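/- Let $d,K\ge 1$. Let $\mathcal T$ be a regular (conforming) triangulation of a bounded polyhedral domain $\Omega\subset\mathbb R^d$: a finite set of closed nondegenerate $d$-simplices, any two of which meet exactly in the (possibly empty) simplex spanned by their common vertices, such that $\Omega$, the interior of their union, is connected. Let $\mathcal N$ be the set of vertices; for $i\in\mathcal N$ let $\omega_i=\{T\in\mathcal T: i\in T\}$ be the patch of $i$ (also identified with the interior of the union of its simplices), and let $\varphi_i$ be the continuous piecewise affine function with $\varphi_i(j)=\delta_{ij}$ for all $j\in\mathcal N$. Let $\mathcal L_k(T)$ be the polynomials of degree at most $k$ on $T$, with $\mathcal L_{-1}(T)=\{0\}$, and for $k\ge0$ let $\mathcal L^1_k(\mathcal T)$, $\mathcal L^1_k(\omega_i)$ be the functions in $W^{1,\infty}$ of $\Omega$, of $\omega_i$, whose restriction to each simplex $T$ lies in $\mathcal L_k(T)$. Let $C_i u$ be the orthogonal projection of $u|_{\omega_i}$ onto $\mathcal L^1_{K-1}(\omega_i)$ with respect to $\langle\varphi_i\,\cdot,\cdot\rangle_{L^2(\omega_i)}$, let $\varphi_i C_i u$ be extended by zero to $\Omega$, and let $C=\sum_{i\in\mathcal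 N}\varphi_iC_i$ on $L^2(\Omega)$. Call $T\ne T'$ in $\mathcal T$ neighbours if they share a vertex, and let $\delta(T,T')$ be the length of a shortest chain of neighbours from $T$ to $T'$. For $T\in\mathcal T$ with barycentric coordinates $\lambda_0,\dots,\lambda_d$ let $D_j^T:\mathcal L_K(T)\to\mathcal L_{K-1}(T)$, $0\le j\le d$, be the linear maps with $D^T_j\lambda^\alpha=\frac{\alpha_j}{K}\lambda^{\alpha-e_j}$ for all multi-indices $\alpha\in\mathbb N_0^{d+1}$ with $|\alpha|=K$ (read as $0$ if $\alpha_j=0$). Let $\mathfrak S:\mathcal L_K(T)\to\mathcal L_K(T)$ be the linear map with $\langle\mathfrak S v,w\rangle_T=\sum_{j=0}^d\langle\lambda_jD_j^Tv,D_j^Tw\rangle_T$ for all $v,w\in\mathcal L_K(T)$. For $v\in\mathcal L^1_K(\mathcal T)$ and $i\in\mathcal N$ let $\mathfrak D_iv$ be the function that equals $D_j^T(v|_T)$ on each $T\in\omega_i$, where $j$ is the index of $i$ in $T$, and that vanishes outside $\omega_i$. Let $\mathcal Z_k=\{v\in\mathcal L_k(T):\langle v,w\rangle_T=0\text{ for all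 }w\in\mathcal L_{k-1}(T)\}$. Then $C_i$, $D^T_j$ and $\mathfrak S$ are well defined (exist uniquely), and the following hold. (C1) $C$ is linear, maps $L^2(\Omega)$ into $\mathcal L^1_K(\mathcal T)$, and is self-adjoint in $L^2(\Omega)$. (C2) $C|_{\mathcal L^1_K(\mathcal T)}$ has a smallest eigenvalue $\lambda_{\min}$ and a largest eigenvalue $\lambda_{\max}$; moreover $\lambda_{\min}>0$, $\langle Cv,v\rangle\ge\lambda_{\min}\|v\|_2^2$ for all $v\in\mathcal L^1_K(\mathcal T)$, and $\kappa:=\mathrm{cond}_2(C|_{\mathcal L^1_K(\mathcal T)})=\lambda_{\max}/\lambda_{\min}\le\frac{2K+d}{K}$. Consequently the decay parameter $q(\kappa)=\frac{\sqrt\kappa-1}{\sqrt\kappa+1}$ satisfies $$q(\kappa)\le q\Big(\frac{2K+d}{K}\Big)=q_{\rm new}:=\frac{\sqrt{2K+d}-\sqrt K}{\sqrt{2K+d}+\sqrt K}.$$ (C3) $\delta$ is a finite integer-valued metric on $\mathcal T$; $\delta(T,T')=1$ holds if and only if $T,T'$ are neighbours, and if and only if $T\ne T'$ and $T\cap T'\ne\emptyset$;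 and $\delta(T,T')$ is the least $N\in\mathbb N_0$ for which there are $T=T_0,\dots,T_N=T'$ in $\mathcal T$ with $\delta(T_{j-1},T_j)=1$ for $j=1,\dots,N$. (C4) If $v\in L^2(\Omega)$ vanishes a.e. outside the union of a collection $L\subset\mathcal T$, and $Cv$ does not vanish a.e. on $T'\in\mathcal T$, then $\delta(T',T)\le1$ for some $T\in L$. (Identity) $Cv=v$ for all $v\in\mathcal L^1_{K-1}(\mathcal T)$. (Decomposition estimate) $\sum_{i\in\mathcal N}\int_\Omega\varphi_i|\mathfrak D_iv|^2\,dx\le\frac{2K+d}{K}\|v\|_2^2$ for all $v\in\mathcal L^1_K(\mathcal T)$. (Eigenvalues) For every $T\in\mathcal T$ the eigenvalues of $\mathfrak S$ are exactly the numbers $\mu_k=\frac{K^2+k(k+d)}{K^2}$, $k=0,\dots,K$, and the eigenspace for $\mu_k$ is $\mathcal Z_k$. -/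

import Mathlib

open MeasureTheory Set
open scoped ENNReal ContDiff

noncomputable section

namespace LagrangeFE

/-! ### Simplices, barycentric coordinates, polynomials -/

/-- The Euclidean space `ℝ^d`. -/
abbrev Pt (d : ℕ) := EuclideanSpace ℝ (Fin d)

/-- Nondegenerate `d`-simplices in `ℝ^d`, with vertices numbered by `0, …, d`. -/
abbrev Simp (d : ℕ) := Affine.Simplex ℝ (Pt d) d

variable {d : ℕ}

/-- The closed simplex as a subset of `ℝ^d`. -/
def body (T : Simp d) : Set (Pt d) := convexHull ℝ (range T.points)

/-- The vertices of a nondegenerate `d`-simplex form an affine basis of `ℝ^d`. -/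
def affBasis (T : Simp d) : AffineBasis (Fin (d + 1)) ℝ (Pt d) where
  toFun := T.points
  ind' := T.independent
  tot' := by
    rw [T.independent.affineSpan_eq_top_iff_card_eq_finrank_add_one]
    simp

/-- The barycentric coordinate `λ_k` of the simplex `T`, as an affine function on `ℝ^d`. -/
def bary (T : Simp d) (k : Fin (d + 1)) (x : Pt d) : ℝ := (affBasis T).coord k x

/-- Polynomials in `d` variables of total degree at most `K`; a polynomial on a nondegenerate
simplex is identified with its (unique) polynomial expression. -/
abbrev Poly (d K : ℕ) : Submodule ℝ (MvPolynomial (Fin d) ℝ) :=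
  MvPolynomial.restrictTotalDegree (Fin d) ℝ K

/-- The value of a polynomial at a point. -/
def evalAt (p : MvPolynomial (Fin d) ℝ) (x : Pt d) : ℝ := MvPolynomial.eval (fun l => x l) p

/-- The barycentric coordinate `λ_k` as a polynomial of degree at most one
(see `evalAt_baryPoly`). -/
def baryPoly (T : Simp d) (k : Fin (d + 1)) : MvPolynomial (Fin d) ℝ :=
  MvPolynomial.C (bary T k 0) +
    ∑ l, MvPolynomial.C (bary T k (EuclideanSpace.single l 1) - bary T k 0) * MvPolynomial.X l

theorem bary_eq (T : Simp d) (k : Fin (d + 1)) (x : Pt d) :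
    bary T k x = (affBasis T).coord k 0 + ((affBasis T).coord k).linear x := by
  have h := ((affBasis T).coord k).map_vadd 0 x
  simp only [vadd_eq_add, add_zero] at h
  rw [bary, h, add_comm]

theorem evalAt_baryPoly (T : Simp d) (k : Fin (d + 1)) (x : Pt d) :
    evalAt (baryPoly T k) x = bary T k x := by
  have hx : x = ∑ l, x l • (EuclideanSpace.single l (1 : ℝ) : Pt d) := by
    ext m
    simp [Finset.sum_apply, Pi.single_apply]
  have h2 : ((affBasis T).coord k).linear x
      = ∑ l, x l * ((affBasis T).coord k).linear (EuclideanSpace.single l (1 : ℝ)) := by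
    conv_lhs => rw [hx]
    simp [map_sum]
  simp only [evalAt, baryPoly, bary_eq, map_add, map_sum, map_mul, MvPolynomial.eval_C,
    MvPolynomial.eval_X, map_zero, h2]
  simp [mul_comm]

theorem baryPoly_totalDegree (T : Simp d) (k : Fin (d + 1)) :
    (baryPoly T k).totalDegree ≤ 1 := by
  refine (MvPolynomial.totalDegree_add _ _).trans (max_le (by simp) ?_)
  refine MvPolynomial.totalDegree_finsetSum_le fun l _ => ?_
  refine (MvPolynomial.totalDegree_mul _ _).trans ?_
  rw [MvPolynomial.totalDegree_C, MvPolynomial.totalDegree_X]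

/-- The barycentric monomial `λ^α = λ_0^{α_0} ⋯ λ_d^{α_d}`. -/
def baryMonomial (T : Simp d) (α : Fin (d + 1) → ℕ) : MvPolynomial (Fin d) ℝ :=
  ∏ k, baryPoly T k ^ α k

theorem baryMonomial_mem (T : Simp d) {K : ℕ} (α : Fin (d + 1) → ℕ) (hα : ∑ k, α k = K) :
    baryMonomial T α ∈ Poly d K := by
  rw [MvPolynomial.mem_restrictTotalDegree, ← hα]
  refine (MvPolynomial.totalDegree_finsetProd _ _).trans (Finset.sum_le_sum fun k _ => ?_)
  refine (MvPolynomial.totalDegree_pow _ _).trans ?_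
  simpa using Nat.mul_le_mul_left (α k) (baryPoly_totalDegree T k)

/-! ### The local operators on one simplex -/

/-- The `L²(T)`-inner product of two polynomials. -/
def ip (T : Simp d) (p q : MvPolynomial (Fin d) ℝ) : ℝ :=
  ∫ x in body T, evalAt p x * evalAt q x

theorem integrable_evalAt_mul (T : Simp d) (p q : MvPolynomial (Fin d) ℝ) :
    Integrable (fun x => evalAt p x * evalAt q x) (volume.restrict (body T)) := by
  have hc : ∀ p : MvPolynomial (Fin d) ℝ, Continuous (evalAt p) := fun p =>
    (MvPolynomial.continuous_eval p).comp
      (by fun_prop : Continuous fun (x : Pt d) => (fun l => x l : Fin d → ℝ))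
  exact ((hc p).mul (hc q)).continuousOn.integrableOn_compact
    ((finite_range T.points).isCompact_convexHull ℝ)

/-- `Z_k`: polynomials of degree at most `k` that are `L²(T)`-orthogonal to all polynomials of
degree less than `k` (no condition if `k = 0`). -/
def Zspace (T : Simp d) (k : ℕ) : Submodule ℝ (MvPolynomial (Fin d) ℝ) where
  carrier := {p | p ∈ Poly d k ∧ ∀ w : MvPolynomial (Fin d) ℝ, w.totalDegree < k → ip T p w = 0}
  zero_mem' := ⟨Submodule.zero_mem _, fun w _ => by simp [ip, evalAt]⟩
  add_mem' := by
    rintro p q ⟨hp, hp'⟩ ⟨hq, hq'⟩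
    refine ⟨Submodule.add_mem _ hp hq, fun w hw => ?_⟩
    have h : ip T (p + q) w = ip T p w + ip T q w := by
      unfold ip
      rw [← integral_add (integrable_evalAt_mul T p w) (integrable_evalAt_mul T q w)]
      simp [evalAt, add_mul]
    rw [h, hp' w hw, hq' w hw, add_zero]
  smul_mem' := by
    rintro c p ⟨hp, hp'⟩
    refine ⟨Submodule.smul_mem _ c hp, fun w hw => ?_⟩
    have h : ip T (c • p) w = c * ip T p w := by
      unfold ip
      rw [← integral_const_mul]
      simp [evalAt, mul_assoc]
    rw [h, hp' w hw, mul_zero]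

/-- `D_0, …, D_d : L_K(T) → L_{K-1}(T)` are the linear maps with
`D_k(λ^α) = (α_k / K) λ^{α - e_k}` for all multi-indices `α` with `|α| = K`
(the coefficient vanishes if `α_k = 0`). -/
def IsLocalDecomp (T : Simp d) (K : ℕ) (D : Fin (d + 1) → (Poly d K →ₗ[ℝ] Poly d (K - 1))) :
    Prop :=
  ∀ (k : Fin (d + 1)) (α : Fin (d + 1) → ℕ) (hα : ∑ j, α j = K),
    (D k ⟨baryMonomial T α, baryMonomial_mem T α hα⟩ : MvPolynomial (Fin d) ℝ)
      = ((α k : ℝ) / K) • baryMonomial T (α - Pi.single k 1)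

open Classical in
/-- The local decomposition operators `D_k^T`. -/
def localDecomp (T : Simp d) (K : ℕ) : Fin (d + 1) → (Poly d K →ₗ[ℝ] Poly d (K - 1)) :=
  if h : ∃ D, IsLocalDecomp T K D then h.choose else 0

/-- `S : L_K(T) → L_K(T)` represents the form `∑_k ⟨λ_k D_k v, D_k w⟩_T`. -/
def IsLocalOp (T : Simp d) (K : ℕ) (S : Module.End ℝ (Poly d K)) : Prop :=
  ∀ v w : Poly d K, ip T (S v) w =
    ∑ k, ∫ x in body T,
      bary T k x * (evalAt (localDecomp T K k v) x * evalAt (localDecomp T K k w) x)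

open Classical in
/-- The local operator `S` of the simplex `T`. -/
def localOp (T : Simp d) (K : ℕ) : Module.End ℝ (Poly d K) :=
  if h : ∃ S, IsLocalOp T K S then h.choose else 0

/-- The number `μ_k = (K² + k (k + d)) / K²`. -/
def muVal (d K k : ℕ) : ℝ := ((K : ℝ) ^ 2 + k * (k + d)) / (K : ℝ) ^ 2

/-! ### Weak derivatives and Lagrange spaces -/

/-- `g` is the weak partial derivative `∂_l u` on the open set `U`. -/
def HasWeakPartial (U : Set (Pt d)) (u g : Pt d → ℝ) (l : Fin d) : Prop :=
  ∀ φ : Pt d → ℝ, ContDiff ℝ ∞ φ → HasCompactSupport φ → tsupport φ ⊆ U →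
    ∫ x in U, u x * fderiv ℝ φ x (EuclideanSpace.single l 1) = - ∫ x in U, g x * φ x

/-- The space `L²(U)`. -/
abbrev L2 (U : Set (Pt d)) := Lp ℝ 2 (volume.restrict U)

/-- Membership in `W^{1,∞}(U)`: bounded with bounded weak partial derivatives. -/
def MemW1inf (U : Set (Pt d)) (u : Pt d → ℝ) : Prop :=
  MemLp u ∞ (volume.restrict U) ∧
    ∀ l, ∃ g : Pt d → ℝ, MemLp g ∞ (volume.restrict U) ∧ HasWeakPartial U u g l

/-- The open domain covered by a finite collection of closed simplices: the interior of
their union. -/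
def region (F : Finset (Simp d)) : Set (Pt d) := interior (⋃ T ∈ F, body T)

theorem interior_subset_region {F : Finset (Simp d)} {T : Simp d} (hT : T ∈ F) :
    interior (body T) ⊆ region F :=
  interior_mono (subset_biUnion_of_mem (u := fun T => body T) hT)

theorem integrable_mul_test {U : Set (Pt d)} {u φ : Pt d → ℝ}
    (hu : MemLp u ∞ (volume.restrict U)) (hφ : Continuous φ) (hs : HasCompactSupport φ) :
    Integrable (fun x => u x * φ x) (volume.restrict U) := by
  have h1 : MemLp φ 1 (volume.restrict U) :=
    memLp_one_iff_integrable.2 (hφ.integrable_of_hasCompactSupport hs)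
  exact hu.integrable_mul h1

theorem continuous_partial {φ : Pt d → ℝ} (hφ : ContDiff ℝ ∞ φ) (l : Fin d) :
    Continuous fun x => fderiv ℝ φ x (EuclideanSpace.single l 1) :=
  (hφ.continuous_fderiv (by simp)).clm_apply continuous_const

theorem hasCompactSupport_partial {φ : Pt d → ℝ} (hs : HasCompactSupport φ) (l : Fin d) :
    HasCompactSupport fun x => fderiv ℝ φ x (EuclideanSpace.single l 1) :=
  hs.fderiv_apply (𝕜 := ℝ) _

theorem MemW1inf.add {U : Set (Pt d)} {u v : Pt d → ℝ} (hu : MemW1inf U u) (hv : MemW1inf U v) :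
    MemW1inf U (u + v) := by
  refine ⟨hu.1.add hv.1, fun l => ?_⟩
  obtain ⟨g, hg, hg'⟩ := hu.2 l
  obtain ⟨f, hf, hf'⟩ := hv.2 l
  refine ⟨g + f, hg.add hf, fun φ h1 h2 h3 => ?_⟩
  have a := integral_add (integrable_mul_test hu.1 (continuous_partial h1 l)
    (hasCompactSupport_partial h2 l)) (integrable_mul_test hv.1 (continuous_partial h1 l)
    (hasCompactSupport_partial h2 l))
  have b := integral_add (integrable_mul_test hg h1.continuous h2)
    (integrable_mul_test hf h1.continuous h2)
  simp only [Pi.add_apply, add_mul]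
  rw [a, b, hg' φ h1 h2 h3, hf' φ h1 h2 h3, neg_add]

theorem MemW1inf.const_smul {U : Set (Pt d)} {u : Pt d → ℝ} (hu : MemW1inf U u) (c : ℝ) :
    MemW1inf U (c • u) := by
  refine ⟨hu.1.const_smul c, fun l => ?_⟩
  obtain ⟨g, hg, hg'⟩ := hu.2 l
  refine ⟨c • g, hg.const_smul c, fun φ h1 h2 h3 => ?_⟩
  simp only [Pi.smul_apply, smul_eq_mul, mul_assoc]
  rw [integral_const_mul, integral_const_mul, hg' φ h1 h2 h3, mul_neg]

theorem MemW1inf.congr {U : Set (Pt d)} {u v : Pt d → ℝ} (hu : MemW1inf U u)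
    (h : u =ᵐ[volume.restrict U] v) : MemW1inf U v := by
  refine ⟨(memLp_congr_ae h).1 hu.1, fun l => ?_⟩
  obtain ⟨g, hg, hg'⟩ := hu.2 l
  refine ⟨g, hg, fun φ h1 h2 h3 => ?_⟩
  rw [← hg' φ h1 h2 h3]
  refine integral_congr_ae ?_
  filter_upwards [h] with x hx
  rw [hx]

theorem memW1inf_zero {U : Set (Pt d)} : MemW1inf U 0 :=
  ⟨MemLp.zero, fun _ => ⟨0, MemLp.zero, fun φ _ _ _ => by simp⟩⟩

/-- The function `v` agrees a.e. on the simplex `T` with the polynomial `p`. -/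
def EqOnCell (T : Simp d) (v : Pt d → ℝ) (p : MvPolynomial (Fin d) ℝ) : Prop :=
  v =ᵐ[volume.restrict (interior (body T))] evalAt p

theorem ae_cell {F : Finset (Simp d)} {T : Simp d} (hT : T ∈ F) {u v : Pt d → ℝ}
    (h : u =ᵐ[volume.restrict (region F)] v) : u =ᵐ[volume.restrict (interior (body T))] v :=
  ae_restrict_of_ae_restrict_of_subset (interior_subset_region hT) h

/-- The Lagrange space of a finite collection `F` of simplices: the functions in `W^{1,∞}` of
the domain covered by `F` that are polynomial of degree at most `K` on each simplex, as a
subspace of `L²` of this domain. -/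
def lagrange (F : Finset (Simp d)) (K : ℕ) : Submodule ℝ (L2 (region F)) where
  carrier := {v | MemW1inf (region F) v ∧ ∀ T ∈ F, ∃ p ∈ Poly d K, EqOnCell T v p}
  zero_mem' := by
    refine ⟨memW1inf_zero.congr (Lp.coeFn_zero _ _ _).symm, fun T hT =>
      ⟨0, Submodule.zero_mem _, (ae_cell hT (Lp.coeFn_zero _ _ _)).trans ?_⟩⟩
    exact Filter.Eventually.of_forall fun x => by simp [evalAt]
  add_mem' := by
    rintro u v ⟨hu, hu'⟩ ⟨hv, hv'⟩
    refine ⟨(hu.add hv).congr (Lp.coeFn_add u v).symm, fun T hT => ?_⟩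
    obtain ⟨p, hp, hp'⟩ := hu' T hT
    obtain ⟨q, hq, hq'⟩ := hv' T hT
    refine ⟨p + q, Submodule.add_mem _ hp hq, ?_⟩
    filter_upwards [ae_cell hT (Lp.coeFn_add u v), hp', hq'] with x h1 h2 h3
    rw [h1, Pi.add_apply, h2, h3]
    simp [evalAt]
  smul_mem' := by
    rintro c u ⟨hu, hu'⟩
    refine ⟨(hu.const_smul c).congr (Lp.coeFn_smul c u).symm, fun T hT => ?_⟩
    obtain ⟨p, hp, hp'⟩ := hu' T hT
    refine ⟨c • p, Submodule.smul_mem _ c hp, ?_⟩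
    filter_upwards [ae_cell hT (Lp.coeFn_smul c u), hp'] with x h1 h2
    rw [h1, Pi.smul_apply, h2]
    simp [evalAt]

/-! ### Triangulations -/

/-- A regular (conforming) triangulation of a bounded polyhedral domain of `ℝ^d` into finitely
many closed nondegenerate simplices: two simplices meet exactly in the simplex spanned by their
common vertices, distinct members have distinct vertex sets, and the interior of the union, which
is the domain, is connected. -/
structure Triangulation (d : ℕ) where
  /-- The simplices of the triangulation. -/
  cells : Finset (Simp d)
  eq_of_range_eq : ∀ T ∈ cells, ∀ T' ∈ cells, range T.points = range T'.points → T = T'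
  inter_eq : ∀ T ∈ cells, ∀ T' ∈ cells,
    body T ∩ body T' = convexHull ℝ (range T.points ∩ range T'.points)
  connected : IsConnected (region cells)

namespace Triangulation

variable (𝒯 : Triangulation d)

/-- The triangulated domain `Ω`. -/
def domain : Set (Pt d) := region 𝒯.cells

open Classical in
/-- The vertices of the triangulation. -/
def vertices : Finset (Pt d) := 𝒯.cells.biUnion fun T => Finset.univ.image T.points

open Classical in
/-- The patch `ω_i`: the collection of simplices that have `i` as a vertex. -/
def patch (i : Pt d) : Finset (Simp d) := 𝒯.cells.filter fun T => i ∈ range T.points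

open Classical in
/-- The Lagrange basis function `φ_i` of degree one: on a simplex with vertex `i` it is the
barycentric coordinate of `i`, and it vanishes on the other simplices
(see `hat_points` and `hat_of_notMem`). -/
def hat (i x : Pt d) : ℝ :=
  if h : ∃ q : Simp d × Fin (d + 1), q.1 ∈ 𝒯.cells ∧ q.1.points q.2 = i ∧ x ∈ body q.1 then
    bary h.choose.1 h.choose.2 x
  else 0

theorem bary_points (T : Simp d) (k j : Fin (d + 1)) :
    bary T k (T.points j) = if k = j then 1 else 0 :=
  (affBasis T).coord_apply k j

theorem bary_affine (T : Simp d) (k : Fin (d + 1)) : ∃ f : Pt d →ᵃ[ℝ] ℝ, ∀ x, f x = bary T k x :=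
  ⟨(affBasis T).coord k, fun _ => rfl⟩

/-- Two affine functions that agree on a set agree on its convex hull. -/
theorem affine_eqOn_convexHull {s : Set (Pt d)} (f g : Pt d →ᵃ[ℝ] ℝ) (h : EqOn f g s) :
    EqOn f g (convexHull ℝ s) := by
  have hc : Convex ℝ {x | f x = g x} := by
    have h0 : Convex ℝ ((f - g) ⁻¹' {0}) := (convex_singleton 0).affine_preimage (f - g)
    convert h0 using 1
    ext x
    simp [sub_eq_zero]
  exact convexHull_min h hc

theorem hat_points {T : Simp d} (hT : T ∈ 𝒯.cells) (k : Fin (d + 1)) {x : Pt d}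
    (hx : x ∈ body T) : 𝒯.hat (T.points k) x = bary T k x := by
  have h : ∃ q : Simp d × Fin (d + 1),
      q.1 ∈ 𝒯.cells ∧ q.1.points q.2 = T.points k ∧ x ∈ body q.1 := ⟨(T, k), hT, rfl, hx⟩
  rw [hat, dif_pos h]
  obtain ⟨h1, h2, h3⟩ := h.choose_spec
  set q := h.choose
  have hx' : x ∈ convexHull ℝ (range q.1.points ∩ range T.points) := by
    rw [← 𝒯.inter_eq _ h1 _ hT]
    exact ⟨h3, hx⟩
  refine affine_eqOn_convexHull ((affBasis q.1).coord q.2) ((affBasis T).coord k) ?_ hx'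
  rintro y ⟨⟨a, ha⟩, ⟨b, hb⟩⟩
  have e1 : (affBasis q.1).coord q.2 y = if q.2 = a then 1 else 0 := by
    rw [← ha]; exact bary_points q.1 q.2 a
  have e2 : (affBasis T).coord k y = if k = b then 1 else 0 := by
    rw [← hb]; exact bary_points T k b
  have e3 : q.2 = a ↔ k = b := by
    rw [← q.1.independent.injective.eq_iff, ← T.independent.injective.eq_iff, h2, ha, hb]
  rw [e1, e2]
  simp only [e3]

theorem hat_of_notMem {T : Simp d} (hT : T ∈ 𝒯.cells) {i x : Pt d} (hi : i ∉ range T.points)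
    (hx : x ∈ body T) : 𝒯.hat i x = 0 := by
  unfold hat
  split_ifs with h
  · obtain ⟨h1, h2, h3⟩ := h.choose_spec
    set q := h.choose
    have hx' : x ∈ convexHull ℝ (range q.1.points ∩ range T.points) := by
      rw [← 𝒯.inter_eq _ h1 _ hT]
      exact ⟨h3, hx⟩
    refine affine_eqOn_convexHull ((affBasis q.1).coord q.2) (AffineMap.const ℝ _ 0) ?_ hx'
    rintro y ⟨⟨a, ha⟩, hy⟩
    have e1 : (affBasis q.1).coord q.2 y = if q.2 = a then 1 else 0 := by
      rw [← ha]; exact bary_points q.1 q.2 a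
    have e3 : q.2 ≠ a := by
      rintro rfl
      exact hi (by rw [← h2, ha]; exact hy)
    simp [e1, e3]
  · rfl

theorem bary_mem_Icc {T : Simp d} {x : Pt d} (hx : x ∈ body T) (k : Fin (d + 1)) :
    bary T k x ∈ Icc (0 : ℝ) 1 := by
  have h0 : ∀ j, 0 ≤ bary T j x := by
    have := (affBasis T).convexHull_eq_nonneg_coord
    intro j
    have hx' : x ∈ convexHull ℝ (range (affBasis T)) := hx
    rw [this] at hx'
    exact hx' j
  refine ⟨h0 k, ?_⟩
  rw [← (affBasis T).sum_coord_apply_eq_one x]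
  exact Finset.single_le_sum (f := fun j => bary T j x) (fun j _ => h0 j) (Finset.mem_univ k)

theorem norm_hat_le (i x : Pt d) : ‖𝒯.hat i x‖ ≤ 1 := by
  unfold hat
  split_ifs with h
  · obtain ⟨-, -, h3⟩ := h.choose_spec
    have := bary_mem_Icc h3 h.choose.2
    rw [Real.norm_eq_abs, abs_le]
    exact ⟨by linarith [this.1], this.2⟩
  · simp

theorem aestronglyMeasurable_hat (i : Pt d) :
    AEStronglyMeasurable (𝒯.hat i) (volume.restrict 𝒯.domain) := by
  have h : AEStronglyMeasurable (𝒯.hat i) (volume.restrict (⋃ T : 𝒯.cells, body T.1)) := by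
    rw [aestronglyMeasurable_iUnion_iff]
    rintro ⟨T, hT⟩
    have hm : MeasurableSet (body T) :=
      ((finite_range T.points).isCompact_convexHull ℝ).isClosed.measurableSet
    by_cases hi : i ∈ range T.points
    · obtain ⟨k, rfl⟩ := hi
      have hc : Continuous (bary T k) := ((affBasis T).coord k).continuous_of_finiteDimensional
      refine hc.aestronglyMeasurable.congr ?_
      filter_upwards [ae_restrict_mem hm] with x hx
      exact (𝒯.hat_points hT k hx).symm
    · refine (aestronglyMeasurable_const (b := (0 : ℝ))).congr ?_
      filter_upwards [ae_restrict_mem hm] with x hx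
      exact (𝒯.hat_of_notMem hT hi hx).symm
  refine h.mono_measure (Measure.restrict_mono ?_ le_rfl)
  refine interior_subset.trans ?_
  rw [iUnion_subtype]

theorem region_patch_subset (i : Pt d) : region (𝒯.patch i) ⊆ 𝒯.domain :=
  interior_mono (biUnion_subset_biUnion_left fun _ hT => (Finset.mem_filter.1 hT).1)

theorem memLp_hat_mul (i : Pt d) (w : L2 (region (𝒯.patch i))) :
    MemLp (fun x => 𝒯.hat i x * (region (𝒯.patch i)).indicator w x) 2
      (volume.restrict 𝒯.domain) := by
  have hm : MeasurableSet (region (𝒯.patch i)) := isOpen_interior.measurableSet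
  have h1 : MemLp ((region (𝒯.patch i)).indicator w) 2 (volume.restrict 𝒯.domain) := by
    rw [memLp_indicator_iff_restrict hm, Measure.restrict_restrict hm,
      inter_eq_self_of_subset_left (𝒯.region_patch_subset i)]
    exact Lp.memLp w
  refine h1.of_le ((𝒯.aestronglyMeasurable_hat i).mul h1.1) (Filter.Eventually.of_forall fun x => ?_)
  rw [norm_mul]
  exact mul_le_of_le_one_left (norm_nonneg _) (𝒯.norm_hat_le i x)

/-- For `w ∈ L²(ω_i)`, the function `φ_i w`, extended by zero to `Ω`. -/
def hatMul (i : Pt d) (w : L2 (region (𝒯.patch i))) : L2 𝒯.domain := (𝒯.memLp_hat_mul i w).toLp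

/-- `w` is the projection of `u` onto the Lagrange space of degree `K - 1` on the patch `ω_i`,
orthogonal with respect to the weighted inner product `⟨φ_i ·, ·⟩` on `ω_i`. -/
def IsWeightedProj (K : ℕ) (i : Pt d) (u : L2 𝒯.domain) (w : L2 (region (𝒯.patch i))) : Prop :=
  w ∈ lagrange (𝒯.patch i) (K - 1) ∧ ∀ v ∈ lagrange (𝒯.patch i) (K - 1),
    ∫ x in region (𝒯.patch i), 𝒯.hat i x * (w x * v x) =
      ∫ x in region (𝒯.patch i), 𝒯.hat i x * (u x * v x)

open Classical in
/-- The local weighted projection `C_i`. -/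
def localProj (K : ℕ) (i : Pt d) (u : L2 𝒯.domain) : L2 (region (𝒯.patch i)) :=
  if h : ∃ w, 𝒯.IsWeightedProj K i u w then h.choose else 0

/-- The operator `C = ∑_i φ_i C_i`. -/
def opC (K : ℕ) (u : L2 𝒯.domain) : L2 𝒯.domain :=
  ∑ i ∈ 𝒯.vertices, 𝒯.hatMul i (𝒯.localProj K i u)

/-- The Lagrange space of degree `K` of the whole triangulation. -/
abbrev space (K : ℕ) : Submodule ℝ (L2 𝒯.domain) := lagrange 𝒯.cells K

/-- The eigenvalues of the restriction of `C` to the Lagrange space of degree `K`. -/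
def eigenvaluesC (K : ℕ) : Set ℝ :=
  {μ | ∃ v ∈ 𝒯.space K, v ≠ 0 ∧ 𝒯.opC K v = μ • v}

/-- The neighbour relation on the simplices: `T ≠ T'` are neighbours if they share a vertex. -/
def neighborGraph : SimpleGraph {T : Simp d // T ∈ 𝒯.cells} where
  Adj T T' := T ≠ T' ∧ (range T.1.points ∩ range T'.1.points).Nonempty
  symm := ⟨fun _ _ h => ⟨h.1.symm, by rw [inter_comm]; exact h.2⟩⟩
  loopless := ⟨fun _ h => h.1 rfl⟩

/-- The distance `δ`: the length of a shortest chain of neighbours. -/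
def delta (T T' : {T : Simp d // T ∈ 𝒯.cells}) : ℕ := 𝒯.neighborGraph.dist T T'

open Classical in
/-- The polynomial of degree at most `K` that represents `v` on the simplex `T`. -/
def cellPoly (K : ℕ) (T : Simp d) (v : Pt d → ℝ) : Poly d K :=
  if h : ∃ p : Poly d K, EqOnCell T v p then h.choose else 0

open Classical in
/-- The global operator `D_i`: on the interior of a simplex `T` with vertex `i`, the function
`D_i v` is the local operator of `T` for this vertex applied to the polynomial `v|_T`; it vanishes
outside the patch of `i`. -/
def globalDecomp (K : ℕ) (i : Pt d) (v : Pt d → ℝ) (x : Pt d) : ℝ :=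
  ∑ T ∈ 𝒯.cells, ∑ k, if T.points k = i then
    (interior (body T)).indicator (evalAt (localDecomp T K k (cellPoly K T v))) x else 0

end Triangulation

/-- The decay parameter `q = (√κ - 1) / (√κ + 1)` that belongs to a condition number `κ`. -/
def decayParam (κ : ℝ) : ℝ := (√κ - 1) / (√κ + 1)

/-- The number `q_new = (√(2K + d) - √K) / (√(2K + d) + √K)`. -/
def qNew (d K : ℕ) : ℝ := (√(2 * K + d) - √K) / (√(2 * K + d) + √K)

end LagrangeFE

end

noncomputable section

namespace LagrangeFE

variable {d : ℕ}

/-! ### Polynomials and their values -/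

/-! `opC` is a sum of local projections glued by the partition of unity `hat`, and its spectrum is
controlled as for an additive Schwarz method. Testing the definition of one projection with the
value of the other gives `inner_opC`: ⟨Cu,w⟩ = ∑ ∫ φ_i (C_i u)(C_i w). Self-adjointness is
immediate, and since each C_i is a contraction in its weighted norm and ∑ φ_i = 1, also ⟨Cv,v⟩ ≤
‖v‖² (`inner_opC_self_le`).

The lower bound needs a stable decomposition v = ∑ φ_i D_i v with D_i v in the local Lagrange space
of degree K-1. Then ‖v‖² = ∑ ∫ φ_i (D_i v)(C_i v), and Young's inequality yields ‖v‖² ≤ μ ⟨Cv,v⟩ as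
soon as ∑ ∫ φ_i |D_i v|² ≤ μ ‖v‖² (`norm_sq_le_inner_opC`). So the spectrum lies in [1/μ, 1], with μ
= (2K+d)/K.

On a simplex, a polynomial of degree at most K is a homogeneous P of degree K in the barycentric
coordinates, and D_j is ∂_j P / K; Euler's identity gives ∑ λ_j D_j p = p. In Cartesian terms D_j p
= p + K⁻¹ (p_j - x)·∇p (`vertexDecomp`), which depends on the vertex p_j but on nothing else of the
simplex. It differentiates only along segments towards that vertex, and for two cells of a patch
such a segment lies in both. Hence D_i v is continuous across cell interfaces
(`compatible_vertexDecomp`), although ∇v jumps there.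

The constant μ is the largest eigenvalue of the local operator. The field λ_i g (p_i - x) has no
flux through the boundary: it is tangential on the faces through p_i, and λ_i vanishes on the
opposite face. This gives an integration by parts for ∂_i in barycentric variables (`integ_radial`,
`integ_toBary_pderiv`) and then `exists_decompForm_eq`: on degree k the operator is μ_k plus terms
of lower degree. Being symmetric and triangular for the degree filtration, it acts as μ_k on the
orthogonal increments Z_k, and the largest value is μ_K = μ.

Membership in W^{1,∞} is handled through an equivalence: a piecewise polynomial function belongs to
it exactly when its cell polynomials agree at common points inside the domain
(`memW1inf_of_compatible`, `MemW1inf.compatible`). -/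

theorem evalAt_ext {p q : MvPolynomial (Fin d) ℝ} (h : ∀ x, evalAt p x = evalAt q x) : p = q :=
  MvPolynomial.funext fun v => by simpa [evalAt] using h (WithLp.toLp 2 v)

@[simp] theorem evalAt_add (p q : MvPolynomial (Fin d) ℝ) (x : Pt d) :
    evalAt (p + q) x = evalAt p x + evalAt q x := by simp [evalAt]

@[simp] theorem evalAt_sub (p q : MvPolynomial (Fin d) ℝ) (x : Pt d) :
    evalAt (p - q) x = evalAt p x - evalAt q x := by simp [evalAt]

@[simp] theorem evalAt_mul (p q : MvPolynomial (Fin d) ℝ) (x : Pt d) :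
    evalAt (p * q) x = evalAt p x * evalAt q x := by simp [evalAt]

@[simp] theorem evalAt_smul (c : ℝ) (p : MvPolynomial (Fin d) ℝ) (x : Pt d) :
    evalAt (c • p) x = c * evalAt p x := by simp [evalAt]

@[simp] theorem evalAt_zero (x : Pt d) : evalAt 0 x = 0 := by simp [evalAt]

@[simp] theorem evalAt_one (x : Pt d) : evalAt 1 x = 1 := by simp [evalAt]

@[simp] theorem evalAt_C (c : ℝ) (x : Pt d) : evalAt (MvPolynomial.C c) x = c := by simp [evalAt]

@[simp] theorem evalAt_X (l : Fin d) (x : Pt d) : evalAt (MvPolynomial.X l) x = x l := by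
  simp [evalAt]

@[simp] theorem evalAt_sum {ι : Type*} (s : Finset ι) (p : ι → MvPolynomial (Fin d) ℝ) (x : Pt d) :
    evalAt (∑ i ∈ s, p i) x = ∑ i ∈ s, evalAt (p i) x := by simp [evalAt]

theorem contDiff_evalAt (p : MvPolynomial (Fin d) ℝ) : ContDiff ℝ ∞ (evalAt p) := by
  induction p using MvPolynomial.induction_on with
  | C a => simpa [funext (evalAt_C a)] using contDiff_const
  | add p q hp hq => simpa [funext (evalAt_add p q)] using hp.add hq
  | mul_X p l hp =>
    have h : ContDiff ℝ ∞ fun x : Pt d => x l := by fun_prop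
    simpa [funext (evalAt_mul p _)] using hp.mul h

@[fun_prop]
theorem continuous_evalAt (p : MvPolynomial (Fin d) ℝ) : Continuous (evalAt p) :=
  (contDiff_evalAt p).continuous

/-- Polynomials that agree a.e. on a nonempty open set are equal. -/
theorem poly_eq_of_ae {U : Set (Pt d)} (hU : IsOpen U) (hne : U.Nonempty)
    {p q : MvPolynomial (Fin d) ℝ} (h : evalAt p =ᵐ[volume.restrict U] evalAt q) : p = q := by
  have h1 : EqOn (evalAt p) (evalAt q) U := Measure.eqOn_open_of_ae_eq h hU
    (continuous_evalAt p).continuousOn (continuous_evalAt q).continuousOn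
  obtain ⟨x, hx⟩ := hne
  have hc : Continuous fun v : Fin d → ℝ => (WithLp.toLp 2 v : Pt d) := PiLp.continuous_toLp 2 _
  have hV : (fun v : Fin d → ℝ => (WithLp.toLp 2 v : Pt d)) ⁻¹' U ∈ nhds (fun l => x l) :=
    (hU.preimage hc).mem_nhds (by simpa using hx)
  obtain ⟨ε, hε, hb⟩ := Metric.mem_nhds_iff.1 hV
  -- The open set contains a sup-norm ball, that is, a product of intervals; a polynomial is
  -- determined by its values on a product of infinite sets.
  refine MvPolynomial.funext_set (fun l => Metric.ball (x l) ε) (fun l => ?_) fun v hv => ?_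
  · rw [Real.ball_eq_Ioo]
    exact Ioo_infinite (by linarith)
  · have h2 : v ∈ Metric.ball (fun l => x l) ε := by
      rw [ball_pi _ hε]
      exact hv
    simpa [evalAt] using h1 (hb h2)

/-! ### The geometry of a simplex -/

theorem isCompact_body (T : Simp d) : IsCompact (body T) :=
  (finite_range T.points).isCompact_convexHull ℝ

theorem convex_body (T : Simp d) : Convex ℝ (body T) := convex_convexHull ℝ _

theorem interior_body (T : Simp d) : interior (body T) = {x | ∀ k, 0 < bary T k x} :=
  (affBasis T).interior_convexHull

theorem body_eq (T : Simp d) : body T = {x | ∀ k, 0 ≤ bary T k x} :=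
  (affBasis T).convexHull_eq_nonneg_coord

theorem interior_body_nonempty (T : Simp d) : (interior (body T)).Nonempty :=
  ⟨_, (affBasis T).centroid_mem_interior_convexHull⟩

theorem closure_interior_body (T : Simp d) : closure (interior (body T)) = body T := by
  rw [(convex_body T).closure_interior_eq_closure_of_nonempty_interior (interior_body_nonempty T),
    (isCompact_body T).isClosed.closure_eq]

theorem interior_body_ae_eq (T : Simp d) : interior (body T) =ᵐ[volume] body T :=
  interior_ae_eq_of_null_frontier ((convex_body T).addHaar_frontier _)

theorem sum_bary (T : Simp d) (x : Pt d) : ∑ k, bary T k x = 1 :=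
  (affBasis T).sum_coord_apply_eq_one x

theorem sum_bary_smul (T : Simp d) (x : Pt d) : ∑ k, bary T k x • T.points k = x :=
  (affBasis T).linear_combination_coord_eq_self x

theorem bary_combo (T : Simp d) (k : Fin (d + 1)) (c x : Pt d) (s : ℝ) :
    bary T k (c + s • (x - c)) = bary T k c + s * (bary T k x - bary T k c) := by
  simp only [bary_eq, map_add, map_smul, map_sub, smul_eq_mul]
  ring

/-! ### Barycentric representation of polynomials -/

/-- Substitution of the barycentric coordinates into a polynomial in `d + 1` variables. -/
def toBary (T : Simp d) : MvPolynomial (Fin (d + 1)) ℝ →ₐ[ℝ] MvPolynomial (Fin d) ℝ :=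
  MvPolynomial.aeval (baryPoly T)

@[simp] theorem toBary_X (T : Simp d) (k : Fin (d + 1)) :
    toBary T (MvPolynomial.X k) = baryPoly T k := by simp [toBary]

theorem toBary_monomial (T : Simp d) (α : Fin (d + 1) →₀ ℕ) (c : ℝ) :
    toBary T (MvPolynomial.monomial α c) = c • baryMonomial T α := by
  rw [toBary, MvPolynomial.aeval_monomial, Finsupp.prod_fintype _ _ (by simp), baryMonomial,
    Algebra.smul_def]

theorem sum_baryPoly (T : Simp d) : ∑ k, baryPoly T k = 1 :=
  evalAt_ext fun x => by simp [evalAt_baryPoly, sum_bary]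

theorem sum_C_mul_baryPoly (T : Simp d) (l : Fin d) :
    ∑ k, MvPolynomial.C (T.points k l) * baryPoly T k = MvPolynomial.X l :=
  evalAt_ext fun x => by
    conv_rhs => rw [evalAt_X, ← sum_bary_smul T x]
    simp [evalAt_baryPoly, Finset.sum_apply, mul_comm]

theorem degree_eq_sum (α : Fin (d + 1) →₀ ℕ) : α.degree = ∑ j, α j := by
  rw [Finsupp.degree_apply, Finset.sum_subset (Finset.subset_univ _)]
  intro j _ hj
  simpa using hj

theorem toBary_mem (T : Simp d) {n : ℕ} {P : MvPolynomial (Fin (d + 1)) ℝ}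
    (hP : P.IsHomogeneous n) : toBary T P ∈ Poly d n := by
  rw [P.as_sum, map_sum]
  refine Submodule.sum_mem _ fun α hα => ?_
  rw [toBary_monomial]
  refine Submodule.smul_mem _ _ (baryMonomial_mem T α ?_)
  rw [← degree_eq_sum]
  by_contra hne
  exact MvPolynomial.mem_support_iff.1 hα (hP.coeff_eq_zero hne)

/-- Every polynomial of degree at most `n` is a homogeneous polynomial of degree `n` in the
barycentric coordinates. -/
theorem exists_toBary_eq (T : Simp d) {n : ℕ} {p : MvPolynomial (Fin d) ℝ} (hp : p ∈ Poly d n) :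
    ∃ P : MvPolynomial (Fin (d + 1)) ℝ, P.IsHomogeneous n ∧ toBary T P = p := by
  have h1 : (∑ k : Fin (d + 1), MvPolynomial.X k : MvPolynomial (Fin (d + 1)) ℝ).IsHomogeneous 1 :=
    MvPolynomial.IsHomogeneous.sum _ _ _ fun k _ => MvPolynomial.isHomogeneous_X _ _
  have h2 : ∀ l : Fin d, (∑ k, MvPolynomial.C (T.points k l) * MvPolynomial.X k :
      MvPolynomial (Fin (d + 1)) ℝ).IsHomogeneous 1 := fun l =>
    MvPolynomial.IsHomogeneous.sum _ _ _ fun k _ => by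
      simpa using (MvPolynomial.isHomogeneous_C _ (T.points k l)).mul
        (MvPolynomial.isHomogeneous_X ℝ k)
  -- Homogenization: each Cartesian variable becomes the linear form ∑ p_k(l) λ_k, and a monomial of
  -- degree |m| is filled up with the power n - |m| of ∑ λ_k = 1.
  refine ⟨∑ m ∈ p.support, MvPolynomial.C (p.coeff m) * ((∑ k, MvPolynomial.X k) ^ (n - m.degree) *
    ∏ l, (∑ k, MvPolynomial.C (T.points k l) * MvPolynomial.X k) ^ m l), ?_, ?_⟩
  · refine MvPolynomial.IsHomogeneous.sum _ _ _ fun m hm => ?_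
    have hm' : m.degree ≤ n := by
      have := (MvPolynomial.le_totalDegree hm).trans
        ((MvPolynomial.mem_restrictTotalDegree _ _ _).1 hp)
      simpa [Finsupp.degree_apply, Finsupp.sum] using this
    have h3 : (∏ l, (∑ k, MvPolynomial.C (T.points k l) * MvPolynomial.X k) ^ m l :
        MvPolynomial (Fin (d + 1)) ℝ).IsHomogeneous (∑ l, m l) :=
      MvPolynomial.IsHomogeneous.prod _ _ _ fun l _ => by simpa using (h2 l).pow (m l)
    have h4 := (MvPolynomial.isHomogeneous_C (Fin (d + 1)) (p.coeff m)).mul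
      ((h1.pow (n - m.degree)).mul h3)
    convert h4 using 1
    have h5 : m.degree = ∑ l, m l := by
      rw [Finsupp.degree_apply, Finset.sum_subset (Finset.subset_univ _)]
      intro j _ hj
      simpa using hj
    omega
  · conv_rhs => rw [p.as_sum]
    rw [map_sum]
    refine Finset.sum_congr rfl fun m _ => ?_
    have hC : ∀ c : ℝ, toBary T (MvPolynomial.C c) = MvPolynomial.C c := fun c => by
      simp [toBary, MvPolynomial.algebraMap_eq]
    simp only [map_mul, map_pow, map_prod, map_sum, toBary_X, hC, sum_baryPoly,
      sum_C_mul_baryPoly, one_pow, one_mul]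
    rw [MvPolynomial.monomial_eq, Finsupp.prod_fintype _ _ (by simp)]

/-! ### Differentiation towards a point -/

/-- The derivation `p ↦ (c - x) · ∇p`. -/
def radial (c : Pt d) : Derivation ℝ (MvPolynomial (Fin d) ℝ) (MvPolynomial (Fin d) ℝ) :=
  MvPolynomial.mkDerivation ℝ fun l => MvPolynomial.C (c l) - MvPolynomial.X l

/-- λ_k is affine, so its derivative in the direction c - x is an exact difference. -/
theorem radial_baryPoly (T : Simp d) (k : Fin (d + 1)) (c : Pt d) :
    radial c (baryPoly T k) = MvPolynomial.C (bary T k c) - baryPoly T k := by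
  refine evalAt_ext fun x => ?_
  have h : ∀ a : ℝ, radial c (MvPolynomial.C a) = 0 := fun a => by simp [radial]
  have hb : ∀ y, bary T k y = bary T k 0 +
      ∑ l, (bary T k (EuclideanSpace.single l 1) - bary T k 0) * y l := fun y => by
    rw [← evalAt_baryPoly T k y]
    simp [baryPoly]
  rw [evalAt_sub, evalAt_C, evalAt_baryPoly, hb c, hb x, add_sub_add_left_eq_sub,
    ← Finset.sum_sub_distrib]
  simp only [baryPoly, map_add, map_sum, Derivation.leibniz, h]
  simp [radial, mul_sub]

/-- Chain rule for the barycentric substitution. The left side depends only on `toBary T P`, whereas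
the individual ∂_m P depend on the choice of P. -/
theorem radial_toBary (T : Simp d) (c : Pt d) (P : MvPolynomial (Fin (d + 1)) ℝ) :
    radial c (toBary T P) = ∑ m, toBary T (MvPolynomial.pderiv m P) *
      (MvPolynomial.C (bary T m c) - baryPoly T m) := by
  induction P using MvPolynomial.induction_on with
  | C a => simp [toBary]
  | add P Q hP hQ => simp only [map_add, hP, hQ, add_mul, Finset.sum_add_distrib]
  | mul_X P k hP =>
    rw [map_mul, Derivation.leibniz, hP, toBary_X, radial_baryPoly]
    simp only [Derivation.leibniz, map_add, smul_eq_mul, map_mul, toBary_X, add_mul,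
      Finset.sum_add_distrib, MvPolynomial.pderiv_X, Finset.mul_sum]
    congr 1
    · rw [Finset.sum_eq_single k]
      · simp
      · intro b _ hb
        simp [hb.symm]
      · simp
    · exact Finset.sum_congr rfl fun m _ => by ring

/-- At a vertex the values λ_m(c) are 0 or 1, so a single partial derivative survives, and Euler's
identity sums the rest to n P. This turns ∂_k of a homogeneous representative into an operator on
the polynomial function itself. -/
theorem radial_toBary_of_isHomogeneous (T : Simp d) (k : Fin (d + 1)) {n : ℕ}
    {P : MvPolynomial (Fin (d + 1)) ℝ} (hP : P.IsHomogeneous n) :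
    radial (T.points k) (toBary T P) =
      toBary T (MvPolynomial.pderiv k P) - (n : ℝ) • toBary T P := by
  have h := congrArg (toBary T) hP.sum_X_mul_pderiv
  rw [map_sum, map_nsmul] at h
  simp only [map_mul, toBary_X] at h
  simp only [radial_toBary, mul_sub, Finset.sum_sub_distrib]
  refine congrArg₂ (· - ·) ?_ ?_
  · rw [Finset.sum_eq_single k]
    · simp [Triangulation.bary_points]
    · intro b _ hb
      simp [Triangulation.bary_points, hb]
    · simp
  · rw [Nat.cast_smul_eq_nsmul, ← h]
    exact Finset.sum_congr rfl fun m _ => mul_comm _ _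

/-- At y = c + s(x - c) the velocity x - c equals -(c - y)/s, whence the factor -1/s. -/
theorem hasDerivAt_evalAt_combo (p : MvPolynomial (Fin d) ℝ) (c x : Pt d) {s : ℝ} (hs : s ≠ 0) :
    HasDerivAt (fun s : ℝ => evalAt p (c + s • (x - c)))
      (-(s⁻¹ * evalAt (radial c p) (c + s • (x - c)))) s := by
  induction p using MvPolynomial.induction_on with
  | C a => simpa [radial] using hasDerivAt_const s a
  | add p q hp hq =>
    simp only [evalAt_add, map_add]
    exact (hp.add hq).congr_deriv (by ring)
  | mul_X p l hp =>
    have h : HasDerivAt (fun s : ℝ => (c + s • (x - c)) l) (x l - c l) s := by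
      have : HasDerivAt (fun s : ℝ => c l + s * (x l - c l)) (x l - c l) s := by
        simpa using ((hasDerivAt_id s).mul_const (x l - c l)).const_add (c l)
      simpa using this
    simp only [evalAt_mul, evalAt_X]
    refine (hp.mul h).congr_deriv ?_
    have e : radial c (MvPolynomial.X l) = MvPolynomial.C (c l) - MvPolynomial.X l := by
      simp [radial]
    rw [Derivation.leibniz, e]
    simp
    field_simp
    ring

/-! ### The local decomposition operators -/

/-- The operator `p ↦ p + K⁻¹ (c - x) · ∇p`, which is the local decomposition operator for the
vertex `c` of any simplex. -/
def vertexDecomp (K : ℕ) (c : Pt d) : MvPolynomial (Fin d) ℝ →ₗ[ℝ] MvPolynomial (Fin d) ℝ :=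
  LinearMap.id + (K : ℝ)⁻¹ • (radial c : MvPolynomial (Fin d) ℝ →ₗ[ℝ] MvPolynomial (Fin d) ℝ)

theorem vertexDecomp_apply (K : ℕ) (c : Pt d) (p : MvPolynomial (Fin d) ℝ) :
    vertexDecomp K c p = p + (K : ℝ)⁻¹ • radial c p := rfl

theorem vertexDecomp_toBary (T : Simp d) {K : ℕ} (hK : 1 ≤ K) (k : Fin (d + 1))
    {P : MvPolynomial (Fin (d + 1)) ℝ} (hP : P.IsHomogeneous K) :
    vertexDecomp K (T.points k) (toBary T P) =
      (K : ℝ)⁻¹ • toBary T (MvPolynomial.pderiv k P) := by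
  have hK' : (K : ℝ) ≠ 0 := by positivity
  rw [vertexDecomp_apply, radial_toBary_of_isHomogeneous T k hP, smul_sub, smul_smul,
    inv_mul_cancel₀ hK', one_smul]
  abel

/-- The drop in degree is a cancellation of the terms of degree K, visible only after passing to a
homogeneous representative, where the result is K⁻¹ ∂_k P. -/
theorem vertexDecomp_mem (T : Simp d) {K : ℕ} (hK : 1 ≤ K) (k : Fin (d + 1))
    {p : MvPolynomial (Fin d) ℝ} (hp : p ∈ Poly d K) :
    vertexDecomp K (T.points k) p ∈ Poly d (K - 1) := by
  obtain ⟨P, hP, rfl⟩ := exists_toBary_eq T hp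
  rw [vertexDecomp_toBary T hK k hP]
  exact Submodule.smul_mem _ _ (toBary_mem T hP.pderiv)

theorem baryMonomial_eq_toBary (T : Simp d) (α : Fin (d + 1) → ℕ) :
    baryMonomial T α = toBary T (MvPolynomial.monomial (Finsupp.equivFunOnFinite.symm α) 1) := by
  rw [toBary_monomial, one_smul]
  simp

theorem isLocalDecomp_vertexDecomp (T : Simp d) {K : ℕ} (hK : 1 ≤ K) :
    IsLocalDecomp T K fun k =>
      (vertexDecomp K (T.points k)).restrict fun _ hp => vertexDecomp_mem T hK k hp := by
  intro k α hα
  have h : (MvPolynomial.monomial (Finsupp.equivFunOnFinite.symm α) (1 : ℝ)).IsHomogeneous K :=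
    MvPolynomial.isHomogeneous_monomial _ (by rw [degree_eq_sum]; simpa using hα)
  rw [LinearMap.coe_restrict_apply]
  simp only
  rw [baryMonomial_eq_toBary, vertexDecomp_toBary T hK k h, MvPolynomial.pderiv_monomial,
    toBary_monomial, smul_smul]
  congr 1
  · simp [div_eq_inv_mul]
  · congr 1
    ext j
    simp [Finsupp.single_apply, Pi.single_apply, eq_comm]

/-- Uniqueness only needs that the barycentric monomials of degree K span. Their linear independence
is never required, because existence comes from the explicit `vertexDecomp`. -/
theorem IsLocalDecomp.eq_vertexDecomp {T : Simp d} {K : ℕ} (hK : 1 ≤ K)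
    {D : Fin (d + 1) → (Poly d K →ₗ[ℝ] Poly d (K - 1))} (hD : IsLocalDecomp T K D)
    (k : Fin (d + 1)) (p : Poly d K) :
    (D k p : MvPolynomial (Fin d) ℝ) = vertexDecomp K (T.points k) p := by
  obtain ⟨p, hp⟩ := p
  obtain ⟨P, hP, rfl⟩ := exists_toBary_eq T hp
  have hα : ∀ α ∈ P.support, ∑ j, α j = K := fun α hα => by
    rw [← degree_eq_sum]
    by_contra hne
    exact MvPolynomial.mem_support_iff.1 hα (hP.coeff_eq_zero hne)
  have e : (⟨toBary T P, hp⟩ : Poly d K) = ∑ α ∈ P.support.attach,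
      P.coeff α.1 • ⟨baryMonomial T α.1, baryMonomial_mem T α.1 (hα _ α.2)⟩ := by
    apply Subtype.ext
    simp only [Submodule.coe_sum, Submodule.coe_smul]
    conv_lhs => rw [P.as_sum, map_sum]
    rw [Finset.sum_attach P.support fun α => P.coeff α • baryMonomial T α]
    simp only [toBary_monomial]
  have h2 : ∀ q : Poly d K, vertexDecomp K (T.points k) (q : MvPolynomial (Fin d) ℝ) =
      ((vertexDecomp K (T.points k)).restrict fun _ hp => vertexDecomp_mem T hK k hp) q :=
    fun q => rfl
  rw [h2, e, map_sum, map_sum, Submodule.coe_sum, Submodule.coe_sum]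
  refine Finset.sum_congr rfl fun α _ => ?_
  rw [map_smul, map_smul, Submodule.coe_smul, Submodule.coe_smul, hD k _ (hα _ α.2),
    isLocalDecomp_vertexDecomp T hK k _ (hα _ α.2)]

theorem existsUnique_isLocalDecomp (T : Simp d) {K : ℕ} (hK : 1 ≤ K) :
    ∃! D, IsLocalDecomp T K D := by
  refine ⟨_, isLocalDecomp_vertexDecomp T hK, fun D hD => ?_⟩
  funext k
  ext1 p
  exact Subtype.ext (hD.eq_vertexDecomp hK k p)

theorem localDecomp_eq (T : Simp d) {K : ℕ} (hK : 1 ≤ K) (k : Fin (d + 1)) (p : Poly d K) :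
    (localDecomp T K k p : MvPolynomial (Fin d) ℝ) = vertexDecomp K (T.points k) p := by
  have h : ∃ D, IsLocalDecomp T K D := (existsUnique_isLocalDecomp T hK).exists
  rw [localDecomp, dif_pos h]
  exact h.choose_spec.eq_vertexDecomp hK k p

/-- Euler's identity for the decomposition operators. -/
theorem sum_bary_mul_vertexDecomp (T : Simp d) {K : ℕ} (hK : 1 ≤ K)
    {p : MvPolynomial (Fin d) ℝ} (hp : p ∈ Poly d K) (x : Pt d) :
    ∑ k, bary T k x * evalAt (vertexDecomp K (T.points k) p) x = evalAt p x := by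
  have hK' : (K : ℝ) ≠ 0 := by positivity
  obtain ⟨P, hP, rfl⟩ := exists_toBary_eq T hp
  have h := congrArg (fun q => evalAt (toBary T q) x) hP.sum_X_mul_pderiv
  rw [← Nat.cast_smul_eq_nsmul ℝ, map_smul, evalAt_smul] at h
  simp only [map_sum, map_mul, toBary_X, evalAt_sum, evalAt_mul, evalAt_baryPoly] at h
  simp only [vertexDecomp_toBary T hK _ hP, evalAt_smul]
  rw [← mul_right_inj' hK', ← h, Finset.mul_sum]
  refine Finset.sum_congr rfl fun k _ => ?_
  field_simp

/-! ### Integrals of barycentric polynomials -/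

theorem volume_body_lt_top (T : Simp d) : volume (body T) < ⊤ := (isCompact_body T).measure_lt_top

theorem measurableSet_body (T : Simp d) : MeasurableSet (body T) :=
  (isCompact_body T).isClosed.measurableSet

theorem integrableOn_evalAt (T : Simp d) (p : MvPolynomial (Fin d) ℝ) :
    IntegrableOn (evalAt p) (body T) :=
  (continuous_evalAt p).continuousOn.integrableOn_compact (isCompact_body T)

/-- The integral of a polynomial over a simplex. -/
def integ (T : Simp d) : MvPolynomial (Fin d) ℝ →ₗ[ℝ] ℝ where
  toFun p := ∫ x in body T, evalAt p x
  map_add' p q := by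
    simp only [evalAt_add]
    exact integral_add (integrableOn_evalAt T p) (integrableOn_evalAt T q)
  map_smul' c p := by
    simp only [evalAt_smul, RingHom.id_apply, smul_eq_mul]
    exact integral_const_mul _ _

theorem integ_apply (T : Simp d) (p : MvPolynomial (Fin d) ℝ) :
    integ T p = ∫ x in body T, evalAt p x := rfl

theorem ip_eq_integ (T : Simp d) (p q : MvPolynomial (Fin d) ℝ) : ip T p q = integ T (p * q) := by
  simp [ip, integ_apply]

/-- The image of the simplex `T` under the homothety with ratio `s` centred at a vertex. -/
def shrink (T : Simp d) (i : Fin (d + 1)) (s : ℝ) : Set (Pt d) :=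
  AffineMap.homothety (T.points i) s '' body T

theorem homothety_apply' (c x : Pt d) (s : ℝ) : AffineMap.homothety c s x = c + s • (x - c) := by
  simp [AffineMap.homothety_apply, add_comm]

theorem bary_shrink (T : Simp d) (i k : Fin (d + 1)) (s : ℝ) (x : Pt d) :
    bary T k (T.points i + s • (x - T.points i)) =
      (if k = i then 1 - s else 0) + s * bary T k x := by
  rw [bary_combo, Triangulation.bary_points]
  split_ifs <;> ring

theorem shrink_subset (T : Simp d) (i : Fin (d + 1)) {s : ℝ} (h0 : 0 ≤ s) (h1 : s ≤ 1) :
    shrink T i s ⊆ body T := by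
  rintro _ ⟨x, hx, rfl⟩
  rw [body_eq] at hx ⊢
  intro k
  rw [homothety_apply', bary_shrink]
  have := mul_nonneg h0 (hx k)
  split_ifs <;> linarith

/-- The shrunken simplex is the part of T where λ_i ≥ 1 - s. On the layer that is cut off, λ_i is
therefore small, which will replace the vanishing boundary flux. -/
theorem bary_lt_of_notMem_shrink (T : Simp d) (i : Fin (d + 1)) {s : ℝ} (h0 : 0 < s)
    {x : Pt d} (hx : x ∈ body T) (hxs : x ∉ shrink T i s) : bary T i x < 1 - s := by
  by_contra! hge
  refine hxs ⟨T.points i + s⁻¹ • (x - T.points i), ?_, ?_⟩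
  · rw [body_eq] at hx ⊢
    intro k
    rw [bary_shrink]
    split_ifs with h
    · subst h
      have : 0 ≤ s⁻¹ * (s - 1 + bary T k x) := mul_nonneg (by positivity) (by linarith)
      have e : s⁻¹ * s = 1 := inv_mul_cancel₀ h0.ne'
      nlinarith
    · have := mul_nonneg (inv_nonneg.2 h0.le) (hx k)
      linarith
  · rw [homothety_apply', add_sub_cancel_left, smul_smul, mul_inv_cancel₀ h0.ne', one_smul,
      add_sub_cancel]

theorem isCompact_shrink (T : Simp d) (i : Fin (d + 1)) (s : ℝ) : IsCompact (shrink T i s) := by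
  refine (isCompact_body T).image ?_
  simp only [funext (homothety_apply' (T.points i) · s)]
  fun_prop

theorem volume_real_shrink (T : Simp d) (i : Fin (d + 1)) {s : ℝ} (h0 : 0 ≤ s) :
    volume.real (shrink T i s) = s ^ d * volume.real (body T) := by
  rw [Measure.real, shrink, Measure.addHaar_image_homothety, ENNReal.toReal_mul,
    ENNReal.toReal_ofReal (abs_nonneg _), abs_of_nonneg (by positivity), finrank_euclideanSpace,
    Fintype.card_fin, Measure.real]

theorem integral_shrink (T : Simp d) (i : Fin (d + 1)) {s : ℝ} (h0 : 0 < s) (f : Pt d → ℝ) :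
    ∫ x in shrink T i s, f x =
      s ^ d * ∫ x in body T, f (T.points i + s • (x - T.points i)) := by
  have hd : ∀ x ∈ body T, HasFDerivWithinAt (AffineMap.homothety (T.points i) s)
      (s • ContinuousLinearMap.id ℝ (Pt d)) (body T) x := fun x _ => by
    rw [funext (homothety_apply' (T.points i) · s)]
    exact ((((hasFDerivAt_id x).sub_const (T.points i)).const_smul s).const_add
      (T.points i)).hasFDerivWithinAt
  have hi : InjOn (AffineMap.homothety (T.points i) s) (body T) := fun x _ y _ h => by
    simpa [homothety_apply', h0.ne'] using h
  rw [shrink, integral_image_eq_integral_abs_det_fderiv_smul volume (measurableSet_body T) hd hi]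
  have e : (s • ContinuousLinearMap.id ℝ (Pt d)).det = s ^ d := by
    simp [ContinuousLinearMap.det]
  simp only [e, abs_of_pos (pow_pos h0 d), smul_eq_mul, homothety_apply']
  rw [integral_const_mul]

/-- The divergence theorem for the field `λ_i g (p_i - x)`, whose flux through the boundary of
the simplex vanishes. -/
theorem integ_radial (T : Simp d) (i : Fin (d + 1)) (g : MvPolynomial (Fin d) ℝ) :
    integ T (radial (T.points i) (baryPoly T i * g)) = d * integ T (baryPoly T i * g) := by
  set f := baryPoly T i * g with hf
  set c := T.points i
  obtain ⟨M, hM⟩ := (isCompact_body T).exists_bound_of_continuousOn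
    (continuous_evalAt g).continuousOn
  -- For s > 0, Ψ(s) is the integral of f over the simplex shrunk towards c. Its derivative at 1 is
  -- computed in two ways: under the integral sign, and by estimating the layer that is removed.
  set Ψ : ℝ → ℝ := fun s => s ^ d * ∫ x in body T, evalAt f (c + s • (x - c)) with hΨ
  have hder : HasDerivAt Ψ (d * integ T f - integ T (radial c f)) 1 := by
    have hcomp : IsCompact (Icc (1 / 2 : ℝ) 2 ×ˢ body T) := isCompact_Icc.prod (isCompact_body T)
    have hco : ContinuousOn (fun q : ℝ × Pt d =>
        -(q.1⁻¹ * evalAt (radial c f) (c + q.1 • (q.2 - c)))) (Icc (1 / 2 : ℝ) 2 ×ˢ body T) := by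
      refine (ContinuousOn.mul ?_ ?_).neg
      · refine continuousOn_fst.inv₀ fun q hq => ?_
        have := hq.1.1
        linarith
      · exact Continuous.continuousOn (by fun_prop)
    obtain ⟨B, hB⟩ := hcomp.exists_bound_of_continuousOn hco
    have h := (hasDerivAt_integral_of_dominated_loc_of_deriv_le
      (μ := volume.restrict (body T)) (F := fun (s : ℝ) x => evalAt f (c + s • (x - c)))
      (F' := fun (s : ℝ) x => -(s⁻¹ * evalAt (radial c f) (c + s • (x - c)))) (x₀ := 1)
      (bound := fun _ => B) (Icc_mem_nhds (by norm_num : (1 / 2 : ℝ) < 1) one_lt_two)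
      (Filter.Eventually.of_forall fun s => by
        exact (Continuous.aestronglyMeasurable (by fun_prop)))
      (by simpa using (integrableOn_evalAt T f).integrable)
      (by exact (Continuous.aestronglyMeasurable (by fun_prop)))
      (by
        filter_upwards [ae_restrict_mem (measurableSet_body T)] with x hx s hs
        exact hB (s, x) ⟨hs, hx⟩)
      (by exact integrableOn_const (volume_body_lt_top T).ne)
      (by
        filter_upwards with x s hs
        exact hasDerivAt_evalAt_combo f c x (by
          rintro rfl
          norm_num at hs))).2
    refine ((hasDerivAt_pow d (1 : ℝ)).mul h).congr_deriv ?_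
    simp [integ_apply, integral_neg]
    ring
  -- On the removed layer |f| ≤ M(1 - s), and the volume of the layer tends to 0; so Ψ(1) - Ψ(s) =
  -- o(1 - s). A left derivative is enough because Ψ is differentiable at 1.
  have hzero : HasDerivWithinAt Ψ 0 (Iic 1) 1 := by
    rw [hasDerivWithinAt_iff_isLittleO, Asymptotics.isLittleO_iff]
    intro ε hε
    have hlim : Filter.Tendsto (fun s : ℝ => M * ((1 - s ^ d) * volume.real (body T)))
        (nhds 1) (nhds 0) := by
      have : Continuous fun s : ℝ => M * ((1 - s ^ d) * volume.real (body T)) := by fun_prop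
      simpa using this.tendsto 1
    have hev := (hlim.eventually (gt_mem_nhds hε)).filter_mono
      (nhdsWithin_le_nhds (s := Iic 1))
    filter_upwards [hev, self_mem_nhdsWithin,
      nhdsWithin_le_nhds (lt_mem_nhds (zero_lt_one (α := ℝ)))] with s hs h1 h0
    have hsub := shrink_subset T i h0.le h1
    have hms := (isCompact_shrink T i s).isClosed.measurableSet
    have e1 : Ψ 1 - Ψ s = ∫ x in body T \ shrink T i s, evalAt f x := by
      rw [setIntegral_sdiff hms (integrableOn_evalAt T f) hsub, integral_shrink T i h0]
      simp [hΨ, c]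
    have e2 : volume.real (body T \ shrink T i s) = (1 - s ^ d) * volume.real (body T) := by
      rw [measureReal_sdiff hsub hms (volume_body_lt_top T).ne, volume_real_shrink T i h0.le]
      ring
    have e3 : ‖∫ x in body T \ shrink T i s, evalAt f x‖ ≤
        ((1 - s) * M) * volume.real (body T \ shrink T i s) := by
      refine norm_setIntegral_le_of_norm_le_const
        ((measure_mono sdiff_subset).trans_lt (volume_body_lt_top T)) fun x hx => ?_
      rw [hf, evalAt_mul, evalAt_baryPoly, norm_mul]
      have h2 := Triangulation.bary_mem_Icc hx.1 i
      rw [Real.norm_of_nonneg h2.1]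
      exact mul_le_mul (bary_lt_of_notMem_shrink T i h0 hx.1 hx.2).le (hM x hx.1)
        (norm_nonneg _) (sub_nonneg.2 h1)
    rw [smul_zero, sub_zero, norm_sub_rev, e1]
    refine e3.trans ?_
    have h1' : s ≤ 1 := h1
    rw [e2, Real.norm_eq_abs, abs_sub_comm, abs_of_nonneg (sub_nonneg.2 h1')]
    calc (1 - s) * M * ((1 - s ^ d) * volume.real (body T))
        = (M * ((1 - s ^ d) * volume.real (body T))) * (1 - s) := by ring
      _ ≤ ε * (1 - s) := mul_le_mul_of_nonneg_right hs.le (sub_nonneg.2 h1')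
  have := (uniqueDiffWithinAt_Iic (1 : ℝ)).eq_deriv _ hder.hasDerivWithinAt hzero
  linarith

/-- X_i F has degree n + 1, so the derivation towards p_i is ∂_i - (n + 1) on it, while
`integ_radial` evaluates its integral with the factor d. -/
theorem integ_toBary_pderiv (T : Simp d) (i : Fin (d + 1)) {n : ℕ}
    {F : MvPolynomial (Fin (d + 1)) ℝ} (hF : F.IsHomogeneous n) :
    integ T (toBary T (MvPolynomial.pderiv i (MvPolynomial.X i * F))) =
      (n + 1 + d) * integ T (toBary T (MvPolynomial.X i * F)) := by
  have h1 : (MvPolynomial.X i * F).IsHomogeneous (1 + n) :=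
    (MvPolynomial.isHomogeneous_X ℝ i).mul hF
  have h2 := radial_toBary_of_isHomogeneous T i h1
  have h3 := integ_radial T i (toBary T F)
  rw [← toBary_X, ← map_mul, h2, map_sub, map_smul, smul_eq_mul] at h3
  push_cast at h3
  linarith

theorem pderiv_eq_zero_of_isHomogeneous_zero {P : MvPolynomial (Fin (d + 1)) ℝ}
    (hP : P.IsHomogeneous 0) (i : Fin (d + 1)) : MvPolynomial.pderiv i P = 0 := by
  have h : P.totalDegree = 0 := Nat.le_zero.1 hP.totalDegree_le
  rw [MvPolynomial.totalDegree_eq_zero_iff_eq_C.1 h, MvPolynomial.pderiv_C]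

/-- Green's formula for the form `∑_j ∫ λ_j ∂_j P ∂_j Q`. -/
theorem sum_integ_pderiv_mul_pderiv (T : Simp d) {k m : ℕ} {P Q : MvPolynomial (Fin (d + 1)) ℝ}
    (hP : P.IsHomogeneous k) (hQ : Q.IsHomogeneous m) :
    ∑ j, integ T (toBary T (MvPolynomial.X j * (MvPolynomial.pderiv j P * MvPolynomial.pderiv j Q)))
      = k * (k + m + d) * integ T (toBary T (P * Q)) -
        integ T (toBary T ((∑ j, MvPolynomial.pderiv j (MvPolynomial.X j * MvPolynomial.pderiv j P))
          * Q)) := by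
  -- The degree k - 1 of ∂_j P is a truncated subtraction, so constants are treated apart; for them
  -- all terms vanish.
  rcases Nat.eq_zero_or_pos k with rfl | hk
  · simp [pderiv_eq_zero_of_isHomogeneous_zero hP]
  have h : ∀ j, integ T (toBary T
      (MvPolynomial.X j * (MvPolynomial.pderiv j P * MvPolynomial.pderiv j Q))) =
      (k + m + d) * integ T (toBary T (MvPolynomial.X j * MvPolynomial.pderiv j P * Q)) -
      integ T (toBary T (MvPolynomial.pderiv j (MvPolynomial.X j * MvPolynomial.pderiv j P) * Q)) := by
    intro j
    have h1 := integ_toBary_pderiv T j (hP.pderiv (i := j) |>.mul hQ)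
    have e : MvPolynomial.pderiv j (MvPolynomial.X j * (MvPolynomial.pderiv j P * Q)) =
        MvPolynomial.X j * (MvPolynomial.pderiv j P * MvPolynomial.pderiv j Q) +
        MvPolynomial.pderiv j (MvPolynomial.X j * MvPolynomial.pderiv j P) * Q := by
      rw [← mul_assoc, Derivation.leibniz, smul_eq_mul, smul_eq_mul]
      ring
    rw [e, map_add, map_add, ← mul_assoc (MvPolynomial.X j) (MvPolynomial.pderiv j P) Q] at h1
    have e2 : ((k - 1 + m : ℕ) : ℝ) + 1 + d = k + m + d := by
      have : k - 1 + m + 1 = k + m := by omega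
      exact_mod_cast congrArg (· + d) this
    rw [e2] at h1
    linarith
  rw [Finset.sum_congr rfl fun j _ => h j, Finset.sum_sub_distrib, ← Finset.mul_sum, ← map_sum,
    ← map_sum, ← map_sum, ← map_sum, ← Finset.sum_mul, ← Finset.sum_mul, hP.sum_X_mul_pderiv,
    ← Nat.cast_smul_eq_nsmul ℝ, smul_mul_assoc, map_smul, map_smul, smul_eq_mul]
  ring

/-! ### The eigenvalues of the local operator -/

/-- A positive definite form on a finite-dimensional space represents every functional. -/
theorem existsUnique_represents {W : Type*} [AddCommGroup W] [Module ℝ W] [FiniteDimensional ℝ W]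
    (B : W →ₗ[ℝ] W →ₗ[ℝ] ℝ) (hB : ∀ w, B w w = 0 → w = 0) (f : W →ₗ[ℝ] ℝ) :
    ∃! w, ∀ z, B w z = f z := by
  have hinj : Function.Injective B := by
    rw [← LinearMap.ker_eq_bot, LinearMap.ker_eq_bot']
    intro w hw
    exact hB w (by simp [hw])
  have hsurj : Function.Surjective B :=
    (LinearMap.injective_iff_surjective_of_finrank_eq_finrank
      (Subspace.dual_finrank_eq (K := ℝ) (V := W)).symm).1 hinj
  obtain ⟨w, hw⟩ := hsurj f
  refine ⟨w, fun z => by rw [hw], fun w' hw' => hinj ?_⟩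
  rw [hw]
  exact LinearMap.ext hw'

/-- The `L²(T)`-inner product as a bilinear form. -/
def ipForm (T : Simp d) :
    MvPolynomial (Fin d) ℝ →ₗ[ℝ] MvPolynomial (Fin d) ℝ →ₗ[ℝ] ℝ :=
  (LinearMap.mul ℝ (MvPolynomial (Fin d) ℝ)).compr₂ (integ T)

theorem ipForm_apply (T : Simp d) (p q : MvPolynomial (Fin d) ℝ) : ipForm T p q = ip T p q := by
  rw [ip_eq_integ]; rfl

theorem ip_comm (T : Simp d) (p q : MvPolynomial (Fin d) ℝ) : ip T p q = ip T q p := by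
  rw [ip_eq_integ, ip_eq_integ, mul_comm]

theorem ip_self_nonneg (T : Simp d) (p : MvPolynomial (Fin d) ℝ) : 0 ≤ ip T p p :=
  integral_nonneg fun _ => mul_self_nonneg _

theorem eq_zero_of_ip_self (T : Simp d) {p : MvPolynomial (Fin d) ℝ} (h : ip T p p = 0) :
    p = 0 := by
  rw [ip, integral_eq_zero_iff_of_nonneg (fun _ => mul_self_nonneg _)
    (integrable_evalAt_mul T p p)] at h
  refine poly_eq_of_ae isOpen_interior (interior_body_nonempty T) ?_
  filter_upwards [ae_restrict_of_ae_restrict_of_subset interior_subset h] with x hx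
  simpa using hx

/-- The form that defines the local operator. -/
def decompForm (T : Simp d) (K : ℕ) (p q : MvPolynomial (Fin d) ℝ) : ℝ :=
  ∑ k, integ T (baryPoly T k *
    (vertexDecomp K (T.points k) p * vertexDecomp K (T.points k) q))

theorem decompForm_comm (T : Simp d) (K : ℕ) (p q : MvPolynomial (Fin d) ℝ) :
    decompForm T K p q = decompForm T K q p := by
  simp only [decompForm, mul_comm (vertexDecomp K _ p)]

theorem isLocalOp_iff {T : Simp d} {K : ℕ} (hK : 1 ≤ K) {S : Module.End ℝ (Poly d K)} :
    IsLocalOp T K S ↔ ∀ v w : Poly d K, ip T (S v) w = decompForm T K v w := by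
  simp [IsLocalOp, decompForm, integ_apply, localDecomp_eq T hK, evalAt_baryPoly]

theorem existsUnique_isLocalOp (T : Simp d) {K : ℕ} (hK : 1 ≤ K) :
    ∃! S, IsLocalOp T K S := by
  set B : Poly d K →ₗ[ℝ] Poly d K →ₗ[ℝ] ℝ :=
    (ipForm T).compl₁₂ (Poly d K).subtype (Poly d K).subtype
  have hBa : ∀ v w, B v w = ip T v w := fun v w => ipForm_apply T _ _
  have hB : ∀ w, B w w = 0 → w = 0 := fun w hw => by
    rw [hBa] at hw
    exact Subtype.ext (eq_zero_of_ip_self T hw)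
  set A : Poly d K →ₗ[ℝ] Poly d K →ₗ[ℝ] ℝ := LinearMap.mk₂ ℝ
    (fun v w => decompForm T K v w)
    (by intros; simp [decompForm, add_mul, mul_add, Finset.sum_add_distrib])
    (by intros; simp [decompForm, Finset.mul_sum])
    (by intros; simp [decompForm, mul_add, Finset.sum_add_distrib])
    (by intros; simp [decompForm, Finset.mul_sum])
  have hAa : ∀ v w, A v w = decompForm T K v w := fun v w => rfl
  have hinj : Function.Injective B := by
    rw [← LinearMap.ker_eq_bot, LinearMap.ker_eq_bot']
    intro w hw
    exact hB w (by simp [hw])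
  have hsurj : Function.Surjective B := fun f => by
    obtain ⟨w, hw, -⟩ := existsUnique_represents B hB f
    exact ⟨w, LinearMap.ext hw⟩
  set e := LinearEquiv.ofBijective B ⟨hinj, hsurj⟩
  refine ⟨e.symm.toLinearMap ∘ₗ A, ?_, fun S hS => ?_⟩
  · refine (isLocalOp_iff hK).2 fun v w => ?_
    rw [← hBa, ← hAa]
    exact LinearMap.congr_fun (e.apply_symm_apply (A v)) w
  · replace hS := (isLocalOp_iff hK).1 hS
    ext1 v
    apply hinj
    refine LinearMap.ext fun w => ?_
    rw [hBa, hS, ← hAa]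
    exact (LinearMap.congr_fun (e.apply_symm_apply (A v)) w).symm

theorem ip_localOp (T : Simp d) {K : ℕ} (hK : 1 ≤ K) (v w : Poly d K) :
    ip T (localOp T K v) w = decompForm T K v w := by
  have h : ∃ S, IsLocalOp T K S := (existsUnique_isLocalOp T hK).exists
  rw [localOp, dif_pos h]
  exact (isLocalOp_iff hK).1 h.choose_spec v w

/-- The polynomials of degree less than `k`. -/
def belowDeg (d : ℕ) : ℕ → Submodule ℝ (MvPolynomial (Fin d) ℝ)
  | 0 => ⊥
  | k + 1 => Poly d k

instance (k : ℕ) : FiniteDimensional ℝ (belowDeg d k) := by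
  cases k
  · exact inferInstanceAs (FiniteDimensional ℝ (⊥ : Submodule ℝ (MvPolynomial (Fin d) ℝ)))
  · exact inferInstanceAs (FiniteDimensional ℝ (Poly d _))

theorem poly_mono {k l : ℕ} (h : k ≤ l) : Poly d k ≤ Poly d l := fun p hp => by
  rw [MvPolynomial.mem_restrictTotalDegree] at hp ⊢
  exact hp.trans h

theorem belowDeg_le (k : ℕ) : belowDeg d k ≤ Poly d k := by
  cases k
  · exact bot_le
  · exact poly_mono (Nat.le_succ _)

theorem notMem_belowDeg_totalDegree {p : MvPolynomial (Fin d) ℝ} (hp : p ≠ 0) :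
    p ∉ belowDeg d p.totalDegree := by
  intro h
  cases hk : p.totalDegree with
  | zero =>
    rw [hk] at h
    exact hp ((Submodule.mem_bot ℝ).1 h)
  | succ k =>
    rw [hk] at h
    have := (MvPolynomial.mem_restrictTotalDegree _ _ _).1 h
    omega

theorem mem_Zspace_iff (T : Simp d) (k : ℕ) (p : MvPolynomial (Fin d) ℝ) :
    p ∈ Zspace T k ↔ p ∈ Poly d k ∧ ∀ w ∈ belowDeg d k, ip T p w = 0 := by
  refine and_congr_right fun _ => ?_
  cases k with
  | zero => simp [belowDeg, ip]
  | succ k =>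
    refine forall_congr' fun w => imp_congr_left ?_
    rw [belowDeg, MvPolynomial.mem_restrictTotalDegree, Nat.lt_succ_iff]

/-- q is the L²(T)-orthogonal projection of p onto the polynomials of degree below k. -/
theorem exists_sub_mem_Zspace (T : Simp d) {k : ℕ} {p : MvPolynomial (Fin d) ℝ}
    (hp : p ∈ Poly d k) : ∃ q ∈ belowDeg d k, p - q ∈ Zspace T k := by
  set B : belowDeg d k →ₗ[ℝ] belowDeg d k →ₗ[ℝ] ℝ :=
    (ipForm T).compl₁₂ (belowDeg d k).subtype (belowDeg d k).subtype
  have hB : ∀ w, B w w = 0 → w = 0 := fun w hw => by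
    have hw' : ip T w w = 0 := by rw [← ipForm_apply]; exact hw
    exact Subtype.ext (eq_zero_of_ip_self T hw')
  obtain ⟨q, hq, -⟩ := existsUnique_represents B hB (ipForm T p ∘ₗ (belowDeg d k).subtype)
  refine ⟨q, q.2, (mem_Zspace_iff T k _).2 ⟨Submodule.sub_mem _ hp (belowDeg_le k q.2),
    fun w hw => ?_⟩⟩
  have := hq ⟨w, hw⟩
  rw [← ipForm_apply, map_sub, LinearMap.sub_apply, sub_eq_zero]
  exact this.symm

/-- The local operator is triangular for the degree filtration. The diagonal entry collects K(K - k)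
from the zeroth-order part of D_j p and k(k + K + d) from Green's formula; together they are K² +
k(k + d), over K². -/
theorem exists_decompForm_eq (T : Simp d) {k K : ℕ} (hK : 1 ≤ K) (hk : k ≤ K)
    {p : MvPolynomial (Fin d) ℝ} (hp : p ∈ Poly d k) :
    ∃ r ∈ belowDeg d k, ∀ q ∈ Poly d K,
      decompForm T K p q = muVal d K k * ip T p q - ip T r q := by
  have hK' : (K : ℝ) ≠ 0 := by positivity
  obtain ⟨P, hP, rfl⟩ := exists_toBary_eq T hp
  set R : MvPolynomial (Fin (d + 1)) ℝ :=
    ∑ j, MvPolynomial.pderiv j (MvPolynomial.X j * MvPolynomial.pderiv j P) with hR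
  have hRmem : toBary T R ∈ belowDeg d k := by
    cases k with
    | zero => simp [hR, pderiv_eq_zero_of_isHomogeneous_zero hP]
    | succ k =>
      refine toBary_mem T (MvPolynomial.IsHomogeneous.sum _ _ _ fun j _ => ?_)
      have h := ((MvPolynomial.isHomogeneous_X ℝ j).mul (hP.pderiv (i := j))).pderiv (i := j)
      convert h using 1
      omega
  refine ⟨((K : ℝ) ^ 2)⁻¹ • toBary T R, Submodule.smul_mem _ _ hRmem, fun q hq => ?_⟩
  obtain ⟨Q, hQ, rfl⟩ := exists_toBary_eq T hq
  -- P has degree k while the operator is normalized for degree K. The cancellation is therefore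
  -- incomplete and leaves (K - k) P.
  have e1 : ∀ j, vertexDecomp K (T.points j) (toBary T P) =
      (K : ℝ)⁻¹ • (((K : ℝ) - k) • toBary T P + toBary T (MvPolynomial.pderiv j P)) := fun j => by
    rw [vertexDecomp_apply, radial_toBary_of_isHomogeneous T j hP]
    rw [smul_add, smul_smul, mul_sub, inv_mul_cancel₀ hK']
    module
  have e2 : ∀ j, integ T (baryPoly T j * (vertexDecomp K (T.points j) (toBary T P) *
      vertexDecomp K (T.points j) (toBary T Q))) = ((K : ℝ) ^ 2)⁻¹ *
      (((K : ℝ) - k) * integ T (toBary T (P * (MvPolynomial.X j * MvPolynomial.pderiv j Q))) +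
      integ T (toBary T (MvPolynomial.X j *
        (MvPolynomial.pderiv j P * MvPolynomial.pderiv j Q)))) := fun j => by
    have e : baryPoly T j * (vertexDecomp K (T.points j) (toBary T P) *
        vertexDecomp K (T.points j) (toBary T Q)) = ((K : ℝ) ^ 2)⁻¹ •
        (((K : ℝ) - k) • toBary T (P * (MvPolynomial.X j * MvPolynomial.pderiv j Q)) +
        toBary T (MvPolynomial.X j * (MvPolynomial.pderiv j P * MvPolynomial.pderiv j Q))) := by
      rw [e1, vertexDecomp_toBary T hK j hQ]
      refine evalAt_ext fun x => ?_
      simp only [map_mul, toBary_X, evalAt_add, evalAt_mul, evalAt_smul]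
      ring
    rw [e, map_smul, map_add, map_smul, smul_eq_mul, smul_eq_mul]
  have e3 := sum_integ_pderiv_mul_pderiv T hP hQ
  rw [← hR] at e3
  have e4 : ∑ j, integ T (toBary T (P * (MvPolynomial.X j * MvPolynomial.pderiv j Q))) =
      K * integ T (toBary T (P * Q)) := by
    rw [← map_sum, ← map_sum, ← Finset.mul_sum, hQ.sum_X_mul_pderiv, ← Nat.cast_smul_eq_nsmul ℝ,
      mul_smul_comm, map_smul, map_smul, smul_eq_mul]
  rw [decompForm, Finset.sum_congr rfl fun j _ => e2 j, ← Finset.mul_sum, Finset.sum_add_distrib,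
    ← Finset.mul_sum, e3, e4, ip_eq_integ, ip_eq_integ, smul_mul_assoc, map_smul, smul_eq_mul,
    ← map_mul, ← map_mul, muVal]
  field_simp
  ring

/-- The defining relation makes z = Sv - μ_k v + r orthogonal to all polynomials of degree at most
K, in particular to itself. -/
theorem localOp_sub_mem (T : Simp d) {k K : ℕ} (hK : 1 ≤ K) (hk : k ≤ K) {v : Poly d K}
    (hv : (v : MvPolynomial (Fin d) ℝ) ∈ Poly d k) :
    (localOp T K v : MvPolynomial (Fin d) ℝ) - muVal d K k • (v : MvPolynomial (Fin d) ℝ)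
      ∈ belowDeg d k := by
  obtain ⟨r, hr, h⟩ := exists_decompForm_eq T hK hk hv
  set z := (localOp T K v : MvPolynomial (Fin d) ℝ) - muVal d K k • (v : MvPolynomial (Fin d) ℝ) + r
    with hz
  have hzK : z ∈ Poly d K := Submodule.add_mem _ (Submodule.sub_mem _ (localOp T K v).2
    (Submodule.smul_mem _ _ v.2)) (poly_mono hk (belowDeg_le k hr))
  have h0 : ip T z z = 0 := by
    have h1 := h z hzK
    rw [← ip_localOp T hK v ⟨z, hzK⟩] at h1
    simp only [← ipForm_apply] at h1 ⊢
    have hF : ipForm T z = ipForm T (localOp T K v) - muVal d K k • ipForm T v + ipForm T r := by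
      rw [hz, map_add, map_sub, map_smul]
    rw [hF, LinearMap.add_apply, LinearMap.sub_apply,
      LinearMap.smul_apply, smul_eq_mul, h1]
    ring
  have hz0 := eq_zero_of_ip_self T h0
  rw [hz] at hz0
  rw [eq_neg_of_add_eq_zero_left hz0]
  exact Submodule.neg_mem _ hr

theorem localOp_mem (T : Simp d) {k K : ℕ} (hK : 1 ≤ K) (hk : k ≤ K) {v : Poly d K}
    (hv : (v : MvPolynomial (Fin d) ℝ) ∈ belowDeg d k) :
    (localOp T K v : MvPolynomial (Fin d) ℝ) ∈ belowDeg d k := by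
  cases k with
  | zero =>
    have : v = 0 := Subtype.ext ((Submodule.mem_bot ℝ).1 hv)
    rw [this, map_zero]
    exact Submodule.zero_mem _
  | succ k =>
    have h := belowDeg_le k (localOp_sub_mem T hK (Nat.le_of_succ_le hk) hv)
    have h2 := Submodule.add_mem _ h (Submodule.smul_mem _ (muVal d K k) hv)
    rwa [sub_add_cancel] at h2

theorem ip_localOp_comm (T : Simp d) {K : ℕ} (hK : 1 ≤ K) (v w : Poly d K) :
    ip T (localOp T K v) w = ip T v (localOp T K w) := by
  rw [ip_localOp T hK, ip_comm, ip_localOp T hK, decompForm_comm]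

/-- The defect r = Sv - μ_k v has degree below k. By symmetry ⟨Sv, r⟩ = ⟨v, Sr⟩, and S preserves
degree below k, so both this and ⟨v, r⟩ vanish; hence ⟨r, r⟩ = 0. -/
theorem localOp_of_mem_Zspace (T : Simp d) {k K : ℕ} (hK : 1 ≤ K) (hk : k ≤ K) {v : Poly d K}
    (hv : (v : MvPolynomial (Fin d) ℝ) ∈ Zspace T k) : localOp T K v = muVal d K k • v := by
  obtain ⟨hvk, hv0⟩ := (mem_Zspace_iff T k _).1 hv
  have hr := localOp_sub_mem T hK hk hvk
  set r := localOp T K v - muVal d K k • v with hrdef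
  have hr' : (r : MvPolynomial (Fin d) ℝ) ∈ belowDeg d k := hr
  have h0 : ip T r r = 0 := by
    have h1 : ip T (localOp T K v) r = 0 := by
      rw [ip_localOp_comm T hK]
      exact hv0 _ (localOp_mem T hK hk hr')
    have h2 := hv0 _ hr'
    have e : ip T r r = ip T (localOp T K v) r - muVal d K k * ip T v r := by
      simp only [← ipForm_apply]
      have hF := congrArg (fun u : Poly d K => ipForm T u) hrdef
      simp only [AddSubgroupClass.coe_sub, Submodule.coe_smul, map_sub, map_smul] at hF
      rw [hF, LinearMap.sub_apply, LinearMap.smul_apply, smul_eq_mul]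
    rw [e, h1, h2, mul_zero, sub_zero]
  have : r = 0 := Subtype.ext (eq_zero_of_ip_self T h0)
  exact sub_eq_zero.1 this

/-- For k the exact degree of v, triangularity places (μ - μ_k) v below degree k, which forces the
factor to vanish. -/
theorem eq_muVal_of_localOp_eq (T : Simp d) {K : ℕ} (hK : 1 ≤ K) {v : Poly d K} (hv : v ≠ 0)
    {μ : ℝ} (h : localOp T K v = μ • v) :
    μ = muVal d K (v : MvPolynomial (Fin d) ℝ).totalDegree := by
  have hk := (MvPolynomial.mem_restrictTotalDegree _ _ _).1 v.2
  have h1 := localOp_sub_mem T hK hk (v := v)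
    ((MvPolynomial.mem_restrictTotalDegree _ _ _).2 le_rfl)
  rw [h, Submodule.coe_smul, ← sub_smul] at h1
  by_contra hne
  have h2 := Submodule.smul_mem _ (μ - muVal d K (v : MvPolynomial (Fin d) ℝ).totalDegree)⁻¹ h1
  rw [smul_smul, inv_mul_cancel₀ (sub_ne_zero.2 hne), one_smul] at h2
  exact notMem_belowDeg_totalDegree (fun h0 => hv (Subtype.ext h0)) h2

theorem muVal_strictMono {K : ℕ} (hK : 1 ≤ K) : StrictMono (muVal d K) := by
  intro k l hkl
  have hkl' : (k : ℝ) < l := by exact_mod_cast hkl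
  have hk0 : (0 : ℝ) ≤ k := by positivity
  have hd0 : (0 : ℝ) ≤ d := by positivity
  unfold muVal
  refine div_lt_div_of_pos_right ?_ (by positivity)
  nlinarith

theorem muVal_self {K : ℕ} (hK : 1 ≤ K) : muVal d K K = (2 * K + d) / K := by
  have hK' : (K : ℝ) ≠ 0 := by positivity
  unfold muVal
  field_simp
  ring

/-- An eigenvector v has exact degree k or is zero, as the μ_k are distinct. Its projection q to
lower degree is again an eigenvector for μ_k, because v - q is one; but a nonzero q would then have
degree k, so q = 0. -/
theorem eigenspace_localOp (T : Simp d) {k K : ℕ} (hK : 1 ≤ K) (hk : k ≤ K) :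
    Module.End.eigenspace (localOp T K) (muVal d K k) =
      (Zspace T k).comap (Poly d K).subtype := by
  ext v
  rw [Module.End.mem_eigenspace_iff, Submodule.mem_comap]
  refine ⟨fun h => ?_, localOp_of_mem_Zspace T hK hk⟩
  rcases eq_or_ne v 0 with rfl | hv
  · exact Submodule.zero_mem _
  have hdeg := (muVal_strictMono hK).injective (eq_muVal_of_localOp_eq T hK hv h)
  have hvk : (v : MvPolynomial (Fin d) ℝ) ∈ Poly d k := by
    rw [MvPolynomial.mem_restrictTotalDegree, hdeg]
  obtain ⟨q, hq, hz⟩ := exists_sub_mem_Zspace T hvk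
  set q' : Poly d K := ⟨q, poly_mono hk (belowDeg_le k hq)⟩
  have h1 : localOp T K (v - q') = muVal d K k • (v - q') := localOp_of_mem_Zspace T hK hk hz
  rw [map_sub, h, smul_sub] at h1
  have h2 := sub_right_injective h1
  have hq0 : q' = 0 := by
    by_contra hne
    have hd' := (muVal_strictMono hK).injective (eq_muVal_of_localOp_eq T hK hne h2)
    refine notMem_belowDeg_totalDegree (p := q) (fun h0 => hne (Subtype.ext h0)) ?_
    change k = q.totalDegree at hd'
    rwa [← hd']
  have hq00 : q = 0 := congrArg Subtype.val hq0
  rw [hq00, sub_zero] at hz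
  exact hz

/-- A polynomial of exact degree k must exist; a power of a coordinate serves, and this is where d ≥
1 enters. -/
theorem hasEigenvalue_localOp (hd : 1 ≤ d) (T : Simp d) {k K : ℕ} (hK : 1 ≤ K) (hk : k ≤ K) :
    Module.End.HasEigenvalue (localOp T K) (muVal d K k) := by
  set p : MvPolynomial (Fin d) ℝ := MvPolynomial.X ⟨0, hd⟩ ^ k
  have hp : p.totalDegree = k := MvPolynomial.totalDegree_X_pow _ _
  have hpk : p ∈ Poly d k := (MvPolynomial.mem_restrictTotalDegree _ _ _).2 hp.le
  obtain ⟨q, hq, hz⟩ := exists_sub_mem_Zspace T hpk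
  have hne : p - q ≠ 0 := by
    intro h0
    rw [← sub_eq_zero.1 h0] at hq
    refine notMem_belowDeg_totalDegree (p := p) (pow_ne_zero _ (MvPolynomial.X_ne_zero _)) ?_
    rwa [hp]
  have hmem : p - q ∈ Poly d K :=
    poly_mono hk (Submodule.sub_mem _ hpk (belowDeg_le k hq))
  refine Module.End.hasEigenvalue_of_hasEigenvector (x := (⟨p - q, hmem⟩ : Poly d K)) ⟨?_, ?_⟩
  · exact Module.End.mem_eigenspace_iff.2 (localOp_of_mem_Zspace T hK hk hz)
  · exact fun h0 => hne (congrArg Subtype.val h0)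

theorem exists_eq_muVal_of_hasEigenvalue (T : Simp d) {K : ℕ} (hK : 1 ≤ K) {μ : ℝ}
    (h : Module.End.HasEigenvalue (localOp T K) μ) : ∃ k ≤ K, μ = muVal d K k := by
  obtain ⟨v, hv, hv0⟩ := h.exists_hasEigenvector
  exact ⟨_, (MvPolynomial.mem_restrictTotalDegree _ _ _).1 v.2,
    eq_muVal_of_localOp_eq T hK hv0 (Module.End.mem_eigenspace_iff.1 hv)⟩

/-- Induction on the degree peels off the component in Z_k. It is orthogonal to the remainder and to
its image under S, so both quadratic forms split, and the μ_k increase. -/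
theorem ip_localOp_le (T : Simp d) {K : ℕ} (hK : 1 ≤ K) (k : ℕ) (hk : k ≤ K) (v : Poly d K)
    (hv : (v : MvPolynomial (Fin d) ℝ) ∈ Poly d k) :
    ip T (localOp T K v) v ≤ muVal d K k * ip T v v := by
  induction k generalizing v with
  | zero =>
    obtain ⟨q, hq, hz⟩ := exists_sub_mem_Zspace T hv
    rw [(Submodule.mem_bot ℝ).1 hq, sub_zero] at hz
    rw [localOp_of_mem_Zspace T hK hk hz, ← ipForm_apply, ← ipForm_apply, Submodule.coe_smul,
      map_smul, LinearMap.smul_apply, smul_eq_mul]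
  | succ k ih =>
    obtain ⟨q, hq, hz⟩ := exists_sub_mem_Zspace T hv
    have hqk : q ∈ Poly d k := hq
    set q' : Poly d K := ⟨q, poly_mono hk (belowDeg_le _ hq)⟩ with hq'
    set z : Poly d K := v - q' with hzdef
    have hz' : (z : MvPolynomial (Fin d) ℝ) ∈ Zspace T (k + 1) := hz
    have h1 := localOp_of_mem_Zspace T hK hk hz'
    have h2 := ih (Nat.le_of_succ_le hk) q' hqk
    have h3 : ip T z q' = 0 := ((mem_Zspace_iff T _ _).1 hz').2 _ hq
    have h4 : ip T (localOp T K q') z = 0 := by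
      rw [ip_comm]
      exact ((mem_Zspace_iff T _ _).1 hz').2 _ (localOp_mem T hK hk hq)
    have hv' : v = z + q' := by rw [hzdef, sub_add_cancel]
    have h5 : ip T (localOp T K v) v = muVal d K (k + 1) * ip T z z + ip T (localOp T K q') q' := by
      rw [hv', map_add, h1]
      simp only [← ipForm_apply] at h3 h4 ⊢
      simp only [Submodule.coe_add, Submodule.coe_smul, map_add, map_smul, LinearMap.add_apply,
        LinearMap.smul_apply, smul_eq_mul, h3, h4]
      ring
    have h6 : ip T v v = ip T z z + ip T q' q' := by
      have h3' : ip T q' z = 0 := by rw [ip_comm, h3]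
      rw [hv']
      simp only [← ipForm_apply] at h3 h3' ⊢
      simp only [Submodule.coe_add, map_add, LinearMap.add_apply, h3, h3']
      ring
    rw [h5, h6]
    have h7 := (muVal_strictMono (d := d) hK (Nat.lt_succ_self k)).le
    have h8 := mul_le_mul_of_nonneg_right h7 (ip_self_nonneg T q')
    linarith

theorem decompForm_self_le (T : Simp d) {K : ℕ} (hK : 1 ≤ K) {p : MvPolynomial (Fin d) ℝ}
    (hp : p ∈ Poly d K) : decompForm T K p p ≤ (2 * K + d) / K * ip T p p := by
  have h := ip_localOp_le T hK K le_rfl ⟨p, hp⟩ hp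
  rwa [ip_localOp T hK, muVal_self hK] at h

/-! ### Piecewise polynomial functions in `W^{1,∞}` -/

theorem isOpen_region (F : Finset (Simp d)) : IsOpen (region F) := isOpen_interior

theorem measurableSet_region (F : Finset (Simp d)) : MeasurableSet (region F) :=
  (isOpen_region F).measurableSet

theorem region_ae_eq (F : Finset (Simp d)) :
    region F =ᵐ[volume] ⋃ T ∈ F, interior (body T) := by
  refine Filter.EventuallyLE.antisymm ?_
    (Filter.Eventually.of_forall fun x hx => ?_)
  · have h : (⋃ T ∈ F, interior (body T)) =ᵐ[volume] ⋃ T ∈ F, body T :=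
      F.eventuallyEq_iUnion fun T _ => interior_body_ae_eq T
    exact (LE.le.eventuallyLE interior_subset).trans_eq h.symm
  · exact (iUnion₂_subset fun T hT => interior_subset_region hT) hx

/-- Cell boundaries are null sets, so almost-everywhere statements can be checked cell by cell. -/
theorem ae_region_iff {F : Finset (Simp d)} {P : Pt d → Prop} :
    (∀ᵐ x ∂volume.restrict (region F), P x) ↔
      ∀ T ∈ F, ∀ᵐ x ∂volume.restrict (interior (body T)), P x := by
  rw [Measure.restrict_congr_set (region_ae_eq F), ae_restrict_biUnion_finset_iff]

theorem volume_region_lt_top (F : Finset (Simp d)) : volume (region F) < ⊤ :=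
  (measure_mono interior_subset).trans_lt
    ((F.isCompact_biUnion fun T _ => isCompact_body T).measure_lt_top)

instance (F : Finset (Simp d)) : IsFiniteMeasure (volume.restrict (region F)) :=
  ⟨by simpa using volume_region_lt_top F⟩

theorem aestronglyMeasurable_region {F : Finset (Simp d)} {u : Pt d → ℝ}
    (h : ∀ T ∈ F, AEStronglyMeasurable u (volume.restrict (interior (body T)))) :
    AEStronglyMeasurable u (volume.restrict (region F)) := by
  rw [Measure.restrict_congr_set (region_ae_eq F), ← iUnion_subtype (p := fun T => T ∈ F)
    (s := fun T : F => interior (body T.1))]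
  exact (aestronglyMeasurable_iUnion_iff (s := fun T : F => interior (body T.1))).2
    fun T => h T.1 T.2

theorem memLp_of_eqOnCell {F : Finset (Simp d)} {u : Pt d → ℝ}
    (h : ∀ T ∈ F, ∃ p, EqOnCell T u p) (q : ℝ≥0∞) : MemLp u q (volume.restrict (region F)) := by
  have hm : AEStronglyMeasurable u (volume.restrict (region F)) :=
    aestronglyMeasurable_region fun T hT => by
      obtain ⟨p, hp⟩ := h T hT
      exact (continuous_evalAt p).aestronglyMeasurable.congr hp.symm
  have hb : ∀ T ∈ F, ∃ C : ℝ, ∀ᵐ x ∂volume.restrict (interior (body T)), ‖u x‖ ≤ C := by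
    intro T hT
    obtain ⟨p, hp⟩ := h T hT
    obtain ⟨C, hC⟩ := (isCompact_body T).exists_bound_of_continuousOn
      (continuous_evalAt p).continuousOn
    refine ⟨C, ?_⟩
    filter_upwards [hp, ae_restrict_mem isOpen_interior.measurableSet] with x hx hxT
    rw [hx]
    exact hC x (interior_subset hxT)
  choose! C hC using hb
  refine (memLp_top_of_bound (C := ∑ T ∈ F, |C T|) hm (ae_region_iff.2 fun T hT => ?_)).mono_exponent
    le_top
  filter_upwards [hC T hT] with x hx
  exact hx.trans ((le_abs_self _).trans
    (Finset.single_le_sum (f := fun T => |C T|) (fun _ _ => abs_nonneg _) hT))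

theorem fderiv_evalAt (p : MvPolynomial (Fin d) ℝ) (x : Pt d) (l : Fin d) :
    fderiv ℝ (evalAt p) x (EuclideanSpace.single l 1) = evalAt (MvPolynomial.pderiv l p) x := by
  have hdiff : ∀ p : MvPolynomial (Fin d) ℝ, DifferentiableAt ℝ (evalAt p) x := fun p =>
    (contDiff_evalAt p).differentiable (by simp) x
  induction p using MvPolynomial.induction_on with
  | C a => simp [funext (evalAt_C a)]
  | add p q hp hq =>
    rw [funext (evalAt_add p q), fderiv_fun_add (hdiff p) (hdiff q), add_apply,
      hp, hq, map_add, evalAt_add]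
  | mul_X p k hp =>
    have hX : HasFDerivAt (evalAt (MvPolynomial.X k : MvPolynomial (Fin d) ℝ))
        (EuclideanSpace.proj k : Pt d →L[ℝ] ℝ) x := by
      rw [funext (evalAt_X k)]
      exact (EuclideanSpace.proj k : Pt d →L[ℝ] ℝ).hasFDerivAt
    rw [funext (evalAt_mul p _), fderiv_fun_mul (hdiff p) (hdiff _), hX.fderiv]
    simp [hp, Derivation.leibniz, Pi.single_apply, eq_comm]
    split_ifs <;> simp

/-! ### From compatible cell polynomials to W^{1,∞} -/

/-- A function on `ℝ^d` with a uniform bound for its local slopes at each point is Lipschitz. -/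
theorem lipschitzWith_of_eventually_le {h : Pt d → ℝ} {C : NNReal}
    (H : ∀ x, ∀ᶠ y in nhds x, |h y - h x| ≤ C * ‖y - x‖) : LipschitzWith C h := by
  have hcont : Continuous h := by
    rw [continuous_iff_continuousAt]
    intro x
    rw [ContinuousAt, tendsto_iff_dist_tendsto_zero]
    refine squeeze_zero' (Filter.Eventually.of_forall fun _ => dist_nonneg) (H x) ?_
    have : Continuous fun y => (C : ℝ) * ‖y - x‖ := by fun_prop
    simpa using this.tendsto x
  refine LipschitzWith.of_dist_le_mul fun y x => ?_
  set γ : ℝ → Pt d := fun t => x + t • (y - x)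
  have hγ : Continuous γ := by fun_prop
  -- A mean value inequality for t ↦ |h(γ t) - h(x)| on the segment; it asks only for a bound on
  -- right slopes, which the local hypothesis supplies at each γ t.
  have key := image_le_of_liminf_slope_right_le_deriv_boundary
    (f := fun t => |h (γ t) - h x|) (a := 0) (b := 1) (B := fun t => C * ‖y - x‖ * t)
    (B' := fun _ => C * ‖y - x‖) (by fun_prop) (by simp [γ]) (by fun_prop)
    (fun t _ => by simpa using ((hasDerivAt_id t).const_mul (C * ‖y - x‖)).hasDerivWithinAt)
    (fun t _ r hr => by
      refine Filter.Eventually.frequently ?_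
      have h1 := (hγ.tendsto t).eventually (H (γ t))
      filter_upwards [nhdsWithin_le_nhds h1, self_mem_nhdsWithin] with s hs hts
      have hts' : 0 < s - t := sub_pos.2 hts
      have e : γ s - γ t = (s - t) • (y - x) := by simp only [γ]; module
      rw [e, norm_smul, Real.norm_of_nonneg hts'.le] at hs
      rw [slope_def_field]
      refine lt_of_le_of_lt ?_ hr
      rw [div_le_iff₀ hts']
      have h2 := abs_sub_abs_le_abs_sub (h (γ s) - h x) (h (γ t) - h x)
      rw [sub_sub_sub_cancel_right] at h2
      linarith) (right_mem_Icc.2 zero_le_one)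
  simpa [γ, dist_eq_norm] using key

/-- Integration by parts against the constant function 1, in direction -v to absorb the sign. -/
theorem integral_lineDeriv_eq_zero {h : Pt d → ℝ} {C : NNReal} (hL : LipschitzWith C h)
    (hs : HasCompactSupport h) (v : Pt d) : ∫ x, lineDeriv ℝ h x v = 0 := by
  have h1 := LipschitzWith.integral_lineDeriv_mul_eq (μ := volume)
    (LipschitzWith.const (1 : ℝ) : LipschitzWith 0 fun _ : Pt d => (1 : ℝ)) hL hs (-v)
  simpa [lineDeriv] using h1.symm

/-- A neighbourhood of x avoids the finitely many closed cells that miss x. Nearby points can thus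
be compared with x through one common cell polynomial. -/
theorem eventually_exists_mem_body (F : Finset (Simp d)) {x : Pt d} (hx : x ∈ region F) :
    ∀ᶠ y in nhds x, y ∈ region F ∧ ∃ T ∈ F, x ∈ body T ∧ y ∈ body T := by
  have h1 : ∀ᶠ y in nhds x, ∀ T ∈ F, x ∉ body T → y ∉ body T := by
    rw [Filter.eventually_all_finset]
    intro T _
    by_cases hxT : x ∈ body T
    · simp [hxT]
    · filter_upwards [(isCompact_body T).isClosed.isOpen_compl.mem_nhds hxT] with y hy _
      exact hy
  filter_upwards [h1, (isOpen_region F).mem_nhds hx] with y hy hyF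
  refine ⟨hyF, ?_⟩
  obtain ⟨T, hT, hyT⟩ := mem_iUnion₂.1 (interior_subset hyF)
  exact ⟨T, hT, by_contra fun h => hy T hT h hyT, hyT⟩

/-- The polynomials `p T` agree on common points, inside the domain, of different simplices. -/
def Compatible (F : Finset (Simp d)) (p : Simp d → MvPolynomial (Fin d) ℝ) : Prop :=
  ∀ T ∈ F, ∀ T' ∈ F, ∀ x ∈ region F, x ∈ body T → x ∈ body T' →
    evalAt (p T) x = evalAt (p T') x

/-- The product u φ is Lipschitz on all of ℝ^d, interfaces included, so its directional derivative
integrates to zero. Inside the cells, hence almost everywhere in the domain, the product rule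
identifies that derivative. -/
theorem hasWeakPartial_of_eqOn {F : Finset (Simp d)} {p : Simp d → MvPolynomial (Fin d) ℝ}
    {u : Pt d → ℝ} (hu : ∀ T ∈ F, ∀ x ∈ region F, x ∈ body T → u x = evalAt (p T) x)
    (l : Fin d) {g : Pt d → ℝ}
    (hg : ∀ T ∈ F, ∀ x ∈ interior (body T), g x = evalAt (MvPolynomial.pderiv l (p T)) x) :
    HasWeakPartial (region F) u g l := by
  intro φ h1 h2 h3
  have hLT : ∀ T, ∃ C : NNReal, LipschitzWith C fun x => evalAt (p T) x * φ x := fun T =>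
    ContDiff.lipschitzWith_of_hasCompactSupport (h2.mul_left)
      ((contDiff_evalAt (p T)).mul h1) (by simp)
  choose C hC using hLT
  -- The sum of the cell constants dominates each of them, so it bounds the slope whichever cell
  -- joins the two points.
  have hLip : LipschitzWith (∑ T ∈ F, C T) fun x => u x * φ x := by
    refine lipschitzWith_of_eventually_le fun x => ?_
    by_cases hx : x ∈ region F
    · filter_upwards [eventually_exists_mem_body F hx] with y ⟨hy, T, hT, hxT, hyT⟩
      rw [hu T hT x hx hxT, hu T hT y hy hyT]
      have := (hC T).dist_le_mul y x
      rw [Real.dist_eq, dist_eq_norm] at this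
      refine this.trans (mul_le_mul_of_nonneg_right ?_ (norm_nonneg _))
      exact_mod_cast Finset.single_le_sum (f := C) (fun _ _ => zero_le) hT
    · have hφ : ∀ᶠ y in nhds x, φ y = 0 :=
        notMem_tsupport_iff_eventuallyEq.1 fun h => hx (h3 h)
      filter_upwards [hφ] with y hy
      rw [hy, hφ.self_of_nhds]
      simp only [mul_zero, sub_zero, abs_zero]
      positivity
  have hzero := integral_lineDeriv_eq_zero hLip h2.mul_left (EuclideanSpace.single l 1)
  have hout : ∀ x ∉ region F,
      lineDeriv ℝ (fun x => u x * φ x) x (EuclideanSpace.single l 1) = 0 := by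
    intro x hx
    have hφ : (fun x => u x * φ x) =ᶠ[nhds x] fun _ => 0 := by
      filter_upwards [notMem_tsupport_iff_eventuallyEq.1 fun h => hx (h3 h)] with y hy
      simp [hy]
    rw [hφ.lineDeriv_eq]
    simp [lineDeriv]
  rw [← setIntegral_eq_integral_of_forall_compl_eq_zero hout] at hzero
  have hin : (fun x => lineDeriv ℝ (fun x => u x * φ x) x (EuclideanSpace.single l 1))
      =ᵐ[volume.restrict (region F)]
      fun x => u x * fderiv ℝ φ x (EuclideanSpace.single l 1) + g x * φ x := by
    refine ae_region_iff.2 fun T hT => ?_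
    filter_upwards [ae_restrict_mem isOpen_interior.measurableSet] with x hx
    have heq : (fun x => u x * φ x) =ᶠ[nhds x] fun x => evalAt (p T) x * φ x := by
      filter_upwards [isOpen_interior.mem_nhds hx] with y hy
      rw [hu T hT y (interior_subset_region hT hy) (interior_subset hy)]
    have hd1 : DifferentiableAt ℝ (evalAt (p T)) x :=
      (contDiff_evalAt (p T)).differentiable (by simp) x
    have hd2 : DifferentiableAt ℝ φ x := h1.differentiable (by simp) x
    rw [heq.lineDeriv_eq, (hd1.fun_mul hd2).lineDeriv_eq_fderiv, fderiv_fun_mul hd1 hd2,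
      hu T hT x (interior_subset_region hT hx) (interior_subset hx), hg T hT x hx]
    simp [fderiv_evalAt, mul_comm]
  have hcell : ∀ T ∈ F, ∀ᵐ x ∂volume.restrict (interior (body T)), x ∈ interior (body T) :=
    fun T _ => ae_restrict_mem isOpen_interior.measurableSet
  have mu : MemLp u ⊤ (volume.restrict (region F)) := memLp_of_eqOnCell (fun T hT => ⟨p T, by
    filter_upwards [hcell T hT] with x hx
    exact hu T hT x (interior_subset_region hT hx) (interior_subset hx)⟩) _
  have mg : MemLp g ⊤ (volume.restrict (region F)) :=
    memLp_of_eqOnCell (fun T hT => ⟨MvPolynomial.pderiv l (p T), by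
      filter_upwards [hcell T hT] with x hx
      exact hg T hT x hx⟩) _
  rw [integral_congr_ae hin, integral_add (integrable_mul_test mu (continuous_partial h1 l)
    (hasCompactSupport_partial h2 l)) (integrable_mul_test mg h1.continuous h2)] at hzero
  linarith

open Classical in
/-- A function that is given by a compatible family of polynomials lies in `W^{1,∞}`. -/
theorem memW1inf_of_compatible {F : Finset (Simp d)} {p : Simp d → MvPolynomial (Fin d) ℝ}
    (hp : Compatible F p) {u : Pt d → ℝ} (hu : ∀ T ∈ F, EqOnCell T u (p T)) :
    MemW1inf (region F) u := by
  -- A pointwise representative: by compatibility the chosen cell does not matter at points of the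
  -- domain.
  set w : Pt d → ℝ := fun x =>
    if h : ∃ T ∈ F, x ∈ body T then evalAt (p h.choose) x else 0 with hw
  have hwp : ∀ T ∈ F, ∀ x ∈ region F, x ∈ body T → w x = evalAt (p T) x := by
    intro T hT x hx hxT
    have h : ∃ T ∈ F, x ∈ body T := ⟨T, hT, hxT⟩
    simp only [hw, dif_pos h]
    exact hp _ h.choose_spec.1 _ hT x hx h.choose_spec.2 hxT
  have huw : w =ᵐ[volume.restrict (region F)] u := by
    refine ae_region_iff.2 fun T hT => ?_
    filter_upwards [hu T hT, ae_restrict_mem isOpen_interior.measurableSet] with x hx hxT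
    rw [hx, hwp T hT x (interior_subset_region hT hxT) (interior_subset hxT)]
  have hcell : ∀ T ∈ F, ∀ l, ∀ x ∈ interior (body T),
      fderiv ℝ w x (EuclideanSpace.single l 1) = evalAt (MvPolynomial.pderiv l (p T)) x := by
    intro T hT l x hx
    have heq : w =ᶠ[nhds x] evalAt (p T) := by
      filter_upwards [isOpen_interior.mem_nhds hx] with y hy
      exact hwp T hT y (interior_subset_region hT hy) (interior_subset hy)
    rw [heq.fderiv_eq, fderiv_evalAt]
  refine MemW1inf.congr ⟨?_, fun l => ⟨fun x => fderiv ℝ w x (EuclideanSpace.single l 1), ?_, ?_⟩⟩ huw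
  · exact (memLp_congr_ae huw).2 (memLp_of_eqOnCell (fun T hT => ⟨p T, hu T hT⟩) _)
  · refine memLp_of_eqOnCell (fun T hT => ⟨MvPolynomial.pderiv l (p T), ?_⟩) _
    filter_upwards [ae_restrict_mem isOpen_interior.measurableSet] with x hx
    exact hcell T hT l x hx
  · exact hasWeakPartial_of_eqOn hwp l fun T hT => hcell T hT l

/-! ### From W^{1,∞} to compatible cell polynomials -/

/-- Functions in `W^{1,∞}(U)` are Lipschitz on small balls, up to a null set. -/
theorem MemW1inf.exists_ae_lipschitz {U : Set (Pt d)} (hU : MeasurableSet U) {u : Pt d → ℝ}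
    (hu : MemW1inf U u) {x₀ : Pt d} {r : ℝ} (hr : 0 < r) (hb : Metric.ball x₀ (2 * r) ⊆ U) :
    ∃ M : ℝ, ∃ S : Set (Pt d), (∀ᵐ x, x ∈ S) ∧
      ∀ y ∈ S ∩ Metric.ball x₀ r, ∀ z ∈ S ∩ Metric.ball x₀ r, |u y - u z| ≤ M * ‖y - z‖ := by
  choose g hg hgw using hu.2
  set w : Pt d → ℝ := U.indicator u
  have hwL : LocallyIntegrable w volume :=
    ((memLp_indicator_iff_restrict hU).2 hu.1).locallyIntegrable le_top
  have hM : ∀ l, ∃ M : ℝ, 0 ≤ M ∧ ∀ᵐ x ∂volume.restrict U, ‖g l x‖ ≤ M := fun l =>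
    ⟨(eLpNorm (g l) ⊤ (volume.restrict U)).toReal, ENNReal.toReal_nonneg, by
      filter_upwards [ae_le_eLpNormEssSup (f := g l) (μ := volume.restrict U)] with x hx
      rw [← eLpNorm_exponent_top] at hx
      have := ENNReal.toReal_mono (hg l).2.ne hx
      simpa using this⟩
  choose M hM0 hM using hM
  -- The outer radius stays below r, so kernels centred in the ball of radius r are supported in the
  -- ball of radius 2r inside U. The fixed ratio 2 of the radii is what the almost-everywhere
  -- convergence requires.
  set φ : ℕ → ContDiffBump (0 : Pt d) := fun n =>
    { rIn := r / (2 * (n + 2))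
      rOut := r / (n + 2)
      rIn_pos := by positivity
      rIn_lt_rOut := by
        refine div_lt_div_of_pos_left hr (by positivity) ?_
        have : (0 : ℝ) ≤ n := by positivity
        linarith } with hφ
  have hφr : ∀ n, (φ n).rOut < r := fun n => by
    change r / (n + 2) < r
    refine div_lt_self hr ?_
    have : (0 : ℝ) ≤ n := by positivity
    linarith
  have hφ0 : Filter.Tendsto (fun n => (φ n).rOut) Filter.atTop (nhds 0) := by
    refine Filter.Tendsto.div_atTop tendsto_const_nhds ?_
    exact Filter.tendsto_atTop_add_const_right _ _ tendsto_natCast_atTop_atTop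
  have hconv := ContDiffBump.ae_convolution_tendsto_right_of_locallyIntegrable (φ := φ)
    (μ := volume) (K := 2) hφ0 (Filter.Eventually.of_forall fun n => by
      change r / (n + 2) ≤ 2 * (r / (2 * (n + 2)))
      apply le_of_eq
      field_simp) hwL
  refine ⟨∑ l, M l, _, hconv, fun y hy z hz => ?_⟩
  have hwu : ∀ x ∈ Metric.ball x₀ r, w x = u x := fun x hx =>
    indicator_of_mem (hb (Metric.ball_subset_ball (by linarith) hx)) u
  have hcs : ∀ n, HasCompactSupport ((φ n).normed volume) := fun n => (φ n).hasCompactSupport_normed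
  have hcd : ∀ n, ContDiff ℝ ∞ ((φ n).normed volume) := fun n => (φ n).contDiff_normed
  have hbound : ∀ n, ∀ x ∈ Metric.ball x₀ r, ∃ A : Pt d →L[ℝ] ℝ,
      HasFDerivAt (convolution ((φ n).normed volume) w (ContinuousLinearMap.lsmul ℝ ℝ) volume) A x
        ∧ ‖A‖ ≤ ∑ l, M l := by
    intro n x hx
    set ρ := (φ n).normed volume with hρ
    refine ⟨_, (hcs n).hasFDerivAt_convolution_left (ContinuousLinearMap.lsmul ℝ ℝ)
      ((hcd n).of_le (by simp)) hwL x, ?_⟩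
    set A := convolution (fderiv ℝ ρ) w
      (ContinuousLinearMap.precompL (Pt d) (ContinuousLinearMap.lsmul ℝ ℝ)) volume x with hA
    have hAl : ∀ l, |A (EuclideanSpace.single l 1)| ≤ M l := by
      intro l
      -- The reflected and translated mollifier is an admissible test function. It moves the
      -- derivative from the kernel to g, and its integral 1 then gives the bound by M_l.
      set ψ : Pt d → ℝ := fun t => ρ (x - t) with hψ
      have hψd : ContDiff ℝ ∞ ψ := (hcd n).comp (contDiff_const.sub contDiff_id)
      have hψs : HasCompactSupport ψ := (hcs n).comp_homeomorph (Homeomorph.subLeft x)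
      have hψt : tsupport ψ ⊆ U := by
        refine Subset.trans ?_ hb
        have h1 : tsupport ψ ⊆ Metric.closedBall x (φ n).rOut := by
          refine closure_minimal (fun t ht => ?_) Metric.isClosed_closedBall
          have : x - t ∈ Function.support ρ := ht
          rw [hρ, (φ n).support_normed_eq, mem_ball_zero_iff] at this
          rw [Metric.mem_closedBall, dist_comm, dist_eq_norm]
          exact this.le
        intro t ht
        have h2 := h1 ht
        rw [Metric.mem_closedBall] at h2
        rw [Metric.mem_ball] at hx ⊢
        have := dist_triangle t x x₀
        have := hφr n
        linarith
      have hψ' : ∀ t, fderiv ℝ ψ t (EuclideanSpace.single l 1) =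
          - fderiv ℝ ρ (x - t) (EuclideanSpace.single l 1) := by
        intro t
        have h1 : HasFDerivAt ρ (fderiv ℝ ρ (x - t)) (x - t) :=
          ((hcd n).differentiable (by simp) _).hasFDerivAt
        have h2 := h1.comp t ((hasFDerivAt_id t).const_sub x)
        rw [show ψ = ρ ∘ fun t => x - t from rfl]
        erw [h2.fderiv]
        simp
      have e1 : A (EuclideanSpace.single l 1) =
          ∫ t, fderiv ℝ ρ t (EuclideanSpace.single l 1) * w (x - t) := by
        have hint : ConvolutionExistsAt (fderiv ℝ ρ) w x
            (ContinuousLinearMap.precompL (Pt d) (ContinuousLinearMap.lsmul ℝ ℝ)) volume :=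
          ((hcs n).fderiv ℝ).convolutionExists_left _
            ((hcd n).continuous_fderiv (by simp)) hwL x
        rw [hA, convolution_def, ContinuousLinearMap.integral_apply hint]
        simp [ContinuousLinearMap.precompL_apply]
      have e2 : A (EuclideanSpace.single l 1) = ∫ t in U, g l t * ψ t := by
        rw [e1, ← integral_sub_left_eq_self _ volume x]
        simp only [sub_sub_cancel]
        have e3 : ∫ t, fderiv ℝ ρ (x - t) (EuclideanSpace.single l 1) * w t =
            - ∫ t in U, u t * fderiv ℝ ψ t (EuclideanSpace.single l 1) := by
          rw [← integral_neg, ← integral_indicator hU]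
          refine integral_congr_ae (Filter.Eventually.of_forall fun t => ?_)
          by_cases ht : t ∈ U
          · simp [w, ht, hψ', mul_comm]
          · simp [w, ht]
        rw [e3, hgw l ψ hψd hψs hψt, neg_neg]
      have hψi : Integrable ψ := hψd.continuous.integrable_of_hasCompactSupport hψs
      have hψ0 : ∀ t, 0 ≤ ψ t := fun t => (φ n).nonneg_normed _
      have hψ1 : ∫ t, ψ t = 1 := by
        rw [hψ, integral_sub_left_eq_self (fun t => ρ t) volume x]
        exact (φ n).integral_normed
      rw [e2, ← Real.norm_eq_abs]
      calc ‖∫ t in U, g l t * ψ t‖ ≤ ∫ t in U, M l * ψ t := by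
            refine norm_integral_le_of_norm_le (hψi.const_mul _).integrableOn ?_
            filter_upwards [hM l] with t ht
            rw [norm_mul, Real.norm_of_nonneg (hψ0 t)]
            exact mul_le_mul_of_nonneg_right ht (hψ0 t)
        _ = M l * ∫ t in U, ψ t := integral_const_mul _ _
        _ ≤ M l * 1 := by
            refine mul_le_mul_of_nonneg_left ?_ (hM0 l)
            rw [← hψ1]
            exact setIntegral_le_integral hψi (Filter.Eventually.of_forall hψ0)
        _ = M l := mul_one _
    refine A.opNorm_le_bound (Finset.sum_nonneg fun l _ => hM0 l) fun v => ?_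
    have hv : v = ∑ l, v l • (EuclideanSpace.single l (1 : ℝ) : Pt d) := by
      ext m
      simp [Finset.sum_apply, Pi.single_apply]
    conv_lhs => rw [hv]
    rw [map_sum, Finset.sum_mul]
    refine (norm_sum_le _ _).trans (Finset.sum_le_sum fun l _ => ?_)
    rw [map_smul, norm_smul, mul_comm]
    exact mul_le_mul (hAl l) (PiLp.norm_apply_le v l) (norm_nonneg _) (hM0 l)
  have hlim : Filter.Tendsto (fun n =>
      |convolution ((φ n).normed volume) w (ContinuousLinearMap.lsmul ℝ ℝ) volume y -
        convolution ((φ n).normed volume) w (ContinuousLinearMap.lsmul ℝ ℝ) volume z|)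
      Filter.atTop (nhds |u y - u z|) := by
    rw [← hwu y hy.2, ← hwu z hz.2]
    exact (Filter.Tendsto.sub hy.1 hz.1).abs
  refine le_of_tendsto hlim (Filter.Eventually.of_forall fun n => ?_)
  have hB := hbound n
  choose! A hA1 hA2 using hB
  rw [← Real.norm_eq_abs]
  exact (convex_ball x₀ r).norm_image_sub_le_of_norm_hasFDerivWithin_le
    (fun x hx => (hA1 x hx).hasFDerivWithinAt) hA2 hz.2 hy.2

/-- The cell polynomials of a piecewise polynomial function in `W^{1,∞}` are compatible. -/
theorem MemW1inf.compatible {F : Finset (Simp d)} {u : Pt d → ℝ} (hu : MemW1inf (region F) u)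
    {p : Simp d → MvPolynomial (Fin d) ℝ} (hp : ∀ T ∈ F, EqOnCell T u (p T)) :
    Compatible F p := by
  intro T hT T' hT' x hx hxT hxT'
  obtain ⟨ε, hε, hb⟩ := Metric.isOpen_iff.1 (isOpen_region F) x hx
  obtain ⟨M, S, hS, hL⟩ := hu.exists_ae_lipschitz (measurableSet_region F) (half_pos hε)
    (x₀ := x) (by rwa [mul_div_cancel₀ ε two_ne_zero])
  -- A cell is the closure of its interior, so each cell through x contains open sets arbitrarily
  -- close to x. These have positive measure and therefore contain points of S at which u equals the
  -- cell polynomial.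
  have hgood : ∀ R ∈ F, x ∈ body R → ∀ δ > 0, ∃ y ∈ S ∩ Metric.ball x (ε / 2),
      dist y x < δ ∧ u y = evalAt (p R) y := by
    intro R hR hxR δ hδ
    set V := Metric.ball x (min δ (ε / 2)) ∩ interior (body R)
    have hVo : IsOpen V := Metric.isOpen_ball.inter isOpen_interior
    have hVn : V.Nonempty := by
      rw [← closure_interior_body R] at hxR
      exact mem_closure_iff.1 hxR _ Metric.isOpen_ball
        (Metric.mem_ball_self (lt_min hδ (half_pos hε)))
    have hne : volume.restrict V ≠ 0 := by
      rw [Ne, Measure.restrict_eq_zero]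
      exact (hVo.measure_pos volume hVn).ne'
    have : (ae (volume.restrict V)).NeBot := ae_neBot.2 hne
    have hR' := ae_restrict_of_ae_restrict_of_subset
      (inter_subset_right : V ⊆ interior (body R)) (hp R hR)
    obtain ⟨y, hyS, hyu, hyV⟩ := ((ae_restrict_of_ae hS).and
      (hR'.and (ae_restrict_mem hVo.measurableSet))).exists
    have h1 := Metric.mem_ball.1 hyV.1
    exact ⟨y, ⟨hyS, Metric.mem_ball.2 (h1.trans_le (min_le_right _ _))⟩,
      h1.trans_le (min_le_left _ _), hyu⟩
  choose! y hyS hyd hyu using hgood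
  have hlim : ∀ R ∈ F, x ∈ body R →
      Filter.Tendsto (fun δ => y R δ) (nhdsWithin (0 : ℝ) (Ioi 0)) (nhds x) := by
    intro R hR hxR
    rw [tendsto_iff_dist_tendsto_zero]
    refine squeeze_zero' (g := fun δ => δ) (Filter.Eventually.of_forall fun _ => dist_nonneg) ?_
      (Filter.tendsto_id.mono_left nhdsWithin_le_nhds)
    filter_upwards [self_mem_nhdsWithin] with δ hδ
    exact (hyd R hR hxR δ hδ).le
  have hl1 := hlim T hT hxT
  have hl2 := hlim T' hT' hxT'
  have h1 : Filter.Tendsto (fun δ => |evalAt (p T) (y T δ) - evalAt (p T') (y T' δ)|)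
      (nhdsWithin (0 : ℝ) (Ioi 0)) (nhds |evalAt (p T) x - evalAt (p T') x|) :=
    ((((continuous_evalAt (p T)).tendsto x).comp hl1).sub
      (((continuous_evalAt (p T')).tendsto x).comp hl2)).abs
  have h2 : Filter.Tendsto (fun δ => M * ‖y T δ - y T' δ‖)
      (nhdsWithin (0 : ℝ) (Ioi 0)) (nhds 0) := by
    simpa using ((hl1.sub hl2).norm).const_mul M
  -- Both families of points tend to x, so the Lipschitz bound on their difference tends to zero.
  have h3 : |evalAt (p T) x - evalAt (p T') x| ≤ 0 := by
    refine le_of_tendsto_of_tendsto h1 h2 ?_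
    filter_upwards [self_mem_nhdsWithin] with δ hδ
    rw [← hyu T hT hxT δ hδ, ← hyu T' hT' hxT' δ hδ]
    exact hL _ (hyS T hT hxT δ hδ) _ (hyS T' hT' hxT' δ hδ)
  exact sub_eq_zero.1 (abs_eq_zero.1 (le_antisymm h3 (abs_nonneg _)))

/-! ### Lagrange spaces -/

theorem EqOnCell.unique {T : Simp d} {v : Pt d → ℝ} {p q : MvPolynomial (Fin d) ℝ}
    (hp : EqOnCell T v p) (hq : EqOnCell T v q) : p = q :=
  poly_eq_of_ae isOpen_interior (interior_body_nonempty T) (hp.symm.trans hq)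

open Triangulation in
theorem eqOnCell_cellPoly {F : Finset (Simp d)} {k : ℕ} {v : L2 (region F)}
    (hv : v ∈ lagrange F k) {T : Simp d} (hT : T ∈ F) : EqOnCell T v (cellPoly k T v) := by
  obtain ⟨p, hp, hp'⟩ := hv.2 T hT
  have h : ∃ p : Poly d k, EqOnCell T v p := ⟨⟨p, hp⟩, hp'⟩
  rw [cellPoly, dif_pos h]
  exact h.choose_spec

open Triangulation in
theorem compatible_cellPoly {F : Finset (Simp d)} {k : ℕ} {v : L2 (region F)}
    (hv : v ∈ lagrange F k) : Compatible F fun T => cellPoly k T v :=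
  hv.1.compatible fun _ hT => eqOnCell_cellPoly hv hT

theorem mem_lagrange_of_compatible {F : Finset (Simp d)} {k : ℕ} {v : L2 (region F)}
    {p : Simp d → MvPolynomial (Fin d) ℝ} (hp : Compatible F p) (hk : ∀ T ∈ F, p T ∈ Poly d k)
    (hv : ∀ T ∈ F, EqOnCell T v (p T)) : v ∈ lagrange F k :=
  ⟨memW1inf_of_compatible hp hv, fun T hT => ⟨p T, hk T hT, hv T hT⟩⟩

theorem EqOnCell.add {F : Finset (Simp d)} {T : Simp d} (hT : T ∈ F) {u v : L2 (region F)}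
    {p q : MvPolynomial (Fin d) ℝ} (hu : EqOnCell T u p) (hv : EqOnCell T v q) :
    EqOnCell T (u + v : L2 (region F)) (p + q) := by
  filter_upwards [ae_cell hT (Lp.coeFn_add u v), hu, hv] with x h1 h2 h3
  rw [h1, Pi.add_apply, h2, h3, evalAt_add]

theorem EqOnCell.const_smul {F : Finset (Simp d)} {T : Simp d} (hT : T ∈ F) {u : L2 (region F)}
    {p : MvPolynomial (Fin d) ℝ} (hu : EqOnCell T u p) (c : ℝ) :
    EqOnCell T (c • u : L2 (region F)) (c • p) := by
  filter_upwards [ae_cell hT (Lp.coeFn_smul c u), hu] with x h1 h2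
  rw [h1, Pi.smul_apply, h2, evalAt_smul, smul_eq_mul]

-- The cell polynomials embed the space linearly into a finite product of polynomial spaces.
open Triangulation in
instance finiteDimensional_lagrange (F : Finset (Simp d)) (k : ℕ) :
    FiniteDimensional ℝ (lagrange F k) := by
  let f : lagrange F k →ₗ[ℝ] (F → Poly d k) :=
    { toFun := fun v T => cellPoly k T.1 v.1
      map_add' := fun u v => by
        funext T
        refine Subtype.ext ((eqOnCell_cellPoly (u + v).2 T.2).unique ?_)
        exact EqOnCell.add T.2 (eqOnCell_cellPoly u.2 T.2) (eqOnCell_cellPoly v.2 T.2)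
      map_smul' := fun c u => by
        funext T
        refine Subtype.ext ((eqOnCell_cellPoly (c • u).2 T.2).unique ?_)
        exact EqOnCell.const_smul T.2 (eqOnCell_cellPoly u.2 T.2) c }
  refine Module.Finite.of_injective f fun u v huv => Subtype.ext (Lp.ext ?_)
  refine ae_region_iff.2 fun T hT => ?_
  have h : (cellPoly k T u.1 : MvPolynomial (Fin d) ℝ) = cellPoly k T v.1 :=
    congrArg Subtype.val (congrFun huv ⟨T, hT⟩)
  exact (eqOnCell_cellPoly u.2 hT).trans (h ▸ (eqOnCell_cellPoly v.2 hT).symm)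

namespace Triangulation

variable (𝒯 : Triangulation d)

/-! ### The geometry of a triangulation -/

variable {𝒯}

theorem mem_patch {i : Pt d} {T : Simp d} :
    T ∈ 𝒯.patch i ↔ T ∈ 𝒯.cells ∧ i ∈ range T.points := by
  simp [patch]

theorem patch_subset (i : Pt d) : 𝒯.patch i ⊆ 𝒯.cells := fun _ hT => (mem_patch.1 hT).1

theorem exists_points_notMem {T T' : Simp d} (hT : T ∈ 𝒯.cells) (hT' : T' ∈ 𝒯.cells)
    (hne : T ≠ T') : ∃ k, T.points k ∉ range T'.points := by
  by_contra! h
  refine hne (𝒯.eq_of_range_eq T hT T' hT' ?_)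
  have hsub : range T.points ⊆ range T'.points := range_subset_iff.2 h
  refine eq_of_subset_of_ncard_le hsub ?_ (finite_range _)
  have hc : ∀ R : Simp d, (range R.points).ncard = d + 1 := fun R => by
    rw [← image_univ, ncard_image_of_injective _ R.independent.injective, ncard_univ]
    simp
  rw [hc, hc]

/-- Some vertex of T is not a vertex of T'. Its hat function is positive in the interior of T but
vanishes on T'. -/
theorem notMem_body_of_mem_interior {T T' : Simp d} (hT : T ∈ 𝒯.cells) (hT' : T' ∈ 𝒯.cells)
    (hne : T ≠ T') {x : Pt d} (hx : x ∈ interior (body T)) : x ∉ body T' := by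
  intro hx'
  obtain ⟨k, hk⟩ := exists_points_notMem hT hT' hne
  have h1 := 𝒯.hat_points hT k (interior_subset hx)
  rw [𝒯.hat_of_notMem hT' hk hx'] at h1
  rw [interior_body] at hx
  exact (hx k).ne h1

theorem setIntegral_region {F : Finset (Simp d)} (hF : F ⊆ 𝒯.cells) {f : Pt d → ℝ}
    (hf : IntegrableOn f (region F)) : ∫ x in region F, f x = ∑ T ∈ F, ∫ x in body T, f x := by
  rw [setIntegral_congr_set (region_ae_eq F), integral_biUnion_finset]
  · exact Finset.sum_congr rfl fun T _ => setIntegral_congr_set (interior_body_ae_eq T)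
  · exact fun T _ => isOpen_interior.measurableSet
  · intro T hT T' hT' hne
    rw [Function.onFun, Set.disjoint_left]
    exact fun x hx hx' =>
      notMem_body_of_mem_interior (hF hT) (hF hT') hne hx (interior_subset hx')
  · exact fun T hT => hf.mono_set (interior_subset_region hT)

theorem mem_patch_of_hat_ne_zero {i x : Pt d} (h : 𝒯.hat i x ≠ 0) {T : Simp d}
    (hT : T ∈ 𝒯.cells) (hx : x ∈ body T) : T ∈ 𝒯.patch i :=
  mem_patch.2 ⟨hT, by_contra fun hi => h (𝒯.hat_of_notMem hT hi hx)⟩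

/-- Every cell through x has i as a vertex, and near x these cells cover the domain. So, within the
domain, the hat function vanishes off the open patch. -/
theorem mem_region_patch_of_hat_ne_zero {i x : Pt d} (hx : x ∈ 𝒯.domain) (h : 𝒯.hat i x ≠ 0) :
    x ∈ region (𝒯.patch i) := by
  refine mem_interior_iff_mem_nhds.2 ?_
  filter_upwards [eventually_exists_mem_body 𝒯.cells hx] with y ⟨_, T, hT, hxT, hyT⟩
  exact mem_biUnion (mem_patch_of_hat_ne_zero h hT hxT) hyT

theorem hat_nonneg (i x : Pt d) : 0 ≤ 𝒯.hat i x := by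
  unfold hat
  split_ifs with h
  · exact (bary_mem_Icc h.choose_spec.2.2 _).1
  · exact le_rfl

theorem points_mem_vertices {T : Simp d} (hT : T ∈ 𝒯.cells) (k : Fin (d + 1)) :
    T.points k ∈ 𝒯.vertices := by
  simp only [vertices, Finset.mem_biUnion, Finset.mem_image]
  exact ⟨T, hT, k, Finset.mem_univ _, rfl⟩

theorem sum_vertices {T : Simp d} (hT : T ∈ 𝒯.cells) {g : Pt d → ℝ}
    (hg : ∀ i, i ∉ range T.points → g i = 0) :
    ∑ i ∈ 𝒯.vertices, g i = ∑ k, g (T.points k) := by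
  classical
  rw [← Finset.sum_image (s := Finset.univ) (f := g) (g := T.points)
    fun a _ b _ h => T.independent.injective h]
  symm
  refine Finset.sum_subset (fun i hi => ?_) fun i _ hi => hg i fun h => hi ?_
  · obtain ⟨k, -, rfl⟩ := Finset.mem_image.1 hi
    exact points_mem_vertices hT k
  · obtain ⟨k, rfl⟩ := h
    exact Finset.mem_image_of_mem _ (Finset.mem_univ k)

theorem sum_hat {T : Simp d} (hT : T ∈ 𝒯.cells) {x : Pt d} (hx : x ∈ body T) :
    ∑ i ∈ 𝒯.vertices, 𝒯.hat i x = 1 := by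
  rw [sum_vertices (g := fun i => 𝒯.hat i x) hT fun i hi => 𝒯.hat_of_notMem hT hi hx, ← sum_bary T x]
  exact Finset.sum_congr rfl fun k _ => 𝒯.hat_points hT k hx

/-! ### The neighbour graph -/

theorem body_inter_nonempty_iff {T T' : Simp d} (hT : T ∈ 𝒯.cells) (hT' : T' ∈ 𝒯.cells) :
    (body T ∩ body T').Nonempty ↔ (range T.points ∩ range T'.points).Nonempty := by
  rw [𝒯.inter_eq T hT T' hT', convexHull_nonempty_iff]

theorem neighborGraph_adj_iff (T T' : {T // T ∈ 𝒯.cells}) :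
    𝒯.neighborGraph.Adj T T' ↔ T ≠ T' ∧ (body T.1 ∩ body T'.1).Nonempty := by
  rw [body_inter_nonempty_iff T.2 T'.2]
  rfl

theorem cells_nonempty : Nonempty {T // T ∈ 𝒯.cells} := by
  obtain ⟨x, hx⟩ := 𝒯.connected.nonempty
  obtain ⟨T, hT, -⟩ := mem_iUnion₂.1 (interior_subset hx)
  exact ⟨⟨T, hT⟩⟩

/-- Otherwise the cells reachable from T and the remaining cells form two closed sets covering the
connected domain, each meeting it. They share a point, and by conformity two cells with a common
point share a vertex. -/
theorem neighborGraph_preconnected : 𝒯.neighborGraph.Preconnected := by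
  intro T T'
  by_contra hTT'
  set A : Set (Pt d) := ⋃ R : {R : {T // T ∈ 𝒯.cells} // 𝒯.neighborGraph.Reachable T R}, body R.1.1
  set B : Set (Pt d) := ⋃ R : {R : {T // T ∈ 𝒯.cells} // ¬ 𝒯.neighborGraph.Reachable T R},
    body R.1.1
  have hA : IsClosed A := isClosed_iUnion_of_finite fun R => (isCompact_body R.1.1).isClosed
  have hB : IsClosed B := isClosed_iUnion_of_finite fun R => (isCompact_body R.1.1).isClosed
  have hAB : region 𝒯.cells ⊆ A ∪ B := by
    intro x hx
    obtain ⟨R, hR, hxR⟩ := mem_iUnion₂.1 (interior_subset hx)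
    by_cases h : 𝒯.neighborGraph.Reachable T ⟨R, hR⟩
    · exact Or.inl (mem_iUnion.2 ⟨⟨⟨R, hR⟩, h⟩, hxR⟩)
    · exact Or.inr (mem_iUnion.2 ⟨⟨⟨R, hR⟩, h⟩, hxR⟩)
  have hmeet : ∀ R : {T // T ∈ 𝒯.cells}, ∃ x ∈ region 𝒯.cells, x ∈ body R.1 := fun R => by
    obtain ⟨x, hx⟩ := interior_body_nonempty R.1
    exact ⟨x, interior_subset_region R.2 hx, interior_subset hx⟩
  obtain ⟨x, hx, hxT⟩ := hmeet T
  obtain ⟨y, hy, hyT⟩ := hmeet T'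
  obtain ⟨z, -, hzA, hzB⟩ := isPreconnected_closed_iff.1 𝒯.connected.isPreconnected A B hA hB hAB
    ⟨x, hx, mem_iUnion.2 ⟨⟨T, SimpleGraph.Reachable.refl T⟩, hxT⟩⟩
    ⟨y, hy, mem_iUnion.2 ⟨⟨T', hTT'⟩, hyT⟩⟩
  obtain ⟨⟨R, hR⟩, hzR⟩ := mem_iUnion.1 hzA
  obtain ⟨⟨R', hR'⟩, hzR'⟩ := mem_iUnion.1 hzB
  refine hR' (hR.trans ?_)
  by_cases hne : R = R'
  · rw [hne]
  · exact ((neighborGraph_adj_iff R R').2 ⟨hne, z, hzR, hzR'⟩).reachable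

theorem neighborGraph_connected : 𝒯.neighborGraph.Connected :=
  have := cells_nonempty (𝒯 := 𝒯)
  ⟨neighborGraph_preconnected⟩

theorem delta_eq_one_iff (T T' : {T // T ∈ 𝒯.cells}) :
    𝒯.delta T T' = 1 ↔ 𝒯.neighborGraph.Adj T T' := SimpleGraph.dist_eq_one_iff_adj

theorem isLeast_delta (T T' : {T // T ∈ 𝒯.cells}) :
    IsLeast {N : ℕ | ∃ c : ℕ → {T // T ∈ 𝒯.cells}, c 0 = T ∧ c N = T' ∧
      ∀ j < N, 𝒯.delta (c j) (c (j + 1)) = 1} (𝒯.delta T T') := by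
  constructor
  · obtain ⟨w, hw⟩ := (neighborGraph_preconnected T T').exists_walk_length_eq_dist
    refine ⟨w.getVert, w.getVert_zero, ?_, fun j hj => ?_⟩
    · rw [delta, ← hw, w.getVert_length]
    · rw [delta, ← hw] at hj
      exact (delta_eq_one_iff _ _).2 (w.adj_getVert_succ hj)
  · rintro N ⟨c, rfl, rfl, hc⟩
    induction N with
    | zero => simp [delta]
    | succ N ih =>
      have h1 := ih fun j hj => hc j (hj.trans (Nat.lt_succ_self N))
      have h2 := hc N (Nat.lt_succ_self N)
      have h3 := neighborGraph_connected.dist_triangle (G := 𝒯.neighborGraph)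
        (u := c 0) (v := c N) (w := c (N + 1))
      unfold delta at *
      omega

/-! ### The weighted projections -/

theorem integrable_hat_mul {U : Set (Pt d)} (hU : U ⊆ 𝒯.domain) (i : Pt d) {f g : Pt d → ℝ}
    (hf : MemLp f 2 (volume.restrict U)) (hg : MemLp g 2 (volume.restrict U)) :
    Integrable (fun x => 𝒯.hat i x * (f x * g x)) (volume.restrict U) := by
  refine (hf.integrable_mul hg).bdd_mul (c := 1) ?_ (Filter.Eventually.of_forall fun x => ?_)
  · exact (𝒯.aestronglyMeasurable_hat i).mono_measure (Measure.restrict_mono hU le_rfl)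
  · exact 𝒯.norm_hat_le i x

theorem memLp_patch (i : Pt d) (u : L2 𝒯.domain) :
    MemLp u 2 (volume.restrict (region (𝒯.patch i))) :=
  (Lp.memLp u).mono_measure (Measure.restrict_mono (𝒯.region_patch_subset i) le_rfl)

theorem setIntegral_patch_hat_mul (i : Pt d) (f : Pt d → ℝ) :
    ∫ x in region (𝒯.patch i), 𝒯.hat i x * f x = ∫ x in 𝒯.domain, 𝒯.hat i x * f x := by
  refine (setIntegral_eq_of_subset_of_forall_sdiff_eq_zero (measurableSet_region _)
    (𝒯.region_patch_subset i) fun x hx => ?_).symm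
  have h : 𝒯.hat i x = 0 := by
    by_contra h
    exact hx.2 (mem_region_patch_of_hat_ne_zero hx.1 h)
  rw [h, zero_mul]

theorem hat_pos {i : Pt d} {T : Simp d} (hT : T ∈ 𝒯.patch i) {x : Pt d}
    (hx : x ∈ interior (body T)) : 0 < 𝒯.hat i x := by
  obtain ⟨hT', k, rfl⟩ := mem_patch.1 hT
  rw [𝒯.hat_points hT' k (interior_subset hx)]
  rw [interior_body] at hx
  exact hx k

/-- The weight φ_i is positive inside each cell of the patch, so the weighted form is definite; this
is what makes C_i exist uniquely. -/
theorem ae_eq_zero_of_integral_hat_mul {i : Pt d} {f : Pt d → ℝ}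
    (hf : MemLp f 2 (volume.restrict (region (𝒯.patch i))))
    (h : ∫ x in region (𝒯.patch i), 𝒯.hat i x * (f x * f x) = 0) :
    f =ᵐ[volume.restrict (region (𝒯.patch i))] 0 := by
  rw [integral_eq_zero_iff_of_nonneg
    (fun x => mul_nonneg (hat_nonneg i x) (mul_self_nonneg (f x)))
    (integrable_hat_mul (𝒯.region_patch_subset i) i hf hf)] at h
  refine ae_region_iff.2 fun T hT => ?_
  filter_upwards [ae_cell hT h, ae_restrict_mem isOpen_interior.measurableSet] with x hx hxT
  have h1 := hat_pos hT hxT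
  simpa [h1.ne'] using hx

theorem existsUnique_isWeightedProj (K : ℕ) (i : Pt d) (u : L2 𝒯.domain) :
    ∃! w, 𝒯.IsWeightedProj K i u w := by
  have hsub := 𝒯.region_patch_subset i
  have hi : ∀ v w : L2 (region (𝒯.patch i)), Integrable (fun x => 𝒯.hat i x * (v x * w x))
      (volume.restrict (region (𝒯.patch i))) := fun v w =>
    integrable_hat_mul hsub i (Lp.memLp v) (Lp.memLp w)
  have hiu : ∀ w : L2 (region (𝒯.patch i)), Integrable (fun x => 𝒯.hat i x * (u x * w x))
      (volume.restrict (region (𝒯.patch i))) := fun w =>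
    integrable_hat_mul hsub i (memLp_patch i u) (Lp.memLp w)
  let B : lagrange (𝒯.patch i) (K - 1) →ₗ[ℝ] lagrange (𝒯.patch i) (K - 1) →ₗ[ℝ] ℝ :=
    LinearMap.mk₂ ℝ (fun v w => ∫ x in region (𝒯.patch i), 𝒯.hat i x * (v.1 x * w.1 x))
      (fun v v' w => by
        rw [← integral_add (hi _ _) (hi _ _)]
        refine integral_congr_ae ?_
        filter_upwards [Lp.coeFn_add v.1 v'.1] with x hx
        rw [Submodule.coe_add, hx, Pi.add_apply]
        ring)
      (fun c v w => by
        rw [smul_eq_mul, ← integral_const_mul]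
        refine integral_congr_ae ?_
        filter_upwards [Lp.coeFn_smul c v.1] with x hx
        rw [Submodule.coe_smul, hx, Pi.smul_apply, smul_eq_mul]
        ring)
      (fun v w w' => by
        rw [← integral_add (hi _ _) (hi _ _)]
        refine integral_congr_ae ?_
        filter_upwards [Lp.coeFn_add w.1 w'.1] with x hx
        rw [Submodule.coe_add, hx, Pi.add_apply]
        ring)
      (fun c v w => by
        rw [smul_eq_mul, ← integral_const_mul]
        refine integral_congr_ae ?_
        filter_upwards [Lp.coeFn_smul c w.1] with x hx
        rw [Submodule.coe_smul, hx, Pi.smul_apply, smul_eq_mul]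
        ring)
  let f : lagrange (𝒯.patch i) (K - 1) →ₗ[ℝ] ℝ :=
    { toFun := fun w => ∫ x in region (𝒯.patch i), 𝒯.hat i x * (u x * w.1 x)
      map_add' := fun w w' => by
        rw [← integral_add (hiu _) (hiu _)]
        refine integral_congr_ae ?_
        filter_upwards [Lp.coeFn_add w.1 w'.1] with x hx
        rw [Submodule.coe_add, hx, Pi.add_apply]
        ring
      map_smul' := fun c w => by
        rw [RingHom.id_apply, smul_eq_mul, ← integral_const_mul]
        refine integral_congr_ae ?_
        filter_upwards [Lp.coeFn_smul c w.1] with x hx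
        rw [Submodule.coe_smul, hx, Pi.smul_apply, smul_eq_mul]
        ring }
  have hB : ∀ w, B w w = 0 → w = 0 := fun w hw =>
    Subtype.ext (Lp.ext ((ae_eq_zero_of_integral_hat_mul (Lp.memLp w.1) hw).trans
      (Lp.coeFn_zero _ _ _).symm))
  obtain ⟨w, hw, hu⟩ := existsUnique_represents B hB f
  refine ⟨w.1, ⟨w.2, fun v hv => hw ⟨v, hv⟩⟩, fun w' hw' => ?_⟩
  exact congrArg Subtype.val (hu ⟨w', hw'.1⟩ fun z => hw'.2 z.1 z.2)

theorem isWeightedProj_localProj (K : ℕ) (i : Pt d) (u : L2 𝒯.domain) :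
    𝒯.IsWeightedProj K i u (𝒯.localProj K i u) := by
  have h := (existsUnique_isWeightedProj K i u).exists
  rw [localProj, dif_pos h]
  exact h.choose_spec

theorem IsWeightedProj.eq_localProj {K : ℕ} {i : Pt d} {u : L2 𝒯.domain}
    {w : L2 (region (𝒯.patch i))} (h : 𝒯.IsWeightedProj K i u w) : 𝒯.localProj K i u = w :=
  (existsUnique_isWeightedProj K i u).unique (isWeightedProj_localProj K i u) h

theorem ae_patch {i : Pt d} {P : Pt d → Prop} (h : ∀ᵐ x ∂volume.restrict 𝒯.domain, P x) :
    ∀ᵐ x ∂volume.restrict (region (𝒯.patch i)), P x :=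
  ae_restrict_of_ae_restrict_of_subset (𝒯.region_patch_subset i) h

theorem localProj_add (K : ℕ) (i : Pt d) (u v : L2 𝒯.domain) :
    𝒯.localProj K i (u + v) = 𝒯.localProj K i u + 𝒯.localProj K i v := by
  have hsub := 𝒯.region_patch_subset i
  have hu := isWeightedProj_localProj K i u
  have hv := isWeightedProj_localProj K i v
  refine IsWeightedProj.eq_localProj ⟨Submodule.add_mem _ hu.1 hv.1, fun z hz => ?_⟩
  have e1 : ∫ x in region (𝒯.patch i), 𝒯.hat i x *
      ((𝒯.localProj K i u + 𝒯.localProj K i v : L2 (region (𝒯.patch i))) x * z x) =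
      ∫ x in region (𝒯.patch i), (𝒯.hat i x * (𝒯.localProj K i u x * z x) +
        𝒯.hat i x * (𝒯.localProj K i v x * z x)) := by
    refine integral_congr_ae ?_
    filter_upwards [Lp.coeFn_add (𝒯.localProj K i u) (𝒯.localProj K i v)] with x hx
    rw [hx, Pi.add_apply]
    ring
  have e2 : ∫ x in region (𝒯.patch i), 𝒯.hat i x * ((u + v : L2 𝒯.domain) x * z x) =
      ∫ x in region (𝒯.patch i), (𝒯.hat i x * (u x * z x) + 𝒯.hat i x * (v x * z x)) := by
    refine integral_congr_ae ?_
    filter_upwards [ae_patch (Lp.coeFn_add u v)] with x hx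
    rw [hx, Pi.add_apply]
    ring
  rw [e1, e2, integral_add, integral_add, hu.2 z hz, hv.2 z hz]
  · exact integrable_hat_mul hsub i (memLp_patch i u) (Lp.memLp z)
  · exact integrable_hat_mul hsub i (memLp_patch i v) (Lp.memLp z)
  · exact integrable_hat_mul hsub i (Lp.memLp _) (Lp.memLp z)
  · exact integrable_hat_mul hsub i (Lp.memLp _) (Lp.memLp z)

theorem localProj_smul (K : ℕ) (i : Pt d) (c : ℝ) (u : L2 𝒯.domain) :
    𝒯.localProj K i (c • u) = c • 𝒯.localProj K i u := by
  have hu := isWeightedProj_localProj K i u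
  refine IsWeightedProj.eq_localProj ⟨Submodule.smul_mem _ c hu.1, fun z hz => ?_⟩
  have e1 : ∫ x in region (𝒯.patch i), 𝒯.hat i x *
      ((c • 𝒯.localProj K i u : L2 (region (𝒯.patch i))) x * z x) =
      c * ∫ x in region (𝒯.patch i), 𝒯.hat i x * (𝒯.localProj K i u x * z x) := by
    rw [← integral_const_mul]
    refine integral_congr_ae ?_
    filter_upwards [Lp.coeFn_smul c (𝒯.localProj K i u)] with x hx
    rw [hx, Pi.smul_apply, smul_eq_mul]
    ring
  have e2 : ∫ x in region (𝒯.patch i), 𝒯.hat i x * ((c • u : L2 𝒯.domain) x * z x) =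
      c * ∫ x in region (𝒯.patch i), 𝒯.hat i x * (u x * z x) := by
    rw [← integral_const_mul]
    refine integral_congr_ae ?_
    filter_upwards [ae_patch (Lp.coeFn_smul c u)] with x hx
    rw [hx, Pi.smul_apply, smul_eq_mul]
    ring
  rw [e1, e2, hu.2 z hz]

theorem coeFn_hatMul (i : Pt d) (w : L2 (region (𝒯.patch i))) :
    𝒯.hatMul i w =ᵐ[volume.restrict 𝒯.domain]
      fun x => 𝒯.hat i x * (region (𝒯.patch i)).indicator w x :=
  MemLp.coeFn_toLp _

theorem coeFn_hatMul_patch (i : Pt d) (w : L2 (region (𝒯.patch i))) :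
    𝒯.hatMul i w =ᵐ[volume.restrict (region (𝒯.patch i))] fun x => 𝒯.hat i x * w x := by
  filter_upwards [ae_patch (coeFn_hatMul i w), ae_restrict_mem (measurableSet_region _)] with x h1 h2
  rw [h1, indicator_of_mem h2]

theorem hatMul_cell {i : Pt d} (w : L2 (region (𝒯.patch i))) {T : Simp d} (hT : T ∈ 𝒯.cells)
    (hi : i ∉ range T.points) : 𝒯.hatMul i w =ᵐ[volume.restrict (interior (body T))] 0 := by
  filter_upwards [ae_cell hT (coeFn_hatMul i w), ae_restrict_mem isOpen_interior.measurableSet]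
    with x h1 h2
  rw [h1, 𝒯.hat_of_notMem hT hi (interior_subset h2), zero_mul, Pi.zero_apply]

theorem ext_cells {u v : L2 𝒯.domain}
    (h : ∀ T ∈ 𝒯.cells, u =ᵐ[volume.restrict (interior (body T))] v) : u = v :=
  Lp.ext (ae_region_iff.2 h)

theorem hatMul_ext {i : Pt d} {w : L2 (region (𝒯.patch i))} {u : L2 𝒯.domain}
    (h : u =ᵐ[volume.restrict (region (𝒯.patch i))] fun x => 𝒯.hat i x * w x)
    (h0 : ∀ T ∈ 𝒯.cells, i ∉ range T.points → u =ᵐ[volume.restrict (interior (body T))] 0) :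
    𝒯.hatMul i w = u := by
  refine ext_cells fun T hT => ?_
  by_cases hi : i ∈ range T.points
  · exact ae_cell (mem_patch.2 ⟨hT, hi⟩) ((coeFn_hatMul_patch i w).trans h.symm)
  · exact (hatMul_cell w hT hi).trans (h0 T hT hi).symm

theorem hatMul_add (i : Pt d) (w z : L2 (region (𝒯.patch i))) :
    𝒯.hatMul i (w + z) = 𝒯.hatMul i w + 𝒯.hatMul i z := by
  refine hatMul_ext ?_ fun T hT hi => ?_
  · filter_upwards [ae_patch (Lp.coeFn_add (𝒯.hatMul i w) (𝒯.hatMul i z)), Lp.coeFn_add w z,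
      coeFn_hatMul_patch i w, coeFn_hatMul_patch i z] with x h1 h2 h3 h4
    rw [h1, h2, Pi.add_apply, Pi.add_apply, h3, h4, mul_add]
  · filter_upwards [ae_cell hT (Lp.coeFn_add (𝒯.hatMul i w) (𝒯.hatMul i z)),
      hatMul_cell w hT hi, hatMul_cell z hT hi] with x h1 h2 h3
    rw [h1, Pi.add_apply, h2, h3, Pi.zero_apply, add_zero]

theorem hatMul_smul (i : Pt d) (c : ℝ) (w : L2 (region (𝒯.patch i))) :
    𝒯.hatMul i (c • w) = c • 𝒯.hatMul i w := by
  refine hatMul_ext ?_ fun T hT hi => ?_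
  · filter_upwards [ae_patch (Lp.coeFn_smul c (𝒯.hatMul i w)), Lp.coeFn_smul c w,
      coeFn_hatMul_patch i w] with x h1 h2 h3
    rw [h1, h2, Pi.smul_apply, Pi.smul_apply, h3, smul_eq_mul, smul_eq_mul]
    ring
  · filter_upwards [ae_cell hT (Lp.coeFn_smul c (𝒯.hatMul i w)), hatMul_cell w hT hi]
      with x h1 h2
    rw [h1, Pi.smul_apply, h2, Pi.zero_apply, smul_zero]

theorem inner_hatMul (i : Pt d) (w : L2 (region (𝒯.patch i))) (u : L2 𝒯.domain) :
    inner ℝ (𝒯.hatMul i w) u = ∫ x in region (𝒯.patch i), 𝒯.hat i x * (w x * u x) := by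
  have h : ∀ x, inner ℝ (𝒯.hatMul i w x) (u x) = 𝒯.hatMul i w x * u x := fun x => by
    simp [mul_comm]
  rw [L2.inner_def]
  simp only [h]
  have e : ∫ x in 𝒯.domain, 𝒯.hatMul i w x * u x =
      ∫ x in 𝒯.domain, 𝒯.hat i x * ((region (𝒯.patch i)).indicator w x * u x) := by
    refine integral_congr_ae ?_
    filter_upwards [coeFn_hatMul i w] with x hx
    rw [hx, mul_assoc]
  rw [e, ← setIntegral_patch_hat_mul]
  refine integral_congr_ae ?_
  filter_upwards [ae_restrict_mem (measurableSet_region _)] with x hx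
  rw [indicator_of_mem hx]

/-- On a cell only the hats of its own vertices survive, so a global decomposition reduces to a
barycentric identity on each cell. -/
theorem sum_hatMul_eq {w : ∀ i, L2 (region (𝒯.patch i))} {v : L2 𝒯.domain}
    (h : ∀ T ∈ 𝒯.cells, ∀ᵐ x ∂volume.restrict (interior (body T)),
      ∑ k, bary T k x * w (T.points k) x = v x) :
    ∑ i ∈ 𝒯.vertices, 𝒯.hatMul i (w i) = v := by
  refine ext_cells fun T hT => ?_
  have h1 : ∀ᵐ x ∂volume.restrict (interior (body T)), ∀ i ∈ 𝒯.vertices, i ∉ range T.points →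
      𝒯.hatMul i (w i) x = 0 := by
    rw [Filter.eventually_all_finset]
    intro i _
    by_cases hi : i ∈ range T.points
    · exact Filter.Eventually.of_forall fun x h => absurd hi h
    · filter_upwards [hatMul_cell (w i) hT hi] with x hx _
      exact hx
  have h2 : ∀ᵐ x ∂volume.restrict (interior (body T)), ∀ k,
      𝒯.hatMul (T.points k) (w (T.points k)) x = bary T k x * w (T.points k) x := by
    rw [Filter.eventually_all]
    intro k
    filter_upwards [ae_cell (mem_patch.2 ⟨hT, mem_range_self k⟩)
      (coeFn_hatMul_patch (T.points k) (w (T.points k))),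
      ae_restrict_mem isOpen_interior.measurableSet] with x hx hxT
    rw [hx, 𝒯.hat_points hT k (interior_subset hxT)]
  filter_upwards [h T hT, h1, h2, ae_cell hT (Lp.coeFn_finsetSum 𝒯.vertices
    fun i => 𝒯.hatMul i (w i))] with x hx hx1 hx2 hx3
  classical
  rw [hx3, Finset.sum_apply, ← hx, ← Finset.sum_congr rfl fun k _ => hx2 k,
    ← Finset.sum_filter_add_sum_filter_not 𝒯.vertices (fun i => i ∈ range T.points)]
  rw [Finset.sum_eq_zero (s := 𝒯.vertices.filter fun i => ¬ i ∈ range T.points) fun i hi => by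
    exact hx1 i (Finset.mem_filter.1 hi).1 (Finset.mem_filter.1 hi).2, add_zero]
  have e : 𝒯.vertices.filter (fun i => i ∈ range T.points) = Finset.univ.image T.points := by
    ext i
    simp only [Finset.mem_filter, mem_range, Finset.mem_image, Finset.mem_univ, true_and]
    refine ⟨fun h => h.2, fun h => ⟨?_, h⟩⟩
    obtain ⟨k, rfl⟩ := h
    exact points_mem_vertices hT k
  rw [e, Finset.sum_image fun a _ b _ h => T.independent.injective h]

end Triangulation

/-- The extremal eigenvalues of a symmetric map on a finite-dimensional invariant subspace. -/
theorem exists_extremal_eigenvalues {H : Type*} [NormedAddCommGroup H] [InnerProductSpace ℝ H]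
    (W : Submodule ℝ H) [FiniteDimensional ℝ W] (hW : ∃ v ∈ W, v ≠ 0) {f : H → H}
    (hf : IsLinearMap ℝ f) (hmem : ∀ v ∈ W, f v ∈ W)
    (hsymm : ∀ v w, inner ℝ (f v) w = inner ℝ v (f w)) {a b : ℝ}
    (hlow : ∀ v ∈ W, a * ‖v‖ ^ 2 ≤ inner ℝ (f v) v)
    (hup : ∀ v ∈ W, inner ℝ (f v) v ≤ b * ‖v‖ ^ 2) :
    ∃ lmin lmax : ℝ, IsLeast {μ | ∃ v ∈ W, v ≠ 0 ∧ f v = μ • v} lmin ∧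
      IsGreatest {μ | ∃ v ∈ W, v ≠ 0 ∧ f v = μ • v} lmax ∧ a ≤ lmin ∧ lmax ≤ b ∧
      ∀ v ∈ W, lmin * ‖v‖ ^ 2 ≤ inner ℝ (f v) v := by
  let A : W →ₗ[ℝ] W := hf.mk'.restrict hmem
  have hA : A.IsSymmetric := fun v w => hsymm v.1 w.1
  obtain ⟨v₀, hv₀, hne⟩ := hW
  have hne' : (⟨v₀, hv₀⟩ : W) ≠ 0 := fun h => hne (congrArg Subtype.val h)
  have : Nontrivial W := ⟨⟨v₀, hv₀⟩, 0, hne'⟩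
  have heig : ∀ μ, (∃ v ∈ W, v ≠ 0 ∧ f v = μ • v) ↔ Module.End.HasEigenvalue A μ := by
    intro μ
    constructor
    · rintro ⟨v, hv, hv0, h⟩
      exact Module.End.hasEigenvalue_of_hasEigenvector (x := ⟨v, hv⟩)
        ⟨Module.End.mem_eigenspace_iff.2 (Subtype.ext h), fun h0 => hv0 (congrArg Subtype.val h0)⟩
    · intro h
      obtain ⟨v, hv, hv0⟩ := h.exists_hasEigenvector
      exact ⟨v.1, v.2, fun h0 => hv0 (Subtype.ext h0),
        congrArg Subtype.val (Module.End.mem_eigenspace_iff.1 hv)⟩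
  have hpos : ∀ v : H, v ≠ 0 → 0 < ‖v‖ ^ 2 := fun v hv => by positivity
  -- The infimum and supremum of the Rayleigh quotient are attained as eigenvalues, by symmetry and
  -- finite dimension; the two-sided form bound carries over to them.
  set R : {v : W // v ≠ 0} → ℝ := fun v => inner ℝ (f v.1.1) v.1.1 / ‖v.1.1‖ ^ 2 with hR
  have hv0 : ∀ v : {v : W // v ≠ 0}, v.1.1 ≠ 0 := fun v h => v.2 (Subtype.ext h)
  have hRlow : ∀ v, a ≤ R v := fun v => (le_div_iff₀ (hpos _ (hv0 v))).2 (hlow _ v.1.2)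
  have hRup : ∀ v, R v ≤ b := fun v => (div_le_iff₀ (hpos _ (hv0 v))).2 (hup _ v.1.2)
  have hbb : BddBelow (range R) := ⟨_, forall_mem_range.2 hRlow⟩
  have hba : BddAbove (range R) := ⟨_, forall_mem_range.2 hRup⟩
  have hN : Nonempty {v : W // v ≠ 0} := ⟨⟨⟨v₀, hv₀⟩, hne'⟩⟩
  have hRval : ∀ μ, (∃ v ∈ W, v ≠ 0 ∧ f v = μ • v) → ∃ v, R v = μ := by
    rintro μ ⟨v, hv, hv0, h⟩
    refine ⟨⟨⟨v, hv⟩, fun h0 => hv0 (congrArg Subtype.val h0)⟩, ?_⟩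
    simp only [hR]
    rw [h, real_inner_smul_left, real_inner_self_eq_norm_sq,
      mul_div_cancel_right₀ _ (hpos v hv0).ne']
  refine ⟨⨅ v, R v, ⨆ v, R v, ⟨?_, ?_⟩, ⟨?_, ?_⟩, le_ciInf hRlow, ciSup_le hRup, ?_⟩
  · exact (heig _).2 hA.hasEigenvalue_iInf_of_finiteDimensional
  · intro μ hμ
    obtain ⟨v, rfl⟩ := hRval μ hμ
    exact ciInf_le hbb v
  · exact (heig _).2 hA.hasEigenvalue_iSup_of_finiteDimensional
  · intro μ hμ
    obtain ⟨v, rfl⟩ := hRval μ hμ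
    exact le_ciSup hba v
  · intro v hv
    rcases eq_or_ne v 0 with rfl | hv0
    · simp [hf.map_zero]
    · have h1 := ciInf_le hbb ⟨⟨v, hv⟩, fun h => hv0 (congrArg Subtype.val h)⟩
      exact (le_div_iff₀ (hpos _ hv0)).1 h1

namespace Triangulation

variable {𝒯 : Triangulation d}

/-! ### The operator `C` -/

open Classical in
/-- The polynomial that represents the hat function of `i` on the simplex `T`. -/
def hatPoly (i : Pt d) (T : Simp d) : MvPolynomial (Fin d) ℝ :=
  if h : i ∈ range T.points then baryPoly T h.choose else 0

theorem evalAt_hatPoly (i : Pt d) {T : Simp d} (hT : T ∈ 𝒯.cells) {x : Pt d} (hx : x ∈ body T) :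
    evalAt (hatPoly i T) x = 𝒯.hat i x := by
  unfold hatPoly
  split_ifs with h
  · rw [evalAt_baryPoly, ← 𝒯.hat_points hT _ hx, h.choose_spec]
  · rw [evalAt_zero, 𝒯.hat_of_notMem hT h hx]

theorem hatPoly_totalDegree (i : Pt d) (T : Simp d) : (hatPoly i T).totalDegree ≤ 1 := by
  unfold hatPoly
  split_ifs
  · exact baryPoly_totalDegree _ _
  · simp

/-- At a common point of two cells either φ_i vanishes and both products are zero, or both cells
belong to the patch and the point lies in its open region, where w is compatible. -/
theorem hatMul_mem_space {K : ℕ} (hK : 1 ≤ K) {i : Pt d} {w : L2 (region (𝒯.patch i))}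
    (hw : w ∈ lagrange (𝒯.patch i) (K - 1)) : 𝒯.hatMul i w ∈ 𝒯.space K := by
  refine mem_lagrange_of_compatible (p := fun T => hatPoly i T * cellPoly (K - 1) T w) ?_ ?_ ?_
  · intro T hT T' hT' x hx hxT hxT'
    rw [evalAt_mul, evalAt_mul, evalAt_hatPoly i hT hxT, evalAt_hatPoly i hT' hxT']
    by_cases h : 𝒯.hat i x = 0
    · rw [h, zero_mul, zero_mul]
    · rw [compatible_cellPoly hw T (mem_patch_of_hat_ne_zero h hT hxT) T'
        (mem_patch_of_hat_ne_zero h hT' hxT') x (mem_region_patch_of_hat_ne_zero hx h) hxT hxT']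
  · intro T _
    rw [MvPolynomial.mem_restrictTotalDegree]
    refine (MvPolynomial.totalDegree_mul _ _).trans ?_
    have h1 := hatPoly_totalDegree i T
    have h2 := (MvPolynomial.mem_restrictTotalDegree _ _ _).1 (cellPoly (K - 1) T w).2
    omega
  · intro T hT
    by_cases hi : i ∈ range T.points
    · have hTi : T ∈ 𝒯.patch i := mem_patch.2 ⟨hT, hi⟩
      filter_upwards [ae_cell hTi (coeFn_hatMul_patch i w), eqOnCell_cellPoly hw hTi,
        ae_restrict_mem isOpen_interior.measurableSet] with x h1 h2 h3
      refine h1.trans ?_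
      rw [h2, evalAt_mul, evalAt_hatPoly i hT (interior_subset h3)]
    · filter_upwards [hatMul_cell w hT hi, ae_restrict_mem isOpen_interior.measurableSet]
        with x h1 h3
      refine h1.trans ?_
      rw [evalAt_mul, evalAt_hatPoly i hT (interior_subset h3),
        𝒯.hat_of_notMem hT hi (interior_subset h3), zero_mul, Pi.zero_apply]

theorem opC_mem_space {K : ℕ} (hK : 1 ≤ K) (u : L2 𝒯.domain) : 𝒯.opC K u ∈ 𝒯.space K :=
  Submodule.sum_mem _ fun i _ => hatMul_mem_space hK (isWeightedProj_localProj K i u).1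

theorem isLinearMap_opC (K : ℕ) : IsLinearMap ℝ (𝒯.opC K) where
  map_add u v := by
    simp only [opC, localProj_add, hatMul_add, Finset.sum_add_distrib]
  map_smul c u := by
    simp only [opC, localProj_smul, hatMul_smul, Finset.smul_sum]

/-- C_i u is an admissible test function for the projection C_i w, which replaces w by C_i w and
makes the form symmetric. -/
theorem inner_opC (K : ℕ) (u w : L2 𝒯.domain) :
    inner ℝ (𝒯.opC K u) w = ∑ i ∈ 𝒯.vertices,
      ∫ x in region (𝒯.patch i), 𝒯.hat i x * (𝒯.localProj K i u x * 𝒯.localProj K i w x) := by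
  rw [opC, sum_inner]
  refine Finset.sum_congr rfl fun i _ => ?_
  rw [inner_hatMul]
  have h := (isWeightedProj_localProj K i w).2 _ (isWeightedProj_localProj K i u).1
  simp only [mul_comm (𝒯.localProj K i u _)]
  exact h.symm

theorem inner_opC_comm (K : ℕ) (u w : L2 𝒯.domain) :
    inner ℝ (𝒯.opC K u) w = inner ℝ u (𝒯.opC K w) := by
  rw [real_inner_comm (𝒯.opC K w) u, inner_opC, inner_opC]
  simp only [mul_comm (𝒯.localProj K _ u _)]

theorem norm_sq_eq_integral (v : L2 𝒯.domain) : ‖v‖ ^ 2 = ∫ x in 𝒯.domain, v x * v x := by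
  rw [← real_inner_self_eq_norm_sq, L2.inner_def]
  simp only [real_inner_self_eq_norm_sq, Real.norm_eq_abs, sq_abs]
  simp only [sq]

theorem integrable_mul_self (v : L2 𝒯.domain) :
    Integrable (fun x => v x * v x) (volume.restrict 𝒯.domain) :=
  (Lp.memLp v).integrable_mul (Lp.memLp v)

theorem sum_integral_hat_mul (f : Pt d → ℝ)
    (hf : ∀ i, Integrable (fun x => 𝒯.hat i x * f x) (volume.restrict 𝒯.domain)) :
    ∑ i ∈ 𝒯.vertices, ∫ x in 𝒯.domain, 𝒯.hat i x * f x = ∫ x in 𝒯.domain, f x := by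
  rw [← integral_finsetSum _ fun i _ => hf i]
  refine integral_congr_ae (ae_region_iff.2 fun T hT => ?_)
  filter_upwards [ae_restrict_mem isOpen_interior.measurableSet] with x hx
  rw [← Finset.sum_mul, sum_hat hT (interior_subset hx), one_mul]

theorem inner_opC_self_le (K : ℕ) (v : L2 𝒯.domain) : inner ℝ (𝒯.opC K v) v ≤ ‖v‖ ^ 2 := by
  have hi : ∀ i, Integrable (fun x => 𝒯.hat i x * (v x * v x)) (volume.restrict 𝒯.domain) :=
    fun i => integrable_hat_mul subset_rfl i (Lp.memLp v) (Lp.memLp v)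
  rw [norm_sq_eq_integral, ← sum_integral_hat_mul (fun x => v x * v x) hi, inner_opC]
  refine Finset.sum_le_sum fun i _ => ?_
  rw [← setIntegral_patch_hat_mul]
  set w := 𝒯.localProj K i v with hw
  have hsub := 𝒯.region_patch_subset i
  have h1 : ∫ x in region (𝒯.patch i), 𝒯.hat i x * (w x * w x) =
      ∫ x in region (𝒯.patch i), 𝒯.hat i x * (v x * w x) :=
    (isWeightedProj_localProj K i v).2 w (isWeightedProj_localProj K i v).1
  have i1 := integrable_hat_mul hsub i (Lp.memLp w) (Lp.memLp w)
  have i2 := integrable_hat_mul hsub i (memLp_patch i v) (Lp.memLp w)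
  have i3 := integrable_hat_mul hsub i (memLp_patch i v) (memLp_patch i v)
  -- Contractivity of the projection: expand ∫ φ_i (v - w)² ≥ 0 and use that the mixed term equals ∫
  -- φ_i w².
  have h2 : 0 ≤ ∫ x in region (𝒯.patch i), (𝒯.hat i x * (v x * v x) -
      2 * (𝒯.hat i x * (v x * w x)) + 𝒯.hat i x * (w x * w x)) := by
    refine integral_nonneg fun x => ?_
    have := mul_nonneg (hat_nonneg (𝒯 := 𝒯) i x) (mul_self_nonneg (v x - w x))
    simp only [Pi.zero_apply]
    linarith
  have i4 : Integrable (fun x => 𝒯.hat i x * (v x * v x) - 2 * (𝒯.hat i x * (v x * w x)))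
      (volume.restrict (region (𝒯.patch i))) := i3.sub (i2.const_mul 2)
  rw [integral_add i4 i1, integral_sub i3 (i2.const_mul 2),
    integral_const_mul] at h2
  linarith

/-! ### The decomposition of the Lagrange space -/

theorem globalDecomp_eq {K : ℕ} (hK : 1 ≤ K) {i : Pt d} (v : Pt d → ℝ) {T : Simp d}
    (hT : T ∈ 𝒯.patch i) {x : Pt d} (hx : x ∈ interior (body T)) :
    𝒯.globalDecomp K i v x = evalAt (vertexDecomp K i (cellPoly K T v)) x := by
  obtain ⟨hTc, k, rfl⟩ := mem_patch.1 hT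
  rw [globalDecomp, Finset.sum_eq_single_of_mem T hTc, Finset.sum_eq_single k]
  · rw [if_pos rfl, indicator_of_mem hx, localDecomp_eq T hK]
  · intro j _ hj
    rw [if_neg fun h => hj (T.independent.injective h)]
  · simp
  · intro T' hT' hne
    refine Finset.sum_eq_zero fun j _ => ?_
    rw [indicator_of_notMem fun h => notMem_body_of_mem_interior hTc hT' hne.symm hx
      (interior_subset h), ite_self]

/-- The derivation towards c at x sees only values on the segment just before x. One-sidedness
matters: beyond x the ray may leave the cells. -/
theorem evalAt_radial_congr {p q : MvPolynomial (Fin d) ℝ} {c x : Pt d}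
    (h : ∀ᶠ s : ℝ in nhdsWithin 1 (Iic 1),
      evalAt p (c + s • (x - c)) = evalAt q (c + s • (x - c))) :
    evalAt (radial c p) x = evalAt (radial c q) x := by
  have h1 := (hasDerivAt_evalAt_combo p c x one_ne_zero).hasDerivWithinAt (s := Iic 1)
  have h2 := (hasDerivAt_evalAt_combo q c x one_ne_zero).hasDerivWithinAt (s := Iic 1)
  have h3 := h2.congr_of_eventuallyEq h (h.self_of_nhdsWithin (mem_Iic.2 le_rfl))
  have h4 := (uniqueDiffWithinAt_Iic (1 : ℝ)).eq_deriv _ h1 h3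
  simpa using h4

/-- Two cells of the patch that contain x both contain the segment from i to x by convexity. Near x
it lies in the open domain, where the cell polynomials of v agree, so their derivatives towards i
agree at x. -/
theorem compatible_vertexDecomp {K : ℕ} {v : L2 𝒯.domain} (hv : v ∈ 𝒯.space K) (i : Pt d) :
    Compatible (𝒯.patch i) fun T => vertexDecomp K i (cellPoly K T v) := by
  intro T hT T' hT' x hx hxT hxT'
  obtain ⟨hTc, hiT⟩ := mem_patch.1 hT
  obtain ⟨hTc', hiT'⟩ := mem_patch.1 hT'
  have hc : ∀ x ∈ region 𝒯.cells, x ∈ body T → x ∈ body T' →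
      evalAt (cellPoly K T v) x = evalAt (cellPoly K T' v) x :=
    compatible_cellPoly hv T hTc T' hTc'
  have hxΩ := 𝒯.region_patch_subset i hx
  have hcont : Continuous fun s : ℝ => i + s • (x - i) := by fun_prop
  have hmem : ∀ R : Simp d, i ∈ range R.points → x ∈ body R → ∀ s ∈ Icc (0 : ℝ) 1,
      i + s • (x - i) ∈ body R := fun R hi hxR s hs =>
    (convex_body R).add_smul_sub_mem (subset_convexHull ℝ _ hi) hxR hs
  simp only [vertexDecomp_apply, evalAt_add, evalAt_smul]
  rw [hc x hxΩ hxT hxT', evalAt_radial_congr]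
  have h1 : ∀ᶠ s : ℝ in nhds 1, i + s • (x - i) ∈ region 𝒯.cells :=
    hcont.continuousAt.eventually_mem ((isOpen_region _).mem_nhds (by
      rw [one_smul, add_sub_cancel]
      exact hxΩ))
  filter_upwards [nhdsWithin_le_nhds h1, self_mem_nhdsWithin,
    nhdsWithin_le_nhds (lt_mem_nhds (zero_lt_one (α := ℝ)))] with s hs hs1 hs0
  exact hc _ hs (hmem T hiT hxT s ⟨hs0.le, hs1⟩) (hmem T' hiT' hxT' s ⟨hs0.le, hs1⟩)

theorem exists_globalDecomp_mem {K : ℕ} (hK : 1 ≤ K) {v : L2 𝒯.domain} (hv : v ∈ 𝒯.space K)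
    (i : Pt d) : ∃ w ∈ lagrange (𝒯.patch i) (K - 1),
      (∀ T ∈ 𝒯.patch i, EqOnCell T w (vertexDecomp K i (cellPoly K T v))) ∧
      w =ᵐ[volume.restrict (region (𝒯.patch i))] 𝒯.globalDecomp K i v := by
  have hcell : ∀ T ∈ 𝒯.patch i,
      EqOnCell T (𝒯.globalDecomp K i v) (vertexDecomp K i (cellPoly K T v)) := fun T hT => by
    filter_upwards [ae_restrict_mem isOpen_interior.measurableSet] with x hx
    exact globalDecomp_eq hK v hT hx
  have hm : MemLp (𝒯.globalDecomp K i v) 2 (volume.restrict (region (𝒯.patch i))) :=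
    memLp_of_eqOnCell (fun T hT => ⟨_, hcell T hT⟩) 2
  have hw : ∀ T ∈ 𝒯.patch i,
      EqOnCell T hm.toLp (vertexDecomp K i (cellPoly K T v)) := fun T hT =>
    (ae_cell hT hm.coeFn_toLp).trans (hcell T hT)
  refine ⟨hm.toLp, mem_lagrange_of_compatible (compatible_vertexDecomp hv i) (fun T hT => ?_) hw,
    hw, hm.coeFn_toLp⟩
  obtain ⟨-, k, rfl⟩ := mem_patch.1 hT
  exact vertexDecomp_mem T hK k (cellPoly K T v).2

theorem norm_sq_eq_sum_ip {K : ℕ} {v : L2 𝒯.domain} (hv : v ∈ 𝒯.space K) :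
    ‖v‖ ^ 2 = ∑ T ∈ 𝒯.cells, ip T (cellPoly K T v) (cellPoly K T v) := by
  rw [norm_sq_eq_integral]
  refine (setIntegral_region subset_rfl (integrable_mul_self v)).trans ?_
  refine Finset.sum_congr rfl fun T hT => ?_
  rw [← setIntegral_congr_set (interior_body_ae_eq T), ip,
    ← setIntegral_congr_set (interior_body_ae_eq T)]
  refine integral_congr_ae ?_
  filter_upwards [eqOnCell_cellPoly hv hT] with x hx
  exact congrArg₂ (· * ·) hx hx

/-- Exchanging the sums over vertices and cells leaves, on each cell, the quadratic form of its
local operator. -/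
theorem sum_integral_globalDecomp_eq {K : ℕ} (hK : 1 ≤ K) {v : L2 𝒯.domain} (hv : v ∈ 𝒯.space K) :
    ∑ i ∈ 𝒯.vertices, ∫ x in 𝒯.domain, 𝒯.hat i x * |𝒯.globalDecomp K i v x| ^ 2 =
      ∑ T ∈ 𝒯.cells, decompForm T K (cellPoly K T v) (cellPoly K T v) := by
  have hint : ∀ i, IntegrableOn (fun x => 𝒯.hat i x * |𝒯.globalDecomp K i v x| ^ 2)
      (region (𝒯.patch i)) := fun i => by
    obtain ⟨w, -, -, hw⟩ := exists_globalDecomp_mem hK hv i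
    refine (integrable_hat_mul (𝒯.region_patch_subset i) i (Lp.memLp w) (Lp.memLp w)).congr ?_
    filter_upwards [hw] with x hx
    rw [hx, sq_abs, sq]
  have h1 : ∀ i, ∫ x in 𝒯.domain, 𝒯.hat i x * |𝒯.globalDecomp K i v x| ^ 2 =
      ∑ T ∈ 𝒯.cells, ∫ x in interior (body T), 𝒯.hat i x * |𝒯.globalDecomp K i v x| ^ 2 := by
    intro i
    rw [← setIntegral_patch_hat_mul, setIntegral_region (patch_subset i) (hint i)]
    rw [Finset.sum_subset (patch_subset i) fun T hT hTi => ?_]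
    · exact Finset.sum_congr rfl fun T _ => (setIntegral_congr_set (interior_body_ae_eq T)).symm
    · refine setIntegral_eq_zero_of_forall_eq_zero fun x hx => ?_
      rw [𝒯.hat_of_notMem hT (fun hi => hTi (mem_patch.2 ⟨hT, hi⟩)) hx, zero_mul]
  rw [Finset.sum_congr rfl fun i _ => h1 i, Finset.sum_comm]
  refine Finset.sum_congr rfl fun T hT => ?_
  rw [sum_vertices (g := fun i => ∫ x in interior (body T),
    𝒯.hat i x * |𝒯.globalDecomp K i v x| ^ 2) hT, decompForm]
  · refine Finset.sum_congr rfl fun k _ => ?_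
    rw [integ_apply, ← setIntegral_congr_set (interior_body_ae_eq T)]
    refine setIntegral_congr_fun isOpen_interior.measurableSet fun x hx => ?_
    rw [𝒯.hat_points hT k (interior_subset hx),
      globalDecomp_eq hK v (mem_patch.2 ⟨hT, mem_range_self k⟩) hx, sq_abs, sq, evalAt_mul,
      evalAt_mul, evalAt_baryPoly]
  · intro i hi
    refine setIntegral_eq_zero_of_forall_eq_zero fun x hx => ?_
    rw [𝒯.hat_of_notMem hT hi (interior_subset hx), zero_mul]

/-- The stability estimate of the decomposition operators. -/
theorem sum_integral_globalDecomp_le {K : ℕ} (hK : 1 ≤ K) {v : L2 𝒯.domain}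
    (hv : v ∈ 𝒯.space K) :
    ∑ i ∈ 𝒯.vertices, ∫ x in 𝒯.domain, 𝒯.hat i x * |𝒯.globalDecomp K i v x| ^ 2
      ≤ (2 * K + d) / K * ‖v‖ ^ 2 := by
  rw [sum_integral_globalDecomp_eq hK hv, norm_sq_eq_sum_ip hv, Finset.mul_sum]
  exact Finset.sum_le_sum fun T _ => decompForm_self_le T hK (cellPoly K T v).2

/-- Write v = ∑ φ_i D_i v and pair with v. As D_i v lies in the local space, v may be replaced there
by C_i v, and the stability estimate bounds the factor D_i v. -/
theorem norm_sq_le_inner_opC {K : ℕ} (hK : 1 ≤ K) {v : L2 𝒯.domain} (hv : v ∈ 𝒯.space K) :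
    ‖v‖ ^ 2 ≤ (2 * K + d) / K * inner ℝ (𝒯.opC K v) v := by
  choose w hw hwc hwg using exists_globalDecomp_mem hK hv
  set μ : ℝ := (2 * K + d) / K with hμ
  have hμ0 : 0 < μ := by positivity
  have hsum : ∑ i ∈ 𝒯.vertices, 𝒯.hatMul i (w i) = v := by
    refine sum_hatMul_eq fun T hT => ?_
    have hk : ∀ᵐ x ∂volume.restrict (interior (body T)), ∀ k, w (T.points k) x =
        evalAt (vertexDecomp K (T.points k) (cellPoly K T v)) x := by
      rw [Filter.eventually_all]
      exact fun k => hwc _ T (mem_patch.2 ⟨hT, mem_range_self k⟩)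
    filter_upwards [hk, eqOnCell_cellPoly hv hT] with x h1 h2
    refine Eq.trans ?_ ((sum_bary_mul_vertexDecomp T hK (cellPoly K T v).2 x).trans h2.symm)
    exact Finset.sum_congr rfl fun k _ => by rw [h1]
  have h1 : ‖v‖ ^ 2 = ∑ i ∈ 𝒯.vertices,
      ∫ x in region (𝒯.patch i), 𝒯.hat i x * (w i x * 𝒯.localProj K i v x) := by
    rw [← real_inner_self_eq_norm_sq]
    nth_rewrite 1 [← hsum]
    rw [sum_inner]
    refine Finset.sum_congr rfl fun i _ => ?_
    rw [inner_hatMul]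
    have h := (isWeightedProj_localProj K i v).2 _ (hw i)
    simp only [mul_comm (w i _)]
    exact h.symm
  -- Young's inequality ab ≤ a²/(2μ) + μb²/2, weighted so that the stability estimate turns the
  -- first sum into at most ‖v‖²/2, which is absorbed on the left.
  have h2 : ∀ i, ∫ x in region (𝒯.patch i), 𝒯.hat i x * (w i x * 𝒯.localProj K i v x) ≤
      (2 * μ)⁻¹ * (∫ x in 𝒯.domain, 𝒯.hat i x * |𝒯.globalDecomp K i v x| ^ 2) +
      μ / 2 * ∫ x in region (𝒯.patch i),
        𝒯.hat i x * (𝒯.localProj K i v x * 𝒯.localProj K i v x) := by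
    intro i
    have hsub := 𝒯.region_patch_subset i
    have e : ∫ x in 𝒯.domain, 𝒯.hat i x * |𝒯.globalDecomp K i v x| ^ 2 =
        ∫ x in region (𝒯.patch i), 𝒯.hat i x * (w i x * w i x) := by
      rw [← setIntegral_patch_hat_mul]
      refine integral_congr_ae ?_
      filter_upwards [hwg i] with x hx
      rw [hx, sq_abs, sq]
    rw [e, ← integral_const_mul, ← integral_const_mul, ← integral_add]
    · refine integral_mono (integrable_hat_mul hsub i (Lp.memLp _) (Lp.memLp _)) ?_ fun x => ?_
      · exact ((integrable_hat_mul hsub i (Lp.memLp _) (Lp.memLp _)).const_mul _).add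
          ((integrable_hat_mul hsub i (Lp.memLp _) (Lp.memLp _)).const_mul _)
      · simp only
        have h3 := mul_nonneg (hat_nonneg (𝒯 := 𝒯) i x)
          (mul_nonneg (inv_nonneg.2 (mul_pos two_pos hμ0).le)
            (mul_self_nonneg (w i x - μ * 𝒯.localProj K i v x)))
        have e3 : (2 * μ)⁻¹ * ((w i x - μ * 𝒯.localProj K i v x) *
            (w i x - μ * 𝒯.localProj K i v x)) = (2 * μ)⁻¹ * (w i x * w i x) -
            w i x * 𝒯.localProj K i v x +
            μ / 2 * (𝒯.localProj K i v x * 𝒯.localProj K i v x) := by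
          field_simp
          ring
        rw [e3] at h3
        linarith
    · exact (integrable_hat_mul hsub i (Lp.memLp _) (Lp.memLp _)).const_mul _
    · exact (integrable_hat_mul hsub i (Lp.memLp _) (Lp.memLp _)).const_mul _
  have h3 := Finset.sum_le_sum fun i (_ : i ∈ 𝒯.vertices) => h2 i
  rw [← h1, Finset.sum_add_distrib, ← Finset.mul_sum, ← Finset.mul_sum, ← inner_opC] at h3
  have h4 := mul_le_mul_of_nonneg_left (sum_integral_globalDecomp_le hK hv)
    (inv_nonneg.2 (mul_pos two_pos hμ0).le)
  rw [← hμ] at h4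
  have e4 : (2 * μ)⁻¹ * (μ * ‖v‖ ^ 2) = ‖v‖ ^ 2 / 2 := by field_simp
  linarith

/-- The operator `C` reproduces the Lagrange functions of degree `K - 1`. -/
theorem opC_eq_self {K : ℕ} {v : L2 𝒯.domain} (hv : v ∈ 𝒯.space (K - 1)) : 𝒯.opC K v = v := by
  set r : ∀ i, L2 (region (𝒯.patch i)) := fun i => (memLp_patch i v).toLp
  have hr : ∀ i, r i =ᵐ[volume.restrict (region (𝒯.patch i))] v := fun i =>
    (memLp_patch i v).coeFn_toLp
  have hproj : ∀ i, 𝒯.localProj K i v = r i := fun i => by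
    refine IsWeightedProj.eq_localProj ⟨?_, fun z _ => ?_⟩
    · refine mem_lagrange_of_compatible (p := fun T => cellPoly (K - 1) T v) ?_
        (fun T _ => (cellPoly (K - 1) T v).2) fun T hT =>
          (ae_cell hT (hr i)).trans (eqOnCell_cellPoly hv (patch_subset i hT))
      intro T hT T' hT' x hx
      exact compatible_cellPoly hv T (patch_subset i hT) T' (patch_subset i hT') x
        (𝒯.region_patch_subset i hx)
    · refine integral_congr_ae ?_
      filter_upwards [hr i] with x hx
      rw [hx]
  rw [opC, Finset.sum_congr rfl fun i _ => by rw [hproj i]]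
  refine sum_hatMul_eq fun T hT => ?_
  have hk : ∀ᵐ x ∂volume.restrict (interior (body T)), ∀ k, r (T.points k) x = v x := by
    rw [Filter.eventually_all]
    exact fun k => ae_cell (mem_patch.2 ⟨hT, mem_range_self k⟩) (hr (T.points k))
  filter_upwards [hk] with x hx
  simp only [hx]
  rw [← Finset.sum_mul, sum_bary, one_mul]

/-! ### Locality of `opC` -/

theorem localProj_eq_zero {K : ℕ} {i : Pt d} {u : L2 𝒯.domain}
    (h : u =ᵐ[volume.restrict (region (𝒯.patch i))] 0) : 𝒯.localProj K i u = 0 := by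
  refine IsWeightedProj.eq_localProj ⟨Submodule.zero_mem _, fun z _ => ?_⟩
  refine integral_congr_ae ?_
  filter_upwards [h, Lp.coeFn_zero ℝ 2 (volume.restrict (region (𝒯.patch i)))] with x h1 h2
  rw [h1, h2]

/-- The operator `C` spreads the support by at most one layer of simplices. -/
theorem exists_delta_le_one (K : ℕ) (L : Set {T // T ∈ 𝒯.cells}) (v : L2 𝒯.domain)
    (hv : ∀ᵐ x ∂volume.restrict 𝒯.domain, (∀ T ∈ L, x ∉ body T.1) → v x = 0)
    (T' : {T // T ∈ 𝒯.cells})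
    (hT' : ¬ ∀ᵐ x ∂volume.restrict (interior (body T'.1)), 𝒯.opC K v x = 0) :
    ∃ T ∈ L, 𝒯.delta T' T ≤ 1 := by
  by_contra! hfar
  refine hT' ?_
  -- Each cell of the patch of a vertex of T' is T' itself or one of its neighbours. None of them is
  -- in L, so v vanishes on the whole patch.
  have hzero : ∀ i ∈ range T'.1.points, 𝒯.localProj K i v = 0 := by
    intro i hi
    refine localProj_eq_zero (ae_region_iff.2 fun T hT => ?_)
    filter_upwards [ae_restrict_of_ae_restrict_of_subset
      (interior_subset_region (patch_subset i hT)) hv, ae_restrict_mem isOpen_interior.measurableSet]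
      with x hx hxT
    refine hx fun R hR hxR => ?_
    have hTR : T = R.1 := by
      by_contra hne
      exact notMem_body_of_mem_interior (patch_subset i hT) R.2 hne hxT hxR
    subst hTR
    have h1 := hfar R hR
    by_cases hTR' : T' = R
    · rw [hTR', delta, SimpleGraph.dist_self] at h1
      omega
    · have : 𝒯.neighborGraph.Adj T' R := ⟨hTR', i, hi, (mem_patch.1 hT).2⟩
      rw [(delta_eq_one_iff _ _).2 this] at h1
      omega
  have h1 : ∀ᵐ x ∂volume.restrict (interior (body T'.1)), ∀ i ∈ 𝒯.vertices,
      𝒯.hatMul i (𝒯.localProj K i v) x = 0 := by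
    rw [Filter.eventually_all_finset]
    intro i _
    by_cases hi : i ∈ range T'.1.points
    · have hz := coeFn_hatMul_patch i (𝒯.localProj K i v)
      rw [hzero i hi] at hz ⊢
      filter_upwards [ae_cell (mem_patch.2 ⟨T'.2, hi⟩) hz,
        ae_cell (mem_patch.2 ⟨T'.2, hi⟩)
          (Lp.coeFn_zero ℝ 2 (volume.restrict (region (𝒯.patch i))))] with x hx hx0
      rw [hx, hx0, Pi.zero_apply, mul_zero]
    · exact hatMul_cell _ T'.2 hi
  filter_upwards [h1, ae_cell T'.2 (Lp.coeFn_finsetSum 𝒯.vertices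
    fun i => 𝒯.hatMul i (𝒯.localProj K i v))] with x hx hx2
  rw [opC, hx2, Finset.sum_apply]
  exact Finset.sum_eq_zero hx

/-! ### The condition number -/

theorem exists_space_ne_zero (K : ℕ) : ∃ v ∈ 𝒯.space K, v ≠ 0 := by
  have h1 : ∀ T ∈ 𝒯.cells, EqOnCell T (fun _ => 1) 1 := fun T _ =>
    Filter.Eventually.of_forall fun x => (evalAt_one x).symm
  have hm : MemLp (fun _ : Pt d => (1 : ℝ)) 2 (volume.restrict 𝒯.domain) :=
    memLp_of_eqOnCell (fun T hT => ⟨1, h1 T hT⟩) 2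
  refine ⟨hm.toLp, mem_lagrange_of_compatible (p := fun _ => 1) (fun _ _ _ _ _ _ _ _ => rfl)
    (fun T _ => ?_) fun T hT => (ae_cell hT hm.coeFn_toLp).trans (h1 T hT), fun h0 => ?_⟩
  · rw [MvPolynomial.mem_restrictTotalDegree]
    simp
  · obtain ⟨T, hT⟩ := cells_nonempty (𝒯 := 𝒯)
    have h2 : EqOnCell T hm.toLp 1 := (ae_cell hT hm.coeFn_toLp).trans (h1 T hT)
    have h3 : EqOnCell T hm.toLp 0 := by
      rw [h0]
      filter_upwards [ae_cell hT (Lp.coeFn_zero ℝ 2 (volume.restrict 𝒯.domain))] with x hx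
      rw [hx, Pi.zero_apply, evalAt_zero]
    exact one_ne_zero (h2.unique h3)

end Triangulation

/-! ### The decay parameter -/

theorem decayParam_eq_qNew (d : ℕ) {K : ℕ} (hK : 1 ≤ K) :
    decayParam ((2 * K + d) / K) = qNew d K := by
  have hK' : (0 : ℝ) < K := by positivity
  have hs : (0 : ℝ) < √K := Real.sqrt_pos.2 hK'
  have hs2 : (0 : ℝ) ≤ √(2 * K + d) := Real.sqrt_nonneg _
  rw [decayParam, qNew, Real.sqrt_div (by positivity)]
  field_simp

theorem decayParam_mono {a b : ℝ} (h : a ≤ b) : decayParam a ≤ decayParam b := by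
  have h1 := Real.sqrt_le_sqrt h
  have h2 := Real.sqrt_nonneg a
  rw [decayParam, decayParam, div_le_div_iff₀ (by linarith) (by linarith)]
  linarith

/-- All eigenvalues lie between K/(2K + d), from the stable decomposition, and 1, from the
contractivity of the projections; the quotient of these bounds is the asserted one. -/
theorem exists_condition_bound {K : ℕ} (hK : 1 ≤ K) (𝒯 : Triangulation d) :
    ∃ lmin lmax : ℝ, IsLeast (𝒯.eigenvaluesC K) lmin ∧ IsGreatest (𝒯.eigenvaluesC K) lmax ∧
      0 < lmin ∧ (∀ v ∈ 𝒯.space K, lmin * ‖v‖ ^ 2 ≤ inner ℝ (𝒯.opC K v) v) ∧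
      lmax / lmin ≤ (2 * K + d) / K ∧ decayParam (lmax / lmin) ≤ qNew d K := by
  have hK' : (0 : ℝ) < K := by positivity
  have hd : (0 : ℝ) < 2 * K + d := by positivity
  have hfin : FiniteDimensional ℝ (𝒯.space K) := finiteDimensional_lagrange _ _
  obtain ⟨lmin, lmax, h1, h2, h3, h4, h5⟩ := exists_extremal_eigenvalues (𝒯.space K)
    (Triangulation.exists_space_ne_zero K) (Triangulation.isLinearMap_opC K)
    (fun v _ => Triangulation.opC_mem_space hK v) (Triangulation.inner_opC_comm K)
    (a := K / (2 * K + d)) (b := 1)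
    (fun v hv => by
      have h := Triangulation.norm_sq_le_inner_opC hK hv
      rw [div_mul_eq_mul_div, le_div_iff₀ hK'] at h
      rw [div_mul_eq_mul_div, div_le_iff₀ hd]
      linarith)
    (fun v _ => by
      rw [one_mul]
      exact Triangulation.inner_opC_self_le K v)
  have hpos : 0 < lmin := lt_of_lt_of_le (by positivity) h3
  have hcond : lmax / lmin ≤ (2 * K + d) / K := by
    rw [div_le_div_iff₀ hpos hK']
    rw [div_le_iff₀ hd] at h3
    have := mul_le_mul_of_nonneg_right h4 hK'.le
    linarith
  refine ⟨lmin, lmax, h1, h2, hpos, h5, hcond, ?_⟩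
  rw [← decayParam_eq_qNew d hK]
  exact decayParam_mono hcond

end LagrangeFE

end

/-! ### The main theorem -/

theorem theorem3p2 {d K : ℕ} (hd : 1 ≤ d) (hK : 1 ≤ K) (𝒯 : LagrangeFE.Triangulation d) :
    -- the weighted projections `C_i` are well defined
    (∀ i ∈ 𝒯.vertices, ∀ u : LagrangeFE.L2 𝒯.domain, ∃! w, 𝒯.IsWeightedProj K i u w) ∧
    -- (C1) `C` is linear and self-adjoint, with values in the Lagrange space of degree `K`
    ((∀ u, 𝒯.opC K u ∈ 𝒯.space K) ∧ IsLinearMap ℝ (𝒯.opC K) ∧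
      ∀ u w : LagrangeFE.L2 𝒯.domain, inner ℝ (𝒯.opC K u) w = inner ℝ u (𝒯.opC K w)) ∧
    -- (C2) ellipticity, the bound on the condition number, and the resulting decay parameter
    (∃ lmin lmax : ℝ, IsLeast (𝒯.eigenvaluesC K) lmin ∧ IsGreatest (𝒯.eigenvaluesC K) lmax ∧
      0 < lmin ∧ (∀ v ∈ 𝒯.space K, lmin * ‖v‖ ^ 2 ≤ inner ℝ (𝒯.opC K v) v) ∧
      lmax / lmin ≤ (2 * K + d) / K ∧
      LagrangeFE.decayParam (lmax / lmin) ≤ LagrangeFE.qNew d K) ∧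
    LagrangeFE.decayParam ((2 * K + d) / K) = LagrangeFE.qNew d K ∧
    -- (C3) `δ` is the geodesic metric induced by the vertex neighbours
    ((∀ T T', 𝒯.neighborGraph.Adj T T' ↔ 𝒯.delta T T' = 1) ∧
      (∀ T T', 𝒯.delta T T' = 1 ↔
        T ≠ T' ∧ (LagrangeFE.body T.1 ∩ LagrangeFE.body T'.1).Nonempty) ∧
      (∀ T T', IsLeast {N : ℕ | ∃ c : ℕ → {T // T ∈ 𝒯.cells}, c 0 = T ∧ c N = T' ∧
        ∀ j < N, 𝒯.delta (c j) (c (j + 1)) = 1} (𝒯.delta T T')) ∧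
      (∀ T T', 𝒯.delta T T' = 0 ↔ T = T') ∧
      (∀ T T', 𝒯.delta T T' = 𝒯.delta T' T) ∧
      (∀ T T' T'', 𝒯.delta T T'' ≤ 𝒯.delta T T' + 𝒯.delta T' T'')) ∧
    -- (C4) locality
    (∀ (L : Set {T // T ∈ 𝒯.cells}) (v : LagrangeFE.L2 𝒯.domain),
      (∀ᵐ x ∂(MeasureTheory.volume.restrict 𝒯.domain),
        (∀ T ∈ L, x ∉ LagrangeFE.body T.1) → v x = 0) →
      ∀ T' : {T // T ∈ 𝒯.cells},
        (¬ ∀ᵐ x ∂(MeasureTheory.volume.restrict (interior (LagrangeFE.body T'.1))),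
          𝒯.opC K v x = 0) →
        ∃ T ∈ L, 𝒯.delta T' T ≤ 1) ∧
    -- `C` is the identity on the Lagrange space of degree `K - 1`
    (∀ v ∈ 𝒯.space (K - 1), 𝒯.opC K v = v) ∧
    -- the local operators are well defined
    (∀ T ∈ 𝒯.cells, (∃! D, LagrangeFE.IsLocalDecomp T K D) ∧
      ∃! S, LagrangeFE.IsLocalOp T K S) ∧
    -- the stability estimate of the decomposition operators `D_i`
    (∀ v ∈ 𝒯.space K,
      (∑ i ∈ 𝒯.vertices, ∫ x in 𝒯.domain, 𝒯.hat i x * |𝒯.globalDecomp K i v x| ^ 2)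
        ≤ (2 * K + d) / K * ‖v‖ ^ 2) ∧
    -- eigenvalues and eigenspaces of the local operator `S`
    (∀ T ∈ 𝒯.cells,
      (∀ k ≤ K, Module.End.eigenspace (LagrangeFE.localOp T K) (LagrangeFE.muVal d K k) =
          (LagrangeFE.Zspace T k).comap (LagrangeFE.Poly d K).subtype ∧
        Module.End.HasEigenvalue (LagrangeFE.localOp T K) (LagrangeFE.muVal d K k)) ∧
      ∀ μ : ℝ, Module.End.HasEigenvalue (LagrangeFE.localOp T K) μ →
        ∃ k ≤ K, μ = LagrangeFE.muVal d K k) := by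
  refine ⟨fun i _ u => LagrangeFE.Triangulation.existsUnique_isWeightedProj K i u,
    ⟨LagrangeFE.Triangulation.opC_mem_space hK, LagrangeFE.Triangulation.isLinearMap_opC K,
      LagrangeFE.Triangulation.inner_opC_comm K⟩,
    LagrangeFE.exists_condition_bound hK 𝒯, LagrangeFE.decayParam_eq_qNew d hK,
    ⟨fun T T' => (LagrangeFE.Triangulation.delta_eq_one_iff T T').symm,
      fun T T' => (LagrangeFE.Triangulation.delta_eq_one_iff T T').trans
        (LagrangeFE.Triangulation.neighborGraph_adj_iff T T'),
      LagrangeFE.Triangulation.isLeast_delta,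
      fun T T' => LagrangeFE.Triangulation.neighborGraph_connected.dist_eq_zero_iff,
      fun T T' => SimpleGraph.dist_comm,
      fun T T' T'' => LagrangeFE.Triangulation.neighborGraph_connected.dist_triangle⟩,
    LagrangeFE.Triangulation.exists_delta_le_one K,
    fun v hv => LagrangeFE.Triangulation.opC_eq_self hv,
    fun T _ => ⟨LagrangeFE.existsUnique_isLocalDecomp T hK, LagrangeFE.existsUnique_isLocalOp T hK⟩,
    fun v hv => LagrangeFE.Triangulation.sum_integral_globalDecomp_le hK hv,
    fun T _ => ⟨fun k hk => ⟨LagrangeFE.eigenspace_localOp T hK hk,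
      LagrangeFE.hasEigenvalue_localOp hd T hK hk⟩,
      fun μ h => LagrangeFE.exists_eq_muVal_of_hasEigenvalue T hK h⟩⟩
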